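/- Time is the number of steps of a deterministic multitape Turing machine, and space is the number of tape cells visited on all tapes, the input and output tapes included. Integers are written in binary, each integer in an input or output list being followed by a separator; to enumerate a finite set of primes means to write the list of its elements, in increasing order, on the output tape and halt. $\log$ is the natural logarithm. (a) There are a multitape Turing machine and a constant $C$ such that the machine, given any integer $N \ge 0$, enumerates the primes $p \le N$ and, if $N \ge 3$, does so in time at most $C\, N \log^2 N \log\log N$ and space at most $C\, N \log N \log\log N$. (b) There are a multitape Turing machine and a constant $C$ such that the machine, given any integers $0 \le M \le N$, enumerates the primes $M < p \le N$ and, if $N \ge 3$, does so in time at most $C\, (N-M+\sqrt N) \log^2 N \log\log N$ and space at most $C\, (N-M+\sqrt N) \log N \log\log N$. -/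

import Mathlib

/-- A head movement of a Turing machine. -/
inductive HeadMove where
  | left
  | stay
  | right
  deriving DecidableEq

/-- The displacement of the head caused by a movement. -/
def HeadMove.shift : HeadMove → ℤ
  | .left => -1
  | .stay => 0
  | .right => 1

/-- The input/output alphabet: binary digits and a separator. -/
inductive IOSymbol where
  | bit (b : Bool)
  | sep
  deriving DecidableEq

/-- A deterministic multitape Turing machine: finitely many tapes, each infinite in both directions
with one read/write head, a finite tape alphabet and a finite set of states. -/
structure MultitapeTM where
  /-- the (finite) index set of the tapes -/
  Tp : Type
  /-- the (finite) tape alphabet -/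
  Γ : Type
  /-- the (finite) set of states -/
  Q : Type
  [fintypeTp : Fintype Tp]
  [decEqTp : DecidableEq Tp]
  [finiteΓ : Finite Γ]
  [finiteQ : Finite Q]
  /-- the input/output symbols and the blank `sym none`, pairwise distinct tape symbols -/
  sym : Option IOSymbol ↪ Γ
  /-- the tape that carries the input at the start -/
  inTape : Tp
  /-- the tape that carries the output at the end -/
  outTape : Tp
  /-- the initial state -/
  start : Q
  /-- the transition function: from the state and the scanned symbols it gives the new state and,
  for each tape, the symbol to write and the head movement; `none` means that the machine halts -/
  δ : Q → (Tp → Γ) → Option (Q × (Tp → Γ × HeadMove))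

namespace MultitapeTM

attribute [instance] fintypeTp decEqTp finiteΓ finiteQ

variable (T : MultitapeTM)

/-- A configuration: the state, the head positions and the contents of the tapes. -/
structure Cfg where
  state : T.Q
  head : T.Tp → ℤ
  tape : T.Tp → ℤ → T.Γ

/-- The tape that holds the word `w` in the cells `0, …, w.length - 1` and is blank elsewhere. -/
def wordTape (w : List IOSymbol) : ℤ → T.Γ :=
  fun x => if 0 ≤ x then T.sym w[x.toNat]? else T.sym none

/-- The initial configuration on input `w`: all heads are at cell `0`, and all tapes other than the
input tape are blank. -/
def init (w : List IOSymbol) : T.Cfg where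
  state := T.start
  head := fun _ => 0
  tape := fun i => if i = T.inTape then T.wordTape w else T.wordTape []

/-- One step of the machine; `none` if the machine has halted. -/
def step (c : T.Cfg) : Option T.Cfg :=
  (T.δ c.state fun i => c.tape i (c.head i)).map fun a =>
    { state := a.1
      head := fun i => c.head i + (a.2 i).2.shift
      tape := fun i => Function.update (c.tape i) (c.head i) (a.2 i).1 }

/-- The configuration after `t` steps on input `w` (a halted machine stays where it is). -/
def run (w : List IOSymbol) (t : ℕ) : T.Cfg :=
  (fun c => (T.step c).getD c)^[t] (T.init w)

/-- On input `w` the machine halts after at most `t` steps, and then the output tape holds exactly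
the word `v`. -/
def OutputsWithin (w v : List IOSymbol) (t : ℕ) : Prop :=
  T.step (T.run w t) = none ∧ (T.run w t).tape T.outTape = T.wordTape v

/-- The number of tape cells, over all tapes (including input and output), that are visited
in the first `t` steps on input `w`. -/
def space (w : List IOSymbol) (t : ℕ) : ℕ :=
  ∑ i : T.Tp, ((Finset.range (t + 1)).image fun n => (T.run w n).head i).card

end MultitapeTM

/-- The binary digits of `n`, least significant digit first. -/
def binaryWord (n : ℕ) : List IOSymbol :=
  n.bits.map IOSymbol.bit

/-- The word that lists the given numbers in binary, each followed by a separator. -/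
def listWord (l : List ℕ) : List IOSymbol :=
  l.flatMap fun n => binaryWord n ++ [IOSymbol.sep]

/-- The primes `M < p ≤ N` in increasing order. -/
def primesBetween (M N : ℕ) : List ℕ :=
  (List.range (N + 1)).filter fun p => M < p ∧ p.Prime

set_option linter.unusedSectionVars false

namespace TapeProgram

/-! ### A structured programming language for stacks of symbols -/

/-! The machine runs the sieve of Eratosthenes on `(M, N]`, with sorting in place of random access.
Let `R` be a power of two with `N < R²` and, for `N > 0`, `R² ≤ 4N`. For each prime `p ≤ R` the
multiples of `p` in the interval, from `2p` on, are written on a list. The list is sorted, and one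
scan of it yields the numbers that are missing. These are the primes, once `1` is excluded: a
composite `n ≤ N` has a prime factor below `R`, and no prime is a proper multiple of a `p ≥ 2`.

The list has at most `∑ ((N - M) / p + 1) ≤ (N - M) ∑ 1/p + R` entries. Chebyshev's bound on
primorials, applied to dyadic intervals, gives `∑ 1/p = O(log log N)` over the primes up to `R`
(`sum_inv_primes_le`), so a budget `Z = O((N - M + √N) log log N)` suffices (`exists_budget`). The
first multiple of each `p` is found by binary long division in `O(log N)` operations, and a radix
sort makes `O(log N)` passes of `O(Z)` operations each (`run_sieve`). An operation on numbers of
`O(log N)` digits takes `O(log N)` steps. This makes `O(Z log² N)` steps on tapes that hold `O(Z log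
N)` symbols.

The primes up to `R` come from the same sieve. Let `R'` be of order `√R` with `R < R'²`. All
integers from `2` to `R'` sieve `(1, R']`, with at most `R'² ≤ 4R` marks, and the primes so found
sieve `(1, R]`. Sieving `(1, R]` by all integers up to `R'` at once would make about `√N log N`
marks, too many when `N - M` is small.

Programs are written in a structured language acting on stacks, one stack per tape. `Exec.flatRun`
translates them to code with jumps, and `Prog.machine_spec` carries time and space over to a Turing
machine. Part (a) is the case `M = 0`, where `√N ≤ N`. -/

instance : Fintype IOSymbol :=
  ⟨{.bit true, .bit false, .sep}, by rintro ((_ | _) | _) <;> simp⟩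

/-- What a program may do with a stack in one step. -/
inductive Action where
  | keep
  | pop
  | push (a : IOSymbol)
  | set (a : IOSymbol)
  deriving Fintype

/-- The effect of an action on a stack, the top of the stack being the head of the list. -/
def Action.apply : Action → List IOSymbol → List IOSymbol
  | .keep, l => l
  | .pop, l => l.tail
  | .push a, l => a :: l
  | .set _, [] => []
  | .set a, _ :: l => a :: l

/-- A family of stacks indexed by `τ`. -/
abbrev Stacks (τ : Type) := τ → List IOSymbol

/-- The top symbols of the stacks. -/
def tops {τ : Type} (s : Stacks τ) : τ → Option IOSymbol := fun i => (s i).head?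

/-- Structured programs that act on stacks; tests and actions depend on the top symbols. -/
inductive Prog (τ : Type) where
  | basic (f : (τ → Option IOSymbol) → τ → Action)
  | seq (p q : Prog τ)
  | ite (c : (τ → Option IOSymbol) → Bool) (p q : Prog τ)
  | loop (c : (τ → Option IOSymbol) → Bool) (p : Prog τ)

/-- `Exec ok p s t s'`: the program `p` leads from `s` to `s'` in `t` steps, and all states on the
way satisfy `ok`. -/
inductive Exec {τ : Type} (ok : Stacks τ → Prop) : Prog τ → Stacks τ → ℕ → Stacks τ → Prop where
  | basic {f s} : ok s → ok (fun i => (f (tops s) i).apply (s i)) →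
      Exec ok (.basic f) s 1 (fun i => (f (tops s) i).apply (s i))
  | seq {p q s t s' t' s''} : Exec ok p s t s' → Exec ok q s' t' s'' →
      Exec ok (.seq p q) s (t + t') s''
  -- The code of this branch ends with a jump over the alternative, hence one step more than in
  -- `ite_false`. In `loop_true` the second extra step is the jump back.
  | ite_true {c p q s t s'} : ok s → c (tops s) = true → Exec ok p s t s' →
      Exec ok (.ite c p q) s (t + 2) s'
  | ite_false {c p q s t s'} : ok s → c (tops s) = false → Exec ok q s t s' →
      Exec ok (.ite c p q) s (t + 1) s'
  | loop_false {c p s} : ok s → c (tops s) = false → Exec ok (.loop c p) s 1 s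
  | loop_true {c p s t s' t' s''} : ok s → c (tops s) = true → Exec ok p s t s' →
      Exec ok (.loop c p) s' t' s'' → Exec ok (.loop c p) s (t + 2 + t') s''

/-! ### Compilation of structured programs to code with jumps -/

section Flat

variable {τ : Type}

/-- An instruction of unstructured code: actions and the next value of the program counter. -/
abbrev Instr (τ : Type) := (τ → Option IOSymbol) → (τ → Action) × ℕ

/-- The number of instructions of the code of a program. -/
def Prog.size : Prog τ → ℕ
  | .basic _ => 1
  | .seq p q => p.size + q.size
  | .ite _ p q => p.size + q.size + 2
  | .loop _ p => p.size + 2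

/-- The code of a program that is placed at address `b`. -/
def Prog.code : Prog τ → ℕ → List (Instr τ)
  | .basic f, b => [fun v => (f v, b + 1)]
  | .seq p q, b => p.code b ++ q.code (b + p.size)
  | .ite c p q, b =>
      (fun v => (fun _ => .keep, if c v then b + 1 else b + 1 + p.size + 1)) ::
        (p.code (b + 1) ++
          (fun _ => (fun _ => .keep, b + (p.size + q.size + 2))) :: q.code (b + 1 + p.size + 1))
  | .loop c p, b =>
      (fun v => (fun _ => .keep, if c v then b + 1 else b + (p.size + 2))) ::
        (p.code (b + 1) ++ [fun _ => (fun _ => .keep, b)])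

theorem Prog.length_code (p : Prog τ) (b : ℕ) : (p.code b).length = p.size := by
  induction p generalizing b with
  | basic f => rfl
  | seq p q hp hq => simp [Prog.code, Prog.size, hp, hq]
  | ite c p q hp hq => simp [Prog.code, Prog.size, hp, hq]; omega
  | loop c p hp => simp [Prog.code, Prog.size, hp]

/-- The code runs from one pair of program counter and stacks to another one. -/
inductive FlatRun (ok : Stacks τ → Prop) (code : List (Instr τ)) :
    ℕ → Stacks τ → ℕ → ℕ → Stacks τ → Prop where
  | refl {pc s} : ok s → FlatRun ok code pc s 0 pc s
  | step {pc s I t pc' s'} : code[pc]? = some I → ok s →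
      FlatRun ok code (I (tops s)).2 (fun i => ((I (tops s)).1 i).apply (s i)) t pc' s' →
      FlatRun ok code pc s (t + 1) pc' s'

theorem FlatRun.trans {ok : Stacks τ → Prop} {code : List (Instr τ)} {pc s t pc' s' t' pc'' s''}
    (h : FlatRun ok code pc s t pc' s') (h' : FlatRun ok code pc' s' t' pc'' s'') :
    FlatRun ok code pc s (t + t') pc'' s'' := by
  induction h with
  | refl => simpa using h'
  | @step pc s I t _ _ hI hs _ ih =>
    rw [show t + 1 + t' = (t + t') + 1 by omega]
    exact .step hI hs (ih h')

theorem Exec.ok_end {ok : Stacks τ → Prop} {p : Prog τ} {s t s'} (h : Exec ok p s t s') :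
    ok s' := by
  induction h <;> assumption

theorem Exec.ok_start {ok : Stacks τ → Prop} {p : Prog τ} {s t s'} (h : Exec ok p s t s') :
    ok s := by
  induction h <;> assumption

theorem getElem?_of_eq_append {α : Type*} {L l r : List α} {x : α} {n : ℕ} (h : L = l ++ x :: r)
    (hn : l.length = n) : L[n]? = some x := by
  subst h hn
  simp

/-- Jump targets are absolute, so the code has to sit at its address `b` inside a larger list; this
is why all surroundings `pre` and `suf` are allowed. The remaining rounds of a loop run the same
code again, which induction on the execution, rather than on the program, supplies. -/
theorem Exec.flatRun {ok : Stacks τ → Prop} {p : Prog τ} {s t s'} (h : Exec ok p s t s') :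
    ∀ (code pre suf : List (Instr τ)) (b : ℕ), pre.length = b → code = pre ++ p.code b ++ suf →
      FlatRun ok code b s t (b + p.size) s' := by
  induction h with
  | @basic f s hs hs' =>
    rintro code pre suf b rfl rfl
    exact .step (I := fun v => (f v, pre.length + 1)) (by simp [Prog.code]) hs (.refl hs')
  | @seq p q s t s' t' s'' _ _ ihp ihq =>
    rintro code pre suf b hb rfl
    refine (ihp _ pre (q.code (b + p.size) ++ suf) b hb (by simp [Prog.code])).trans ?_
    rw [Prog.size, ← add_assoc]
    exact ihq _ (pre ++ p.code b) suf _ (by simp [Prog.length_code, hb]) (by simp [Prog.code])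
  | @ite_true c p q s t s' hs hc hex ih =>
    rintro code pre suf b hb rfl
    refine .step (I := fun v => (fun _ => .keep, if c v then b + 1 else b + 1 + p.size + 1))
      (by simp [Prog.code, ← hb]) hs ?_
    simp only [hc, if_true, Action.apply]
    refine (ih _ (pre ++ [fun v => (fun _ => .keep, if c v then b + 1 else b + 1 + p.size + 1)])
      ((fun _ => (fun _ => .keep, b + (p.size + q.size + 2))) ::
      q.code (b + 1 + p.size + 1) ++ suf) (b + 1) (by simp [hb])
      (by simp [Prog.code])).trans (t' := 1) ?_
    exact .step (I := fun _ => (fun _ => .keep, b + (p.size + q.size + 2)))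
      (getElem?_of_eq_append (l := pre ++ (fun v => (fun _ => .keep,
          if c v then b + 1 else b + 1 + p.size + 1)) :: p.code (b + 1))
        (r := q.code (b + 1 + p.size + 1) ++ suf) (by simp [Prog.code])
        (by simp [Prog.length_code, hb]; omega))
      hex.ok_end (.refl hex.ok_end)
  | @ite_false c p q s t s' hs hc hex ih =>
    rintro code pre suf b hb rfl
    refine .step (I := fun v => (fun _ => .keep, if c v then b + 1 else b + 1 + p.size + 1))
      (by simp [Prog.code, ← hb]) hs ?_
    simp only [hc, Action.apply, Prog.size]
    have := ih (pre ++ (Prog.ite c p q).code b ++ suf) (pre ++ (fun v => (fun _ => .keep,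
      if c v then b + 1 else b + 1 + p.size + 1)) :: (p.code (b + 1) ++
      [fun _ => (fun _ => .keep, b + (p.size + q.size + 2))])) suf (b + 1 + p.size + 1)
      (by simp [hb, Prog.length_code]; omega) (by simp [Prog.code])
    convert this using 1
    · simp
    · omega
  | @loop_false c p s hs hc =>
    rintro code pre suf b hb rfl
    refine .step (I := fun v => (fun _ => .keep, if c v then b + 1 else b + (p.size + 2)))
      (by simp [Prog.code, ← hb]) hs ?_
    simp only [hc, Action.apply, Prog.size]
    exact .refl hs
  | @loop_true c p s t s' t' s'' hs hc hex _ ih ih' =>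
    rintro code pre suf b hb rfl
    have h2 := ih' (pre ++ (Prog.loop c p).code b ++ suf) pre suf b hb rfl
    rw [show t + 2 + t' = t + 1 + t' + 1 by omega]
    refine .step (I := fun v => (fun _ => .keep, if c v then b + 1 else b + (p.size + 2)))
      (by simp [Prog.code, ← hb]) hs ?_
    simp only [hc, if_true, Action.apply]
    refine FlatRun.trans ((ih _ (pre ++ [fun v => (fun _ => .keep,
      if c v then b + 1 else b + (p.size + 2))]) ((fun _ => (fun _ => .keep, b)) :: suf) (b + 1)
      (by simp [hb]) (by simp [Prog.code])).trans (t' := 1) ?_) h2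
    exact .step (I := fun _ => (fun _ => .keep, b))
      (getElem?_of_eq_append (l := pre ++ (fun v => (fun _ => .keep,
          if c v then b + 1 else b + (p.size + 2))) :: p.code (b + 1)) (r := suf)
        (by simp [Prog.code]) (by simp [Prog.length_code, hb]; omega))
      hex.ok_end (.refl hex.ok_end)

end Flat

/-! ### Turing machines for structured programs -/

section Machine

variable {τ : Type} [Fintype τ] [DecidableEq τ] (inT outT : τ)

/-- The sign of the direction in which the stacks grow: to the right on the output tape and to the
left on the others. -/
def growth (i : τ) : ℤ := if i = outT then -1 else 1

/-- The position of the `h`-th cell of a stack, counted from the bottom. -/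
def cellPos (base : τ → ℤ) (i : τ) (h : ℕ) : ℤ := base i - growth outT i * h

/-- The tape that represents a stack. -/
def stackTape (base : τ → ℤ) (i : τ) (l : List IOSymbol) : ℤ → Option IOSymbol := fun x =>
  if 1 ≤ growth outT i * (base i - x) then l.reverse[(growth outT i * (base i - x) - 1).toNat]?
  else none

theorem growth_mul_self (i : τ) : growth outT i * growth outT i = 1 := by
  unfold growth; split_ifs <;> rfl

theorem growth_mul_sub_cellPos (base : τ → ℤ) (i : τ) (h : ℕ) :
    growth outT i * (base i - cellPos outT base i h) = h := by
  unfold cellPos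
  linear_combination (h : ℤ) * growth_mul_self outT i

theorem stackTape_top (base : τ → ℤ) (i : τ) (l : List IOSymbol) :
    stackTape outT base i l (cellPos outT base i l.length) = l.head? := by
  unfold stackTape
  rw [growth_mul_sub_cellPos]
  cases l with
  | nil => simp
  | cons a l => simp

theorem stackTape_above (base : τ → ℤ) (i : τ) (l : List IOSymbol) :
    stackTape outT base i l (cellPos outT base i (l.length + 1)) = none := by
  unfold stackTape
  rw [growth_mul_sub_cellPos]
  simp

theorem stackTape_cons (base : τ → ℤ) (i : τ) (a : IOSymbol) (l : List IOSymbol) :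
    stackTape outT base i (a :: l) = Function.update (stackTape outT base i l)
      (cellPos outT base i (l.length + 1)) (some a) := by
  funext x
  by_cases hx : x = cellPos outT base i (l.length + 1)
  · subst hx
    rw [Function.update_self]
    exact stackTape_top outT base i (a :: l)
  · rw [Function.update_of_ne hx]
    unfold stackTape
    split_ifs with h
    · have hne : growth outT i * (base i - x) ≠ (l.length + 1 : ℕ) := by
        intro h'
        apply hx
        unfold cellPos
        rw [← h']
        linear_combination (base i - x) * growth_mul_self outT i
      rw [List.reverse_cons, List.getElem?_append]
      split_ifs with h2
      · rfl
      · simp only [List.length_reverse] at h2 ⊢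
        rw [List.getElem?_eq_none (by simp; omega), List.getElem?_eq_none (by simp; omega)]
    · rfl

/-- The head movement that follows the growth or shrinking of a stack. -/
def upMove (i : τ) : HeadMove := if i = outT then .right else .left

/-- The head movement that follows the shrinking of a stack. -/
def downMove (i : τ) : HeadMove := if i = outT then .left else .right

theorem cellPos_up (base : τ → ℤ) (i : τ) (h : ℕ) :
    cellPos outT base i h + (upMove outT i).shift = cellPos outT base i (h + 1) := by
  unfold cellPos upMove growth; split_ifs <;> simp [HeadMove.shift] <;> ring

theorem cellPos_down (base : τ → ℤ) (i : τ) (h : ℕ) :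
    cellPos outT base i (h + 1) + (downMove outT i).shift = cellPos outT base i h := by
  unfold cellPos downMove growth; split_ifs <;> simp [HeadMove.shift] <;> ring

/-- The first half of an action: all but the writing of a symbol that is pushed. -/
def Action.first (i : τ) (v : Option IOSymbol) : Action → Option IOSymbol × HeadMove
  | .keep => (v, .stay)
  | .pop => if v = none then (v, .stay) else (none, downMove outT i)
  | .push _ => (v, upMove outT i)
  | .set a => if v = none then (v, .stay) else (some a, .stay)

theorem Action.first_head (base : τ → ℤ) (i : τ) (l : List IOSymbol) (a : Action) :
    cellPos outT base i l.length + (a.first outT i l.head?).2.shift =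
      cellPos outT base i (a.apply l).length := by
  cases a with
  | keep => simp [Action.first, Action.apply, HeadMove.shift]
  | pop =>
    cases l with
    | nil => simp [Action.first, Action.apply, HeadMove.shift]
    | cons a l => simp [Action.first, Action.apply, cellPos_down]
  | push a => simp [Action.first, Action.apply, cellPos_up]
  | set a => cases l <;> simp [Action.first, Action.apply, HeadMove.shift]

/-- A machine step writes before it moves. A push must first move to the free cell above the top and
can write only in the next step, so its tape lags behind its head. Every other action is complete
after this half. -/
theorem Action.first_tape (base : τ → ℤ) (i : τ) (l : List IOSymbol) (a : Action) :
    Function.update (stackTape outT base i l) (cellPos outT base i l.length)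
      (a.first outT i l.head?).1 = match (generalizing := false) a with
        | .push _ => stackTape outT base i l
        | a => stackTape outT base i (a.apply l) := by
  have hself : Function.update (stackTape outT base i l) (cellPos outT base i l.length)
      l.head? = stackTape outT base i l := by
    rw [← stackTape_top outT base i l, Function.update_eq_self]
  cases a with
  | keep => simpa [Action.first, Action.apply] using hself
  | pop =>
    cases l with
    | nil => simpa [Action.first, Action.apply] using hself
    | cons a l =>
      simp only [Action.first, Action.apply, List.head?_cons, List.tail_cons,
        reduceCtorEq, if_false]
      rw [stackTape_cons, List.length_cons, Function.update_idem,
        ← stackTape_above outT base i l, Function.update_eq_self]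
  | push a => simpa [Action.first] using hself
  | set a =>
    cases l with
    | nil => simpa [Action.first, Action.apply] using hself
    | cons b l =>
      simp only [Action.first, Action.apply, List.head?_cons, reduceCtorEq, if_false]
      rw [stackTape_cons, List.length_cons, Function.update_idem, ← stackTape_cons]

/-- The second half of an action. -/
def Action.second (v : Option IOSymbol) : Action → Option IOSymbol × HeadMove
  | .push a => (some a, .stay)
  | _ => (v, .stay)

/-- The Turing machine that runs a program. -/
def Prog.machine (p : Prog τ) : MultitapeTM where
  Tp := τ
  Γ := Option IOSymbol
  Q := Option (Fin (p.size + 1) × Option (τ → Action))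
  sym := Function.Embedding.refl _
  inTape := inT
  outTape := outT
  start := none
  δ := fun q v => match q with
    -- The output stack grows to the right and its word is to begin at cell `0`, so its head has to
    -- start at cell `-1`.
    | none => some (some (0, none), fun i => (v i, if i = outT then .left else .stay))
    -- Clipping the counter at `p.size` keeps the set of states finite. There is no instruction at
    -- `p.size`, so the machine halts there.
    | some (pc, none) => ((p.code 0)[(pc : ℕ)]?).map fun I =>
        (some (⟨min (I v).2 p.size, by omega⟩, some (I v).1),
          fun i => ((I v).1 i).first outT i (v i))
    | some (pc, some acts) => some (some (pc, none), fun i => (acts i).second (v i))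

variable {outT} in
/-- The configuration of the machine that belongs to a program counter and stacks. -/
def Prog.cfg (p : Prog τ) (base : τ → ℤ) (pc : ℕ) (s : Stacks τ) : (p.machine inT outT).Cfg where
  state := some (⟨min pc p.size, by omega⟩, none)
  head := fun i => cellPos outT base i (s i).length
  tape := fun i => stackTape outT base i (s i)

variable {outT} in
/-- The configuration of the machine between the halves of an action. -/
def Prog.midCfg (p : Prog τ) (base : τ → ℤ) (pc : ℕ) (s : Stacks τ) (acts : τ → Action) :
    (p.machine inT outT).Cfg where
  state := some (⟨min pc p.size, by omega⟩, some acts)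
  head := fun i => cellPos outT base i ((acts i).apply (s i)).length
  tape := fun i => match (generalizing := false) acts i with
    | .push _ => stackTape outT base i (s i)
    | a => stackTape outT base i (a.apply (s i))

theorem step_eq (T : MultitapeTM) (c : T.Cfg) (v : T.Tp → T.Γ) (a : T.Q × (T.Tp → T.Γ × HeadMove))
    (hv : (fun i => c.tape i (c.head i)) = v) (ha : T.δ c.state v = some a) :
    T.step c = some
      { state := a.1
        head := fun i => c.head i + (a.2 i).2.shift
        tape := fun i => Function.update (c.tape i) (c.head i) (a.2 i).1 } := by
  unfold MultitapeTM.step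
  rw [hv, ha, Option.map_some]

theorem Prog.step_cfg (p : Prog τ) (base : τ → ℤ) (pc : ℕ) (s : Stacks τ) (I : Instr τ)
    (hI : (p.code 0)[pc]? = some I) :
    (p.machine inT outT).step (p.cfg inT base pc s) =
      some (p.midCfg inT base (I (tops s)).2 s (I (tops s)).1) := by
  have hpc : pc < p.size := by
    have := (List.getElem?_eq_some_iff.1 hI).1
    rwa [p.length_code] at this
  have hv : (fun i => (p.cfg (outT := outT) inT base pc s).tape i
      ((p.cfg (outT := outT) inT base pc s).head i)) = tops s :=
    funext fun i => stackTape_top outT base i (s i)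
  have hd : (p.machine inT outT).δ (p.cfg (outT := outT) inT base pc s).state (tops s) =
      some (some (⟨min (I (tops s)).2 p.size, by omega⟩, some (I (tops s)).1),
          fun i => ((I (tops s)).1 i).first outT i (tops s i)) := by
    simp only [Prog.machine, Prog.cfg, min_eq_left hpc.le, hI, Option.map_some]
  rw [step_eq _ _ _ _ hv hd]
  simp only [Prog.midCfg, Option.some.injEq]
  congr 1
  · funext i
    show cellPos outT base i (s i).length + _ = _
    exact Action.first_head outT base i (s i) _
  · funext i
    exact Action.first_tape outT base i (s i) _

theorem Prog.step_midCfg (p : Prog τ) (base : τ → ℤ) (pc : ℕ) (s : Stacks τ) (acts : τ → Action) :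
    (p.machine inT outT).step (p.midCfg inT base pc s acts) =
      some (p.cfg inT base pc fun i => (acts i).apply (s i)) := by
  unfold MultitapeTM.step
  simp only [Prog.machine, Prog.midCfg, Prog.cfg, Option.map_some, Option.some.injEq]
  congr 1
  · funext i
    cases acts i <;> simp [Action.second, HeadMove.shift]
  · funext i
    cases acts i with
    | push a => simp [Action.second, Action.apply, stackTape_cons]
    | keep => simp [Action.second]
    | pop => simp [Action.second]
    | set a => simp [Action.second]

theorem Prog.iterate_cfg (p : Prog τ) (base : τ → ℤ) {ok : Stacks τ → Prop} {pc s t pc' s'}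
    (h : FlatRun ok (p.code 0) pc s t pc' s') :
    (fun c => ((p.machine inT outT).step c).getD c)^[2 * t] (p.cfg inT base pc s) =
        p.cfg inT base pc' s' ∧
      ∀ k ≤ 2 * t, ∃ r, ok r ∧ ((fun c => ((p.machine inT outT).step c).getD c)^[k]
        (p.cfg inT base pc s)).head = fun i => cellPos outT base i (r i).length := by
  induction h with
  | @refl pc s hs =>
    refine ⟨rfl, fun k hk => ⟨s, hs, ?_⟩⟩
    obtain rfl : k = 0 := by omega
    rfl
  | @step pc s I t pc' s' hI hs hrun ih =>
    have h1 := p.step_cfg inT outT base pc s I hI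
    have h2 := p.step_midCfg inT outT base (I (tops s)).2 s (I (tops s)).1
    constructor
    · rw [show 2 * (t + 1) = 2 * t + 1 + 1 by ring, Function.iterate_succ_apply,
        Function.iterate_succ_apply, h1, Option.getD_some, h2, Option.getD_some, ih.1]
    · intro k hk
      match k with
      | 0 => exact ⟨s, hs, rfl⟩
      -- Between the halves of an action the heads are already where the action leaves them, so the
      -- next stacks serve as `r`.
      | 1 =>
        obtain ⟨r, hr, hr'⟩ := ih.2 0 (by omega)
        refine ⟨r, hr, ?_⟩
        rw [Function.iterate_one, h1, Option.getD_some, ← hr']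
        rfl
      | k + 2 =>
        obtain ⟨r, hr, hr'⟩ := ih.2 k (by omega)
        refine ⟨r, hr, ?_⟩
        rw [Function.iterate_succ_apply, Function.iterate_succ_apply, h1, Option.getD_some, h2,
          Option.getD_some, hr']

/-- All stacks have height at most `S`. -/
def Bounded (S : ℕ) (s : Stacks τ) : Prop := ∀ i, (s i).length ≤ S

/-- The stacks at the start: the input word and empty stacks. -/
def startStacks (w : List IOSymbol) : Stacks τ := fun i => if i = inT then w else []

/-- Every instruction costs two machine steps, and the initial head movement one more. A head only
visits cells that belong to the heights `0, …, S` of its stack, which makes `S + 1` cells per tape.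
-/
theorem Prog.machine_spec (p : Prog τ) (hne : inT ≠ outT) (w v : List IOSymbol) (S t : ℕ)
    (s' : Stacks τ) (hS : 1 ≤ S) (h : Exec (Bounded S) p (startStacks inT w) t s')
    (hv : s' outT = v.reverse) :
    (p.machine inT outT).OutputsWithin w v (2 * t + 1) ∧
      (p.machine inT outT).space w (2 * t + 1) ≤ Fintype.card τ * (S + 1) := by
  -- The base is the cell just below the bottom symbol. The first input symbol is the top of its
  -- stack and lies at cell `0`, so that base is `w.length`; the bottom symbol of the output stack
  -- lies at cell `0`, so that base is `-1`.
  set base : τ → ℤ := fun i => if i = outT then -1 else if i = inT then w.length else 0 with hbase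
  have htape : ∀ i, (if i = inT then (p.machine inT outT).wordTape w
      else (p.machine inT outT).wordTape []) = stackTape outT base i (startStacks inT w i) := by
    intro i
    funext x
    by_cases h2 : i = inT
    · subst h2
      rw [if_pos rfl]
      show (if 0 ≤ x then w[x.toNat]? else none) = _
      simp only [stackTape, growth, hne, if_false, base, one_mul, startStacks, if_true]
      by_cases hx : 0 ≤ x
      · rw [if_pos hx]
        split_ifs with h'
        · rw [List.getElem?_reverse (by omega)]
          congr 1
          omega
        · rw [List.getElem?_eq_none]
          omega
      · rw [if_neg hx, if_pos (by omega), List.getElem?_eq_none]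
        rw [List.length_reverse]
        omega
    · rw [if_neg h2]
      show (if 0 ≤ x then ([] : List IOSymbol)[x.toNat]? else none) = _
      simp [stackTape, startStacks, h2]
  have hinit : (p.machine inT outT).step ((p.machine inT outT).init w) =
      some (p.cfg inT base 0 (startStacks inT w)) := by
    unfold MultitapeTM.step
    simp only [Prog.machine, Prog.cfg, MultitapeTM.init, Option.map_some, Option.some.injEq]
    congr 1
    · funext i
      by_cases h1 : i = outT
      · subst h1
        simp [cellPos, startStacks, hne.symm, base, HeadMove.shift]
      · by_cases h2 : i = inT
        · subst h2
          simp [cellPos, startStacks, hne, base, HeadMove.shift, growth]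
        · simp [cellPos, startStacks, h1, h2, base, HeadMove.shift]
    · funext i
      simp only [Function.update_eq_self]
      exact htape i
  have hrun : ∀ k, (p.machine inT outT).run w (k + 1) =
      (fun c => ((p.machine inT outT).step c).getD c)^[k]
        (p.cfg inT base 0 (startStacks inT w)) := by
    intro k
    unfold MultitapeTM.run
    rw [Function.iterate_succ_apply, hinit, Option.getD_some]
  obtain ⟨hit, hheads⟩ := p.iterate_cfg inT outT base (h.flatRun (p.code 0) [] [] 0 rfl (by simp))
  rw [zero_add] at hit
  refine ⟨⟨?_, ?_⟩, ?_⟩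
  · rw [hrun, hit]
    unfold MultitapeTM.step
    simp [Prog.machine, Prog.cfg, Prog.length_code]
  · rw [hrun, hit]
    funext x
    show stackTape outT base outT (s' outT) x = if 0 ≤ x then v[x.toNat]? else none
    simp only [stackTape, growth, if_true, hv, List.reverse_reverse, base]
    by_cases hx : 0 ≤ x
    · rw [if_pos (by omega), if_pos hx]
      congr 2
      ring
    · rw [if_neg (by omega), if_neg hx]
  · unfold MultitapeTM.space
    show ∑ i : τ, _ ≤ _
    refine (Finset.sum_le_card_nsmul _ _ (S + 1) fun i _ => ?_).trans (by simp)
    refine (Finset.card_le_card (t := (Finset.range (S + 1)).image (cellPos outT base i)) ?_).trans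
      (Finset.card_image_le.trans (by simp))
    intro x hx
    simp only [Finset.mem_image, Finset.mem_range] at hx ⊢
    obtain ⟨k, hk, rfl⟩ := hx
    match k with
    | 0 =>
      -- Before the first step the output head is on cell `0`, which belongs to height `1`; here `1
      -- ≤ S` is needed.
      show ∃ a < S + 1, cellPos outT base i a = 0
      by_cases h1 : i = outT
      · exact ⟨1, by omega, by simp [cellPos, h1, base, growth]⟩
      · by_cases h2 : i = inT
        · have := h.ok_start inT
          simp only [startStacks, if_true] at this
          exact ⟨w.length, by omega, by subst h2; simp [cellPos, base, growth, h1]⟩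
        · exact ⟨0, by omega, by simp [cellPos, h1, h2, base]⟩
    | k + 1 =>
      obtain ⟨r, hr, hr'⟩ := hheads k (by omega)
      rw [hrun, hr']
      refine ⟨(r i).length, ?_, rfl⟩
      have := hr i
      omega

end Machine

/-! ### Numbers on stacks -/

theorem Action.length_apply_le (a : Action) (l : List IOSymbol) :
    (a.apply l).length ≤ l.length + 1 := by
  cases a with
  | set a => cases l <;> simp [Action.apply]
  | _ => simp [Action.apply]; try omega

theorem Exec.length_le {τ : Type} {ok : Stacks τ → Prop} {p : Prog τ} {s t s'}
    (h : Exec ok p s t s') (i : τ) : (s' i).length ≤ (s i).length + t := by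
  induction h with
  | basic _ _ => exact Action.length_apply_le _ _
  | seq _ _ ih ih' => omega
  | ite_true _ _ _ ih => omega
  | ite_false _ _ _ ih => omega
  | loop_false _ _ => omega
  | loop_true _ _ _ _ ih ih' => omega

/-- A run of `t` steps does not increase the heights of the stacks by more than `t`. -/
theorem Exec.bounded {τ : Type} {ok : Stacks τ → Prop} {p : Prog τ} {s t s'}
    (h : Exec ok p s t s') {S : ℕ} (hS : ∀ i, (s i).length + t ≤ S) :
    Exec (Bounded S) p s t s' := by
  induction h with
  | basic h h' =>
    exact .basic (fun i => by have := hS i; omega)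
      (fun i => (Action.length_apply_le _ _).trans (hS i))
  | seq h _ ih ih' =>
    exact .seq (ih fun i => by have := hS i; omega)
      (ih' fun i => by have := hS i; have := h.length_le i; omega)
  | ite_true h hc _ ih =>
    exact .ite_true (fun i => by have := hS i; omega) hc (ih fun i => by have := hS i; omega)
  | ite_false h hc _ ih =>
    exact .ite_false (fun i => by have := hS i; omega) hc (ih fun i => by have := hS i; omega)
  | loop_false h hc => exact .loop_false (fun i => by have := hS i; omega) hc
  | loop_true h hc h1 _ ih ih' =>
    exact .loop_true (fun i => by have := hS i; omega) hc (ih fun i => by have := hS i; omega)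
      (ih' fun i => by have := hS i; have := h1.length_le i; omega)

/-- No condition on the stacks. -/
abbrev Free {τ : Type} : Stacks τ → Prop := fun _ => True

theorem Exec.basic_free {τ : Type} {f : (τ → Option IOSymbol) → τ → Action} {s s' : Stacks τ}
    (h : ∀ i, s' i = (f (tops s) i).apply (s i)) : Exec Free (.basic f) s 1 s' := by
  rw [funext h]
  exact .basic trivial trivial

/-- Whether a symbol is a binary digit. -/
def isBit : Option IOSymbol → Bool
  | some (.bit _) => true
  | _ => false

/-- The value of a binary digit, and `false` for all other symbols. -/
def bitOf : Option IOSymbol → Bool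
  | some (.bit b) => b
  | _ => false

/-! ### Moving and stripping digits -/

section Symbols

variable {τ : Type} [DecidableEq τ]

/-- Move binary digits from the top of the stack `a` to the stacks in `b`, reversing them. -/
def xfer (a : τ) (b : τ → Bool) : Prog τ :=
  .loop (fun v => isBit (v a)) (.basic fun v i =>
    if i = a then .pop else if b i then .push (.bit (bitOf (v a))) else .keep)

/-- A digit costs a test, the action and the jump back; the last test costs one more step. The
digits arrive in reverse order, so a number is moved by two transfers, through `aux`. -/
theorem xfer_exec (a : τ) (b : τ → Bool) (w : List Bool) (rest : List IOSymbol)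
    (hrest : isBit rest.head? = false) (s s' : Stacks τ) (hs : s a = w.map .bit ++ rest)
    (ha : s' a = rest) (hb : ∀ i, i ≠ a → b i = true → s' i = w.reverse.map .bit ++ s i)
    (hn : ∀ i, i ≠ a → b i = false → s' i = s i) :
    Exec Free (xfer a b) s (3 * w.length + 1) s' := by
  induction w generalizing s with
  | nil =>
    have : s' = s := by
      funext i
      by_cases h1 : i = a
      · subst h1; simp [ha, hs]
      · cases h2 : b i
        · exact hn i h1 h2
        · simpa using hb i h1 h2
    subst this
    exact .loop_false trivial (by simp [tops, ha, hrest])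
  | cons c w ih =>
    rw [List.length_cons, show 3 * (w.length + 1) + 1 = 1 + 2 + (3 * w.length + 1) by ring]
    refine .loop_true trivial (by simp [tops, hs, isBit]) (Exec.basic_free (s' := fun i =>
      if i = a then w.map .bit ++ rest else if b i then .bit c :: s i else s i) ?_) (ih _ ?_ ?_ ?_)
    · intro i
      by_cases h1 : i = a
      · subst h1; simp [hs, Action.apply]
      · cases h2 : b i <;> simp [h1, hs, Action.apply, tops, bitOf]
    · simp
    · intro i h1 h2; simp [h1, h2, hb i h1 h2]
    · intro i h1 h2; simp [h1, h2, hn i h1 h2]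

/-- Remove the symbols `bit false` from the top of a stack. -/
def strip (a : τ) : Prog τ :=
  .loop (fun v => v a = some (.bit false)) (.basic fun _ i => if i = a then .pop else .keep)

theorem strip_exec (a : τ) (w : List Bool) (s s' : Stacks τ) (hs : s a = w.map .bit)
    (ha : s' a = (w.dropWhile (! ·)).map .bit) (hn : ∀ i, i ≠ a → s' i = s i) :
    ∃ t ≤ 3 * w.length + 1, Exec Free (strip a) s t s' := by
  induction w generalizing s with
  | nil =>
    have : s' = s := by
      funext i
      by_cases h1 : i = a
      · subst h1; simp [ha, hs]
      · exact hn i h1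
    subst this
    exact ⟨1, by simp, .loop_false trivial (by simp [tops, hs])⟩
  | cons c w ih =>
    cases c with
    | true =>
      have : s' = s := by
        funext i
        by_cases h1 : i = a
        · subst h1; simp [ha, hs]
        · exact hn i h1
      subst this
      exact ⟨1, by simp, .loop_false trivial (by simp [tops, hs])⟩
    | false =>
      obtain ⟨t, ht, hex⟩ := ih (fun i => if i = a then w.map .bit else s i) (by simp)
        (by simpa using ha) (fun i h1 => by simp [h1, hn i h1])
      refine ⟨1 + 2 + t, by simp; omega, .loop_true trivial (by simp [tops, hs])
        (Exec.basic_free ?_) hex⟩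
      intro i
      by_cases h1 : i = a
      · subst h1; simp [hs, Action.apply]
      · simp [h1, Action.apply]

end Symbols

/-- A step function of a serial operation on two binary numbers: from the carry and two digits it
gives the new carry and possibly a digit of the result. -/
abbrev DigitOp := Bool → Bool → Bool → Bool × Option Bool

/-- The digits that a serial operation gives, the last one being the final carry. -/
def DigitOp.digits (g : DigitOp) : Bool → List Bool → List Bool → List Bool
  | c, [], [] => [c]
  | c, a :: u, [] => (g c a false).2.toList ++ g.digits (g c a false).1 u []
  | c, [], b :: v => (g c false b).2.toList ++ g.digits (g c false b).1 [] v
  | c, a :: u, b :: v => (g c a b).2.toList ++ g.digits (g c a b).1 u v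

/-- The number with given binary digits, the least significant one first. -/
def digitsVal : List Bool → ℕ
  | [] => 0
  | b :: w => Nat.bit b (digitsVal w)

theorem digitsVal_bits (n : ℕ) : digitsVal n.bits = n := by
  induction n using Nat.binaryRec' with
  | zero => simp [digitsVal]
  | bit b n h ih => rw [Nat.bits_append_bit _ _ h, digitsVal, ih]

/-- A serial operation may produce zeros at the most significant end, whereas the tape must hold the
canonical word `n.bits`. These zeros come out on top of the auxiliary stack, where `strip` removes
them. -/
theorem bits_digitsVal (w : List Bool) :
    (w.reverse.dropWhile (! ·)).reverse = (digitsVal w).bits := by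
  induction w with
  | nil => simp [digitsVal]
  | cons b w ih =>
    rw [digitsVal, List.reverse_cons, List.dropWhile_append]
    by_cases h : digitsVal w = 0
    · rw [h, Nat.zero_bits, List.reverse_eq_nil_iff] at ih
      rw [ih, h]
      cases b <;> simp [Nat.bit]
    · rw [Nat.bits_append_bit _ _ (fun h' => absurd h' h), ← ih]
      split_ifs with h1
      · rw [List.isEmpty_iff] at h1
        rw [h1] at ih
        exact absurd (by rw [← digitsVal_bits (digitsVal w), ← ih]; rfl) h
      · simp

/-- The result of a serial operation. -/
def DigitOp.eval (g : DigitOp) (x y : ℕ) : ℕ := digitsVal (g.digits false x.bits y.bits)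

/-- Addition. -/
def plus : DigitOp := fun c a b => ((a && b) || (c && (a || b)), some (xor (xor a b) c))

/-- The comparison `<`. -/
def less : DigitOp := fun c a b => ((!a && (b || c)) || (b && c), none)

theorem digitsVal_plus (c : Bool) (u v : List Bool) :
    digitsVal (plus.digits c u v) = c.toNat + digitsVal u + digitsVal v := by
  fun_induction DigitOp.digits plus c u v with
  | case1 c => cases c <;> simp [digitsVal, Nat.bit]
  | case2 c a u ih =>
    simp only [plus, Option.toList_some, List.singleton_append, digitsVal] at ih ⊢
    rw [ih]; cases a <;> cases c <;> simp [Nat.bit] <;> omega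
  | case3 c b v ih =>
    simp only [plus, Option.toList_some, List.singleton_append, digitsVal] at ih ⊢
    rw [ih]; cases b <;> cases c <;> simp [Nat.bit] <;> omega
  | case4 c a u b v ih =>
    simp only [plus, Option.toList_some, List.singleton_append, digitsVal] at ih ⊢
    rw [ih]; cases a <;> cases b <;> cases c <;> simp [Nat.bit] <;> omega

/-- The carry tells whether the lower digits read so far make the first number the smaller one. It
decides exactly when the higher digits agree, which is the effect of adding it to the second number.
-/
theorem digits_less (c : Bool) (u v : List Bool) :
    less.digits c u v = [decide (digitsVal u < digitsVal v + c.toNat)] := by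
  fun_induction DigitOp.digits less c u v with
  | case1 c => cases c <;> simp [digitsVal]
  | case2 c a u ih =>
    simp only [less, Option.toList_none, List.nil_append, digitsVal] at ih ⊢
    rw [ih]; cases a <;> cases c <;> simp [Nat.bit]
  | case3 c b v ih =>
    simp only [less, Option.toList_none, List.nil_append, digitsVal] at ih ⊢
    rw [ih]; cases b <;> cases c <;> simp [Nat.bit]
  | case4 c a u b v ih =>
    simp only [less, Option.toList_none, List.nil_append, digitsVal] at ih ⊢
    rw [ih]; cases a <;> cases b <;> cases c <;> simp [Nat.bit] <;> omega

theorem eval_plus (x y : ℕ) : plus.eval x y = x + y := by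
  simp [DigitOp.eval, digitsVal_plus, digitsVal_bits]

theorem eval_less (x y : ℕ) : less.eval x y = if x < y then 1 else 0 := by
  simp only [DigitOp.eval, digits_less, digitsVal_bits, Bool.toNat_false, add_zero, digitsVal]
  split_ifs with h <;> simp [h, Nat.bit]

theorem length_digits_le (g : DigitOp) (c : Bool) (u v : List Bool) :
    (g.digits c u v).length ≤ max u.length v.length + 1 := by
  have ho : ∀ o : Option Bool, o.toList.length ≤ 1 := fun o => by cases o <;> simp
  fun_induction DigitOp.digits g c u v with
  | case1 c => simp
  | case2 c a u ih => have := ho (g c a false).2; simp at ih ⊢; omega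
  | case3 c b v ih => have := ho (g c false b).2; simp at ih ⊢; omega
  | case4 c a u b v ih => have := ho (g c a b).2; simp at ih ⊢; omega

/-! ### Serial operations on stacks -/

section Serial

variable {τ : Type} [DecidableEq τ]

/-- Remove binary numbers digit by digit from the stacks `i` and `j`, and put the digits of the
result on the stack `x`; the carry is on the stack `c`. -/
def serialLoop (g : DigitOp) (i j x c : τ) : Prog τ :=
  .loop (fun v => isBit (v i) || isBit (v j)) (.basic fun v t =>
    if t = i then (if isBit (v i) then .pop else .keep)
    else if t = j then (if isBit (v j) then .pop else .keep)
    else if t = c then .set (.bit (g (bitOf (v c)) (bitOf (v i)) (bitOf (v j))).1)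
    else if t = x then
      (match (g (bitOf (v c)) (bitOf (v i)) (bitOf (v j))).2 with
        | some o => .push (.bit o)
        | none => .keep)
    else .keep)

/-- The loop, followed by the removal of the separators and of the carry. -/
def serial (g : DigitOp) (i j x c : τ) : Prog τ :=
  .seq (serialLoop g i j x c) (.basic fun v t =>
    if t = i then .pop else if t = j then .pop else if t = c then .pop
    else if t = x then .push (.bit (bitOf (v c))) else .keep)

theorem reverse_toList {α : Type*} (o : Option α) : o.toList.reverse = o.toList := by
  cases o <;> rfl

theorem apply_digit (o : Option Bool) (l : List IOSymbol) :
    (match o with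
        | some o => Action.push (.bit o)
        | none => Action.keep).apply l = o.toList.map .bit ++ l := by
  cases o <;> rfl

/-- One round of the loop, common to the cases in which both numbers or only one of them still have
digits. An exhausted number shows its separator, which `bitOf` reads as the digit `0` and which
stays in place. -/
theorem serial_round (g : DigitOp) {i j x c : τ} (hij : i ≠ j) (hix : i ≠ x) (hic : i ≠ c)
    (hjx : j ≠ x) (hjc : j ≠ c) (hxc : x ≠ c) (k a b : Bool) (z ri rj : List IOSymbol)
    (s s' : Stacks τ) (hx : s x = z) (hc : s c = [.bit k])
    (hn : ∀ t, t ≠ i → t ≠ j → t ≠ x → t ≠ c → s' t = s t) (n : ℕ)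
    (ht : (isBit (s i).head? || isBit (s j).head?) = true)
    (ha : bitOf (s i).head? = a) (hb : bitOf (s j).head? = b)
    (hu : (if isBit (s i).head? then Action.pop else .keep).apply (s i) = ri)
    (hv : (if isBit (s j).head? then Action.pop else .keep).apply (s j) = rj)
    (hrec : ∀ r : Stacks τ, r i = ri → r j = rj → r x = (g k a b).2.toList.map .bit ++ z →
      r c = [.bit (g k a b).1] → (∀ t, t ≠ i → t ≠ j → t ≠ x → t ≠ c → s' t = r t) →
      ∃ t ≤ n, Exec Free (serial g i j x c) r t s') :
    ∃ t ≤ n + 3, Exec Free (serial g i j x c) s t s' := by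
  obtain ⟨r, hr⟩ : ∃ r : Stacks τ, r = fun t => if t = i then ri else if t = j then rj
    else if t = c then [.bit (g k a b).1] else if t = x then (g k a b).2.toList.map .bit ++ z
    else s t := ⟨_, rfl⟩
  obtain ⟨m, hm, h1⟩ := hrec r (by simp [hr]) (by simp [hr, hij.symm])
    (by simp [hr, hix.symm, hjx.symm, hxc]) (by simp [hr, hic.symm, hjc.symm])
    (fun t h1 h2 h3 h4 => by simp [hr, h1, h2, h3, h4, hn t h1 h2 h3 h4])
  unfold serial at h1 ⊢
  -- The run for the remaining digits is split at the end of its loop, so that the present round can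
  -- be put in front of that loop.
  cases h1 with
  | @seq _ _ _ t1 m t2 _ hA hB =>
    refine ⟨(1 + 2 + t1) + t2, by omega, .seq (.loop_true trivial ht (Exec.basic_free ?_) hA) hB⟩
    intro t
    have hck : bitOf (tops s c) = k := by simp [tops, hc, bitOf]
    have hai : bitOf (tops s i) = a := ha
    have hbj : bitOf (tops s j) = b := hb
    rw [hck, hai, hbj, hr]
    by_cases h1 : t = i
    · subst h1; simp only [if_true]; exact hu.symm
    by_cases h2 : t = j
    · subst h2; simp only [h1, if_true, if_false]; exact hv.symm
    by_cases h3 : t = c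
    · subst h3; simp [h1, h2, hc, Action.apply]
    by_cases h4 : t = x
    · subst h4; simp only [h1, h2, h3, if_true, if_false]; rw [apply_digit, hx]
    · simp [h1, h2, h3, h4, Action.apply]

theorem serial_exec (g : DigitOp) {i j x c : τ} (hij : i ≠ j) (hix : i ≠ x) (hic : i ≠ c)
    (hjx : j ≠ x) (hjc : j ≠ c) (hxc : x ≠ c) (k : Bool) (u v : List Bool) (z ri rj : List IOSymbol)
    (s s' : Stacks τ)
    (hi : s i = u.map .bit ++ .sep :: ri) (hj : s j = v.map .bit ++ .sep :: rj) (hx : s x = z)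
    (hc : s c = [.bit k]) (hi' : s' i = ri) (hj' : s' j = rj)
    (hx' : s' x = (g.digits k u v).reverse.map .bit ++ z) (hc' : s' c = [])
    (hn : ∀ t, t ≠ i → t ≠ j → t ≠ x → t ≠ c → s' t = s t) :
    ∃ t ≤ 3 * max u.length v.length + 2, Exec Free (serial g i j x c) s t s' := by
  fun_induction DigitOp.digits g k u v generalizing s z with
  | case1 k =>
    refine ⟨2, by simp, .seq (t := 1) (t' := 1) (.loop_false trivial
      (by simp [tops, hi, hj, isBit])) (Exec.basic_free ?_)⟩
    intro t
    by_cases h1 : t = i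
    · subst h1; simp [hi, hi', Action.apply]
    by_cases h2 : t = j
    · subst h2; simp [h1, hj, hj', Action.apply]
    by_cases h3 : t = c
    · subst h3; simp [h1, h2, hc, hc', Action.apply]
    by_cases h4 : t = x
    · subst h4; simp [h1, h2, h3, hx, hx', tops, hc, bitOf, Action.apply]
    · simp [h1, h2, h3, h4, Action.apply, hn t h1 h2 h4 h3]
  | case2 k a u ih =>
    rw [List.length_cons, List.length_nil, show 3 * max (u.length + 1) 0 + 2 =
      (3 * max u.length ([] : List Bool).length + 2) + 3 by simp; ring]
    exact serial_round g hij hix hic hjx hjc hxc k a false z _ _ s s' hx hc hn _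
      (by simp [hi, isBit]) (by simp [hi, bitOf]) (by simp [hj, bitOf])
      (by simp [hi, isBit, Action.apply]) (by simp [hj, isBit, Action.apply])
      fun r h1 h2 h3 h4 h5 => ih _ r h1 h2 h3 h4
        (by rw [hx', List.reverse_append, reverse_toList, List.map_append, List.append_assoc]) h5
  | case3 k b v ih =>
    rw [List.length_cons, List.length_nil, show 3 * max 0 (v.length + 1) + 2 =
      (3 * max ([] : List Bool).length v.length + 2) + 3 by simp; ring]
    exact serial_round g hij hix hic hjx hjc hxc k false b z _ _ s s' hx hc hn _
      (by simp [hj, isBit]) (by simp [hi, bitOf]) (by simp [hj, bitOf])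
      (by simp [hi, isBit, Action.apply]) (by simp [hj, isBit, Action.apply])
      fun r h1 h2 h3 h4 h5 => ih _ r h1 h2 h3 h4
        (by rw [hx', List.reverse_append, reverse_toList, List.map_append, List.append_assoc]) h5
  | case4 k a u b v ih =>
    rw [List.length_cons, List.length_cons, show 3 * max (u.length + 1) (v.length + 1) + 2 =
      (3 * max u.length v.length + 2) + 3 by omega]
    exact serial_round g hij hix hic hjx hjc hxc k a b z _ _ s s' hx hc hn _
      (by simp [hi, isBit]) (by simp [hi, bitOf]) (by simp [hj, bitOf])
      (by simp [hi, isBit, Action.apply]) (by simp [hj, isBit, Action.apply])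
      fun r h1 h2 h3 h4 h5 => ih _ r h1 h2 h3 h4
        (by rw [hx', List.reverse_append, reverse_toList, List.map_append, List.append_assoc]) h5

end Serial

/-- The names of the stacks of numbers. -/
inductive Reg where
  | inp | lo | hi | div | pow | mul | num | key | rem | key0 | rem0 | key1 | rem1 | cnt | tmpA | tmpB
  | flag
  deriving DecidableEq

instance : Fintype Reg :=
  ⟨{.inp, .lo, .hi, .div, .pow, .mul, .num, .key, .rem, .key0, .rem0, .key1, .rem1, .cnt, .tmpA,
    .tmpB, .flag}, fun r => by cases r <;> decide⟩

/-- The tapes: stacks of numbers, two auxiliary stacks, and the output tape. -/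
inductive Tape where
  | reg (r : Reg)
  | aux
  | carry
  | out
  deriving DecidableEq, Fintype

/-- The contents of the stacks of numbers, and the numbers that have been written as output. -/
structure St where
  inp : List ℕ
  lo : List ℕ
  hi : List ℕ
  div : List ℕ
  pow : List ℕ
  mul : List ℕ
  num : List ℕ
  key : List ℕ
  rem : List ℕ
  key0 : List ℕ
  rem0 : List ℕ
  key1 : List ℕ
  rem1 : List ℕ
  cnt : List ℕ
  tmpA : List ℕ
  tmpB : List ℕ
  flag : List ℕ
  out : List ℕ

/-- The contents of a stack. -/
def St.get (s : St) : Reg → List ℕ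
  | .inp => s.inp
  | .lo => s.lo
  | .hi => s.hi
  | .div => s.div
  | .pow => s.pow
  | .mul => s.mul
  | .num => s.num
  | .key => s.key
  | .rem => s.rem
  | .key0 => s.key0
  | .rem0 => s.rem0
  | .key1 => s.key1
  | .rem1 => s.rem1
  | .cnt => s.cnt
  | .tmpA => s.tmpA
  | .tmpB => s.tmpB
  | .flag => s.flag

/-- Change the contents of a stack. -/
def St.set (s : St) (r : Reg) (l : List ℕ) : St :=
  match r with
  | .inp => { s with inp := l }
  | .lo => { s with lo := l }
  | .hi => { s with hi := l }
  | .div => { s with div := l }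
  | .pow => { s with pow := l }
  | .mul => { s with mul := l }
  | .num => { s with num := l }
  | .key => { s with key := l }
  | .rem => { s with rem := l }
  | .key0 => { s with key0 := l }
  | .rem0 => { s with rem0 := l }
  | .key1 => { s with key1 := l }
  | .rem1 => { s with rem1 := l }
  | .cnt => { s with cnt := l }
  | .tmpA => { s with tmpA := l }
  | .tmpB => { s with tmpB := l }
  | .flag => { s with flag := l }

theorem St.get_set (s : St) (i j : Reg) (l : List ℕ) :
    (s.set i l).get j = if j = i then l else s.get j := by
  by_cases h : j = i
  · subst h; cases j <;> rfl
  · rw [if_neg h]; cases i <;> cases j <;> first | rfl | exact absurd rfl h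

theorem St.out_set (s : St) (i : Reg) (l : List ℕ) : (s.set i l).out = s.out := by
  cases i <;> rfl

/-- The tape contents that represent stacks of numbers. -/
def enc (s : St) : Stacks Tape
  | .reg r => listWord (s.get r)
  | .aux => []
  | .carry => []
  | .out => (listWord s.out).reverse

theorem enc_set (s : St) (r : Reg) (l : List ℕ) (t : Tape) :
    enc (s.set r l) t = if t = .reg r then listWord l else enc s t := by
  cases t with
  | reg r' =>
    by_cases h : r' = r
    · subst h; simp [enc, St.get_set]
    · simp [enc, St.get_set, h]
  | aux => simp [enc]
  | carry => simp [enc]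
  | out => simp [enc, St.out_set]

theorem listWord_cons (x : ℕ) (l : List ℕ) :
    listWord (x :: l) = x.bits.map .bit ++ .sep :: listWord l := by
  simp [listWord, binaryWord]

/-- The number of steps that count as one operation if all numbers are at most `V`. -/
def opCost (V : ℕ) : ℕ := 20 * (V.size + 1)

theorem length_bits_le {x V : ℕ} (h : x ≤ V) : x.bits.length ≤ V.size := by
  rw [Nat.size_eq_bits_len]; exact Nat.size_le_size h

/-- `Run V ok p s n s'`: the program leads from `s` to `s'` in at most `n` operations on numbers up
to `V`, and all tape contents on the way satisfy `ok`. -/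
def Run (V : ℕ) (ok : Stacks Tape → Prop) (p : Prog Tape) (s : St) (n : ℕ) (s' : St) : Prop :=
  ∃ t ≤ n * opCost V, Exec ok p (enc s) t (enc s')

/-! ### Elementary operations on numbers and the calculus of their costs -/

section Macros

variable {V : ℕ}

theorem Run.of_exec {p : Prog Tape} {s s' : St} {t : ℕ} (h : Exec Free p (enc s) t (enc s'))
    (ht : t ≤ 20 * (V.size + 1)) : Run V Free p s 1 s' :=
  ⟨t, by simpa [opCost] using ht, h⟩

/-- Move a number from one stack to another one. -/
def move (i j : Reg) : Prog Tape :=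
  .seq (xfer (.reg i) (· = .aux)) (.seq
    (.basic fun _ t => if t = .reg i then .pop else if t = .reg j then .push .sep else .keep)
    (xfer .aux (· = .reg j)))

theorem run_move (i j : Reg) (hij : i ≠ j) {s : St} {x : ℕ} {l : List ℕ} (hi : s.get i = x :: l)
    (hx : x ≤ V) : Run V Free (move i j) s 1 ((s.set i l).set j (x :: s.get j)) := by
  have hlen := length_bits_le hx
  have hji := hij.symm
  refine Run.of_exec (t := (3 * x.bits.length + 1) + (1 + (3 * x.bits.reverse.length + 1)))
    (.seq (s' := fun t => if t = .reg i then .sep :: listWord l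
        else if t = .aux then x.bits.reverse.map .bit else enc s t) ?_ (.seq
      (s' := fun t => if t = .reg i then listWord l
        else if t = .reg j then .sep :: listWord (s.get j)
        else if t = .aux then x.bits.reverse.map .bit else enc s t) ?_ ?_)) ?_
  · refine xfer_exec _ _ x.bits (.sep :: listWord l) rfl _ _ ?_ ?_ ?_ ?_
    · simp [enc, hi, listWord_cons]
    · simp
    · intro t _ h2; simp at h2; subst h2; simp [enc]
    · intro t h1 h2; simp at h2; simp [h1, h2]
  · refine Exec.basic_free fun t => ?_
    by_cases h1 : t = .reg i
    · subst h1; simp [Action.apply]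
    · by_cases h2 : t = .reg j
      · subst h2; simp [hji, Action.apply, enc]
      · simp [h1, h2, Action.apply]
  · refine xfer_exec _ _ x.bits.reverse [] rfl _ _ ?_ ?_ ?_ ?_
    · simp
    · simp [enc]
    · intro t _ h2; simp at h2; subst h2; simp [enc_set, hji, listWord_cons]
    · intro t h1 h2; simp at h2; simp [h1, h2, enc_set]
  · simp only [List.length_reverse]; omega

/-- Copy the top of one stack to another one. -/
def copy (i j : Reg) : Prog Tape :=
  .seq (xfer (.reg i) (· = .aux)) (.seq
    (.basic fun _ t => if t = .reg j then .push .sep else .keep)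
    (xfer .aux (fun t => t = .reg i || t = .reg j)))

theorem run_copy (i j : Reg) (hij : i ≠ j) {s : St} {x : ℕ} {l : List ℕ} (hi : s.get i = x :: l)
    (hx : x ≤ V) : Run V Free (copy i j) s 1 (s.set j (x :: s.get j)) := by
  have hlen := length_bits_le hx
  have hji := hij.symm
  refine Run.of_exec (t := (3 * x.bits.length + 1) + (1 + (3 * x.bits.reverse.length + 1)))
    (.seq (s' := fun t => if t = .reg i then .sep :: listWord l
        else if t = .aux then x.bits.reverse.map .bit else enc s t) ?_ (.seq
      (s' := fun t => if t = .reg i then .sep :: listWord l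
        else if t = .reg j then .sep :: listWord (s.get j)
        else if t = .aux then x.bits.reverse.map .bit else enc s t) ?_ ?_)) ?_
  · refine xfer_exec _ _ x.bits (.sep :: listWord l) rfl _ _ ?_ ?_ ?_ ?_
    · simp [enc, hi, listWord_cons]
    · simp
    · intro t _ h2; simp at h2; subst h2; simp [enc]
    · intro t h1 h2; simp at h2; simp [h1, h2]
  · refine Exec.basic_free fun t => ?_
    by_cases h1 : t = .reg i
    · subst h1; simp [hij, Action.apply]
    · by_cases h2 : t = .reg j
      · subst h2; simp [hji, Action.apply, enc]
      · simp [h1, h2, Action.apply]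
  · refine xfer_exec _ _ x.bits.reverse [] rfl _ _ ?_ ?_ ?_ ?_
    · simp
    · simp [enc]
    · intro t _ h2
      simp at h2
      rcases h2 with rfl | rfl
      · simp [St.get_set, hij, enc, hi, listWord_cons]
      · simp [enc_set, hji, listWord_cons]
    · intro t h1 h2; simp at h2; simp [h1, h2, enc_set]
  · simp only [List.length_reverse]; omega

/-- Remove a number. -/
def drop (i : Reg) : Prog Tape :=
  .seq (xfer (.reg i) (fun _ => false)) (.basic fun _ t => if t = .reg i then .pop else .keep)

theorem run_drop (i : Reg) {s : St} {x : ℕ} {l : List ℕ} (hi : s.get i = x :: l)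
    (hx : x ≤ V) : Run V Free (drop i) s 1 (s.set i l) := by
  have hlen := length_bits_le hx
  refine Run.of_exec (t := (3 * x.bits.length + 1) + 1)
    (.seq (s' := fun t => if t = .reg i then .sep :: listWord l else enc s t) ?_ ?_) (by omega)
  · refine xfer_exec _ _ x.bits (.sep :: listWord l) rfl _ _ ?_ ?_ ?_ ?_
    · simp [enc, hi, listWord_cons]
    · simp
    · intro t _ h2; simp at h2
    · intro t h1 h2; simp [h1]
  · refine Exec.basic_free fun t => ?_
    by_cases h1 : t = .reg i
    · subst h1; simp [Action.apply, enc_set]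
    · simp [h1, Action.apply, enc_set]

/-- Put `0` on a stack. -/
def pushZero (i : Reg) : Prog Tape := .basic fun _ t => if t = .reg i then .push .sep else .keep

theorem run_pushZero (i : Reg) (s : St) :
    Run V Free (pushZero i) s 1 (s.set i (0 :: s.get i)) := by
  refine Run.of_exec (t := 1) (Exec.basic_free fun t => ?_) (by omega)
  by_cases h1 : t = .reg i
  · subst h1; simp [Action.apply, St.get_set, listWord_cons, enc]
  · simp [h1, Action.apply, enc_set]

/-- Put `1` on a stack. -/
def pushOne (i : Reg) : Prog Tape :=
  .seq (pushZero i) (.basic fun _ t => if t = .reg i then .push (.bit true) else .keep)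

theorem run_pushOne (i : Reg) (s : St) :
    Run V Free (pushOne i) s 1 (s.set i (1 :: s.get i)) := by
  refine Run.of_exec (t := 1 + 1) (.seq (s' := enc (s.set i (0 :: s.get i)))
    (Exec.basic_free fun t => ?_) (Exec.basic_free fun t => ?_)) (by omega)
  · by_cases h1 : t = .reg i
    · subst h1; simp [Action.apply, St.get_set, listWord_cons, enc]
    · simp [h1, Action.apply, enc_set]
  · by_cases h1 : t = .reg i
    · subst h1; simp [Action.apply, enc_set, listWord_cons]
    · simp [h1, Action.apply, enc_set]

/-- Halve the top of a stack. -/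
def half (i : Reg) : Prog Tape :=
  .basic fun v t => if t = .reg i && isBit (v t) then .pop else .keep

theorem run_half (i : Reg) {s : St} {x : ℕ} {l : List ℕ} (hi : s.get i = x :: l) :
    Run V Free (half i) s 1 (s.set i (x / 2 :: l)) := by
  refine Run.of_exec (t := 1) (Exec.basic_free fun t => ?_) (by omega)
  by_cases h1 : t = .reg i
  · subst h1
    have hb : (x / 2).bits = x.bits.tail := by rw [← Nat.div2_val, Nat.div2_bits_eq_tail]
    simp only [St.get_set, if_true, listWord_cons, hb, enc, tops, hi]
    cases h : x.bits <;> simp [isBit, Action.apply]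
  · simp [h1, Action.apply, enc_set]

/-- Write a number on the output tape. -/
def emit (i : Reg) : Prog Tape :=
  .seq (xfer (.reg i) (· = .out))
    (.basic fun _ t => if t = .reg i then .pop else if t = .out then .push .sep else .keep)

theorem run_emit (i : Reg) {s : St} {x : ℕ} {l : List ℕ} (hi : s.get i = x :: l) (hx : x ≤ V) :
    Run V Free (emit i) s 1 { s.set i l with out := s.out ++ [x] } := by
  have hlen := length_bits_le hx
  refine Run.of_exec (t := (3 * x.bits.length + 1) + 1)
    (.seq (s' := fun t => if t = .reg i then .sep :: listWord l
      else if t = .out then x.bits.reverse.map .bit ++ enc s .out else enc s t) ?_ ?_) (by omega)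
  -- A single transfer, which reverses the digits, is right here because `enc` keeps the output word
  -- reversed.
  · refine xfer_exec _ _ x.bits (.sep :: listWord l) rfl _ _ ?_ ?_ ?_ ?_
    · simp [enc, hi, listWord_cons]
    · simp
    · intro t _ h2; simp at h2; simp [h2]
    · intro t h1 h2; simp at h2; simp [h1, h2]
  · refine Exec.basic_free fun t => ?_
    have hset := enc_set s i l t
    cases t with
    | out => simp [Action.apply, enc, listWord, binaryWord]
    | reg r =>
      have : enc { s.set i l with out := s.out ++ [x] } (.reg r) = enc (s.set i l) (.reg r) := by
        cases i <;> cases r <;> rfl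
      rw [this, hset]
      by_cases h1 : r = i <;> simp [h1, Action.apply]
    | aux => simp [Action.apply, enc]
    | carry => simp [Action.apply, enc]

/-- A serial operation on the tops of two stacks; the result is put on a third one. -/
def binop (g : DigitOp) (i j k : Reg) : Prog Tape :=
  .seq (.basic fun _ t => if t = .carry then .push (.bit false) else .keep) (.seq
    (serial g (.reg i) (.reg j) .aux .carry) (.seq
    (strip .aux) (.seq
    (.basic fun _ t => if t = .reg k then .push .sep else .keep)
    (xfer .aux (· = .reg k)))))

theorem run_binop (g : DigitOp) (i j k : Reg) (hij : i ≠ j) {s : St} {x y : ℕ} {l m : List ℕ}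
    (hi : s.get i = x :: l) (hj : s.get j = y :: m) (hx : x ≤ V) (hy : y ≤ V) :
    Run V Free (binop g i j k) s 1
      (((s.set i l).set j m).set k (g.eval x y :: ((s.set i l).set j m).get k)) := by
  have hlx := length_bits_le hx
  have hly := length_bits_le hy
  have hji := hij.symm
  set s1 := (s.set i l).set j m with hs1
  set d := g.digits false x.bits y.bits with hd
  have hld : d.length ≤ V.size + 1 := (length_digits_le g _ _ _).trans (by omega)
  have hbits : (g.eval x y).bits = (d.reverse.dropWhile (! ·)).reverse := (bits_digitsVal d).symm
  have hle : (g.eval x y).bits.length ≤ d.length := by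
    rw [hbits, List.length_reverse]
    exact (List.dropWhile_suffix _).sublist.length_le.trans (by simp)
  obtain ⟨t1, ht1, hE1⟩ := serial_exec g (i := .reg i) (j := .reg j) (x := Tape.aux) (c := .carry)
    (by simpa using hij) (by simp) (by simp) (by simp) (by simp) (by simp) false x.bits y.bits []
    (listWord l) (listWord m) (fun t => if t = .carry then [.bit false] else enc s t)
    (fun t => if t = .aux then d.reverse.map .bit else enc s1 t)
    (by simp [enc, hi, listWord_cons]) (by simp [enc, hj, listWord_cons]) (by simp [enc]) (by simp)
    (by simp [s1, enc_set, hij]) (by simp [s1, enc_set]) (by simp [d]) (by simp [enc])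
    (fun t h1 h2 h3 h4 => by simp [h1, h2, h3, h4, s1, enc_set])
  obtain ⟨t2, ht2, hE2⟩ := strip_exec Tape.aux d.reverse
    (fun t => if t = .aux then d.reverse.map .bit else enc s1 t)
    (fun t => if t = .aux then (g.eval x y).bits.reverse.map .bit else enc s1 t) (by simp)
    (by simp [hbits]) (fun t h1 => by simp [h1])
  rw [List.length_reverse] at ht2
  refine Run.of_exec (t := 1 + (t1 + (t2 + (1 + (3 * (g.eval x y).bits.reverse.length + 1)))))
    (.seq (Exec.basic_free fun t => ?_) (.seq hE1 (.seq hE2 (.seq (s' := fun t =>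
      if t = .aux then (g.eval x y).bits.reverse.map .bit else if t = .reg k then
      .sep :: listWord (s1.get k) else enc s1 t) (Exec.basic_free fun t => ?_) ?_)))) ?_
  · by_cases h1 : t = .carry
    · subst h1; simp [enc, Action.apply]
    · simp [h1, Action.apply]
  · by_cases h1 : t = .reg k
    · subst h1; simp [enc, Action.apply]
    · simp [h1, Action.apply]
  · refine xfer_exec _ _ (g.eval x y).bits.reverse [] rfl _ _ ?_ ?_ ?_ ?_
    · simp
    · simp [enc]
    · intro t _ h2; simp at h2; subst h2; simp [enc_set, listWord_cons]
    · intro t h1 h2; simp at h2; simp [h1, h2, enc_set]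
  · rw [List.length_reverse]; omega

/-- Whether the top of a stack is `0`. -/
def isZero (i : Reg) : (Tape → Option IOSymbol) → Bool := fun v => v (.reg i) = some .sep

/-- Whether the top of a stack is odd. -/
def isOdd (i : Reg) : (Tape → Option IOSymbol) → Bool := fun v => v (.reg i) = some (.bit true)

/-- Whether a stack contains numbers. -/
def nonempty (i : Reg) : (Tape → Option IOSymbol) → Bool := fun v => (v (.reg i)).isSome

/-- In canonical binary only `0` is the empty word, so exactly for `0` the separator is on top. -/
theorem isZero_eq {i : Reg} {s : St} {x : ℕ} {l : List ℕ} (hi : s.get i = x :: l) :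
    isZero i (tops (enc s)) = decide (x = 0) := by
  simp only [isZero, tops, enc, hi, listWord_cons]
  induction x using Nat.binaryRec' with
  | zero => simp
  | bit b n h _ =>
    rw [Nat.bits_append_bit _ _ h]
    have : Nat.bit b n ≠ 0 := by
      cases b
      · intro h'; exact absurd (h (by simpa [Nat.bit] using h')) (by simp)
      · simp [Nat.bit]
    simp [this]

theorem isOdd_eq {i : Reg} {s : St} {x : ℕ} {l : List ℕ} (hi : s.get i = x :: l) :
    isOdd i (tops (enc s)) = decide (x % 2 = 1) := by
  simp only [isOdd, tops, enc, hi, listWord_cons]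
  induction x using Nat.binaryRec' with
  | zero => simp
  | bit b n h _ =>
    rw [Nat.bits_append_bit _ _ h]
    cases b <;> simp [Nat.bit]

theorem nonempty_cons {i : Reg} {s : St} {x : ℕ} {l : List ℕ} (hi : s.get i = x :: l) :
    nonempty i (tops (enc s)) = true := by
  simp only [nonempty, tops, enc, hi, listWord_cons]
  cases x.bits <;> simp

theorem nonempty_nil {i : Reg} {s : St} (hi : s.get i = []) :
    nonempty i (tops (enc s)) = false := by
  simp [nonempty, tops, enc, hi, listWord]

variable {ok : Stacks Tape → Prop} {p q : Prog Tape} {s s' s'' : St} {n m : ℕ}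

theorem Run.mono (h : Run V ok p s n s') (hn : n ≤ m) : Run V ok p s m s' := by
  obtain ⟨t, ht, h⟩ := h
  exact ⟨t, ht.trans (Nat.mul_le_mul_right _ hn), h⟩

theorem Run.seq (h : Run V ok p s n s') (h' : Run V ok q s' m s'') :
    Run V ok (.seq p q) s (n + m) s'' := by
  obtain ⟨t, ht, h⟩ := h
  obtain ⟨t', ht', h'⟩ := h'
  exact ⟨t + t', by rw [add_mul]; omega, .seq h h'⟩

theorem two_le_opCost : 2 ≤ opCost V := by unfold opCost; omega

theorem Run.ite_true {c} (hc : c (tops (enc s)) = true) (h : Run V ok p s n s') :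
    Run V ok (.ite c p q) s (n + 1) s' := by
  obtain ⟨t, ht, h⟩ := h
  have := two_le_opCost (V := V)
  exact ⟨t + 2, by rw [add_mul]; omega, .ite_true h.ok_start hc h⟩

theorem Run.ite_false {c} (hc : c (tops (enc s)) = false) (h : Run V ok q s n s') :
    Run V ok (.ite c p q) s (n + 1) s' := by
  obtain ⟨t, ht, h⟩ := h
  have := two_le_opCost (V := V)
  exact ⟨t + 1, by rw [add_mul]; omega, .ite_false h.ok_start hc h⟩

theorem Run.loop_false {c} (hok : ok (enc s)) (hc : c (tops (enc s)) = false) :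
    Run V ok (.loop c p) s 1 s := by
  have := two_le_opCost (V := V)
  exact ⟨1, by omega, .loop_false hok hc⟩

theorem Run.loop_true {c} (hc : c (tops (enc s)) = true) (h : Run V ok p s n s')
    (h' : Run V ok (.loop c p) s' m s'') : Run V ok (.loop c p) s (n + 1 + m) s'' := by
  obtain ⟨t, ht, h⟩ := h
  obtain ⟨t', ht', h'⟩ := h'
  have := two_le_opCost (V := V)
  exact ⟨t + 2 + t', by rw [add_mul, add_mul]; omega, .loop_true h.ok_start hc h h'⟩

theorem Run.bounded (h : Run V Free p s n s') {S : ℕ}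
    (hS : ∀ i, (enc s i).length + n * opCost V ≤ S) : Run V (Bounded S) p s n s' := by
  obtain ⟨t, ht, h⟩ := h
  exact ⟨t, ht, h.bounded fun i => by have := hS i; omega⟩

end Macros

/-! ### Composite operations -/

theorem St.ext_get {s s' : St} (h : ∀ r, s.get r = s'.get r) (ho : s.out = s'.out) : s = s' := by
  have h1 := h .inp
  have h2 := h .lo
  have h3 := h .hi
  have h4 := h .div
  have h5 := h .pow
  have h6 := h .mul
  have h7 := h .num
  have h8 := h .key
  have h9 := h .rem
  have h10 := h .key0
  have h11 := h .rem0
  have h12 := h .key1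
  have h13 := h .rem1
  have h14 := h .cnt
  have h15 := h .tmpA
  have h16 := h .tmpB
  have h17 := h .flag
  cases s; cases s'
  simp only [St.get] at *
  subst_vars
  rfl

theorem Run.congr {V : ℕ} {ok : Stacks Tape → Prop} {p : Prog Tape} {s s' s'' : St} {n m : ℕ}
    (h : Run V ok p s n s') (hn : n ≤ m) (hs : s' = s'') : Run V ok p s m s'' :=
  hs ▸ h.mono hn

/-- The program that does nothing. -/
def skip : Prog Tape := .basic fun _ _ => .keep

section Composite

variable {V : ℕ}

theorem run_skip (s : St) : Run V Free skip s 1 s :=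
  Run.of_exec (t := 1) (Exec.basic_free fun _ => rfl) (by omega)

/-- Add the top of the stack `j` to the top of the stack `i`. -/
def addTo (i j : Reg) : Prog Tape := .seq (copy j .tmpA) (binop plus i .tmpA i)

theorem run_addTo (i j : Reg) (hi' : i ≠ .tmpA) (hj' : j ≠ .tmpA) {s : St} {x y : ℕ}
    {l m : List ℕ} (hi : s.get i = x :: l) (hj : s.get j = y :: m) (hx : x ≤ V) (hy : y ≤ V) :
    Run V Free (addTo i j) s 2 (s.set i ((x + y) :: l)) := by
  have h1 := run_copy (V := V) j .tmpA hj' hj hy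
  have h2 := run_binop (V := V) plus i .tmpA i hi' (s := s.set .tmpA (y :: s.get .tmpA)) (x := x)
    (y := y) (l := l) (m := s.get .tmpA) (by simp [St.get_set, hi', hi]) (by simp [St.get_set])
        hx hy
  refine (h1.seq h2).congr (by omega) ?_
  refine St.ext_get (fun r => ?_) (by simp [St.out_set])
  simp only [St.get_set, eval_plus]
  split_ifs <;> simp_all

/-- Add one to the top of a stack. -/
def inc (i : Reg) : Prog Tape := .seq (pushOne .tmpA) (binop plus i .tmpA i)

theorem run_inc (i : Reg) (hi' : i ≠ .tmpA) {s : St} {x : ℕ} {l : List ℕ}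
    (hi : s.get i = x :: l) (hx : x ≤ V) (hV : 1 ≤ V) :
    Run V Free (inc i) s 2 (s.set i ((x + 1) :: l)) := by
  have h1 := run_pushOne (V := V) .tmpA s
  have h2 := run_binop (V := V) plus i .tmpA i hi' (s := s.set .tmpA (1 :: s.get .tmpA)) (x := x)
    (y := 1) (l := l) (m := s.get .tmpA) (by simp [St.get_set, hi', hi]) (by simp [St.get_set])
        hx hV
  refine (h1.seq h2).congr (by omega) ?_
  refine St.ext_get (fun r => ?_) (by simp [St.out_set])
  simp only [St.get_set, eval_plus]
  split_ifs <;> simp_all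

/-- Put `1` on the flag stack if the top of `i` is less than the top of `j`, and `0` otherwise. -/
def cmp (i j : Reg) : Prog Tape :=
  .seq (copy i .tmpA) (.seq (copy j .tmpB) (binop less .tmpA .tmpB .flag))

theorem run_cmp (i j : Reg) (hi' : i ≠ .tmpA) (hj' : j ≠ .tmpA) (hj'' : j ≠ .tmpB)
    {s : St} {x y : ℕ} {l m : List ℕ} (hi : s.get i = x :: l) (hj : s.get j = y :: m) (hx : x ≤ V)
    (hy : y ≤ V) :
    Run V Free (cmp i j) s 3 (s.set .flag ((if x < y then 1 else 0) :: s.get .flag)) := by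
  have h1 := run_copy (V := V) i .tmpA hi' hi hx
  have h2 := run_copy (V := V) j .tmpB hj'' (s := s.set .tmpA (x :: s.get .tmpA)) (l := m)
    (by simp [St.get_set, hj', hj]) hy
  have h3 := run_binop (V := V) less .tmpA .tmpB .flag (by decide)
    (s := (s.set .tmpA (x :: s.get .tmpA)).set .tmpB
      (y :: (s.set .tmpA (x :: s.get .tmpA)).get .tmpB)) (x := x)
    (y := y) (l := s.get .tmpA) (m := s.get .tmpB) rfl rfl hx hy
  rw [eval_less] at h3
  exact h1.seq (h2.seq h3)

/-- Run `p` if the top of `i` is less than the top of `j`, and `q` otherwise. -/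
def ifLess (i j : Reg) (p q : Prog Tape) : Prog Tape :=
  .seq (cmp i j) (.ite (isZero .flag) (.seq (drop .flag) q) (.seq (drop .flag) p))

theorem run_ifLess (i j : Reg) (p q : Prog Tape) (hi' : i ≠ .tmpA) (hj' : j ≠ .tmpA)
    (hj'' : j ≠ .tmpB) {s s' : St} {x y n : ℕ} {l m : List ℕ} (hi : s.get i = x :: l)
    (hj : s.get j = y :: m) (hx : x ≤ V) (hy : y ≤ V) (hV : 1 ≤ V)
    (hp : x < y → Run V Free p s n s') (hq : y ≤ x → Run V Free q s n s') :
    Run V Free (ifLess i j p q) s (n + 5) s' := by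
  have h1 := run_cmp (V := V) i j hi' hj' hj'' hi hj hx hy
  have h2 : Run V Free (drop .flag) (s.set .flag ((if x < y then 1 else 0) :: s.get .flag)) 1 s :=
    run_drop (V := V) .flag (x := if x < y then 1 else 0) (l := s.flag)
      (s := s.set .flag ((if x < y then 1 else 0) :: s.get .flag)) rfl (by split_ifs <;> omega)
  refine (h1.seq (m := n + 2) ?_).mono (by omega)
  by_cases h : x < y
  · refine (Run.ite_false ?_ (h2.seq (hp h))).mono (by omega)
    rw [isZero_eq (x := if x < y then 1 else 0) (l := s.flag) rfl]
    simp [h]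
  · refine (Run.ite_true ?_ (h2.seq (hq (by omega)))).mono (by omega)
    rw [isZero_eq (x := if x < y then 1 else 0) (l := s.flag) rfl]
    simp [h]

/-- The loop of `whileLess`. -/
def lessLoop (b : Bool) (i j : Reg) (p : Prog Tape) : Prog Tape :=
  .loop (fun v => isZero .flag v != b) (.seq (drop .flag) (.seq p (cmp i j)))

/-- Run `p` as long as the truth value of `x < y` is `b`, where `x` and `y` are the tops of the
stacks `i` and `j`. -/
def whileLess (b : Bool) (i j : Reg) (p : Prog Tape) : Prog Tape :=
  .seq (cmp i j) (.seq (lessLoop b i j p) (drop .flag))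

/-- The runs of `whileLess`. -/
inductive Iter (V : ℕ) (b : Bool) (i j : Reg) (p : Prog Tape) : St → ℕ → St → Prop where
  | final {s x y l m n} : s.get i = x :: l → s.get j = y :: m → x ≤ V → y ≤ V →
      decide (x < y) = !b → Iter V b i j p s n s
  | step {s x y l m n s' n' s''} : s.get i = x :: l → s.get j = y :: m → x ≤ V → y ≤ V →
      decide (x < y) = b → Run V Free p s n s' → Iter V b i j p s' n' s'' →
      Iter V b i j p s (n + 5 + n') s''

theorem Iter.mono {b : Bool} {i j : Reg} {p : Prog Tape} {s s' : St} {n m : ℕ}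
    (h : Iter V b i j p s n s') (hn : n ≤ m) : Iter V b i j p s m s' := by
  induction h generalizing m with
  | final hi hj hx hy hb => exact .final hi hj hx hy hb
  | @step s x y l r n s' n' s'' hi hj hx hy hb hp _ ih =>
    rw [show m = n + 5 + (m - (n + 5)) by omega]
    exact .step hi hj hx hy hb hp (ih (by omega))

/-- Each round of the loop ends with the comparison for the next one. The induction therefore treats
the comparison and the loop together, and the flag of the last comparison is left over. -/
theorem Iter.run_lessLoop {b : Bool} {i j : Reg} {p : Prog Tape} (hi' : i ≠ .tmpA)
    (hj' : j ≠ .tmpA) (hj'' : j ≠ .tmpB) (hV : 1 ≤ V) {s s' : St} {n : ℕ}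
    (h : Iter V b i j p s n s') :
    ∃ f ≤ 1, Run V Free (.seq (cmp i j) (lessLoop b i j p)) s (n + 4)
      (s'.set .flag (f :: s'.flag)) := by
  induction h with
  | @final s x y l m n hi hj hx hy hb =>
    have h1 := run_cmp (V := V) i j hi' hj' hj'' hi hj hx hy
    refine ⟨if x < y then 1 else 0, by split_ifs <;> omega,
      (h1.seq (Run.loop_false trivial ?_)).mono (by omega)⟩
    rw [isZero_eq (x := if x < y then 1 else 0) (l := s.flag) rfl]
    by_cases h : x < y <;> simp_all
  | @step s x y l m n s' n' s'' hi hj hx hy hb hp _ ih =>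
    obtain ⟨f, hf, t, ht, ih⟩ := ih
    have h1 := run_cmp (V := V) i j hi' hj' hj'' hi hj hx hy
    have h2 : Run V Free (drop .flag) (s.set .flag ((if x < y then 1 else 0) :: s.get .flag)) 1 s :=
      run_drop (V := V) .flag (x := if x < y then 1 else 0) (l := s.flag)
        (s := s.set .flag ((if x < y then 1 else 0) :: s.get .flag)) rfl (by split_ifs <;> omega)
    refine ⟨f, hf, ?_⟩
    obtain ⟨t1, ht1, h1⟩ := h1
    obtain ⟨t2, ht2, h2⟩ := h2
    obtain ⟨t3, ht3, h3⟩ := hp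
    cases ih with
    | @seq _ _ _ t4 _ t5 _ h4 h5 =>
      refine ⟨t1 + ((t2 + (t3 + t4)) + 2 + t5), ?_,
        .seq h1 (.loop_true trivial ?_ (.seq h2 (.seq h3 h4)) h5)⟩
      · have := two_le_opCost (V := V)
        simp only [add_mul] at *
        omega
      · rw [isZero_eq (x := if x < y then 1 else 0) (l := s.flag) rfl]
        by_cases h : x < y <;> simp_all

theorem Iter.run {b : Bool} {i j : Reg} {p : Prog Tape} (hi' : i ≠ .tmpA)
    (hj' : j ≠ .tmpA) (hj'' : j ≠ .tmpB) (hV : 1 ≤ V) {s s' : St} {n : ℕ}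
    (h : Iter V b i j p s n s') : Run V Free (whileLess b i j p) s (n + 5) s' := by
  obtain ⟨f, hf, t, ht, h1⟩ := h.run_lessLoop hi' hj' hj'' hV
  have h2 : Run V Free (drop .flag) (s'.set .flag (f :: s'.flag)) 1 s' :=
    run_drop (V := V) .flag (x := f) (l := s'.flag) (s := s'.set .flag (f :: s'.flag)) rfl
      (by omega)
  obtain ⟨t2, ht2, h2⟩ := h2
  cases h1 with
  | @seq _ _ _ t4 _ t5 _ h4 h5 =>
    refine ⟨t4 + (t5 + t2), ?_, .seq h4 (.seq h5 h2)⟩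
    simp only [add_mul] at *
    omega

/-- Move all numbers from one stack to another one. -/
def pour (i j : Reg) : Prog Tape := .loop (nonempty i) (move i j)

theorem run_pour (i j : Reg) (hij : i ≠ j) (l : List ℕ) {s : St} (hi : s.get i = l)
    (hl : ∀ x ∈ l, x ≤ V) : Run V Free (pour i j) s (2 * l.length + 1)
      ((s.set i []).set j (l.reverse ++ s.get j)) := by
  induction l generalizing s with
  | nil =>
    refine (Run.loop_false (ok := Free) trivial (nonempty_nil hi)).congr (by simp) ?_
    refine St.ext_get (fun r => ?_) (by simp [St.out_set])
    simp only [St.get_set]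
    split_ifs <;> simp_all
  | cons x l ih =>
    have h1 := run_move (V := V) i j hij hi (hl x (by simp))
    have h2 := ih (s := (s.set i l).set j (x :: s.get j)) (by simp [St.get_set, hij])
      (fun y hy => hl y (by simp [hy]))
    refine (Run.loop_true (nonempty_cons hi) h1 h2).congr (by simp; omega) ?_
    refine St.ext_get (fun r => ?_) (by simp [St.out_set])
    simp only [St.get_set]
    split_ifs <;> simp_all

/-- Remove all numbers from a stack. -/
def clear (i : Reg) : Prog Tape := .loop (nonempty i) (drop i)

theorem run_clear (i : Reg) (l : List ℕ) {s : St} (hi : s.get i = l)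
    (hl : ∀ x ∈ l, x ≤ V) : Run V Free (clear i) s (2 * l.length + 1) (s.set i []) := by
  induction l generalizing s with
  | nil =>
    refine (Run.loop_false (ok := Free) trivial (nonempty_nil hi)).congr (by simp) ?_
    refine St.ext_get (fun r => ?_) (by simp [St.out_set])
    simp only [St.get_set]
    split_ifs <;> simp_all
  | cons x l ih =>
    have h1 := run_drop (V := V) i hi (hl x (by simp))
    have h2 := ih (s := s.set i l) (by simp [St.get_set]) (fun y hy => hl y (by simp [hy]))
    refine (Run.loop_true (nonempty_cons hi) h1 h2).congr (by simp; omega) ?_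
    refine St.ext_get (fun r => ?_) (by simp [St.out_set])
    simp only [St.get_set]
    split_ifs <;> simp_all

/-! ### The multiples of one number -/

/-- The list `[2 ^ (k - 1) * d, …, 2 * d, d]`. -/
def doublings (d : ℕ) : ℕ → List ℕ
  | 0 => []
  | k + 1 => 2 ^ k * d :: doublings d k

/-- Double the top of the stack `pow`, keeping the old one, while it is at most the top of `lo`. -/
def growDoublings : Prog Tape :=
  whileLess false .lo .pow
    (.seq (copy .pow .tmpA) (.seq (copy .pow .tmpB) (binop plus .tmpA .tmpB .pow)))

/-- The fuel `f` suffices because every round doubles the top. Unless no round takes place, the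
doubling before the last was at most `M`, so the last one is at most `2 * M`; this keeps all numbers
below `V`. -/
theorem iter_growDoublings {M d : ℕ} {ls ps : List ℕ} (hV : 2 * M ≤ V) (f : ℕ) :
    ∀ (k : ℕ) (s : St), s.lo = M :: ls → s.pow = doublings d (k + 1) ++ ps → M < 2 ^ (k + f) * d →
      2 ^ k * d ≤ V → ∃ k', k' ≤ k + f ∧ M < 2 ^ k' * d ∧ 2 ^ k' * d ≤ max (2 ^ k * d) (2 * M) ∧
        Iter V false .lo .pow
          (.seq (copy .pow .tmpA) (.seq (copy .pow .tmpB) (binop plus .tmpA .tmpB .pow)))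
          s (8 * f) { s with pow := doublings d (k' + 1) ++ ps } := by
  induction f with
  | zero =>
    intro k s hlo hpow hlt hk
    refine ⟨k, le_rfl, by simpa using hlt, le_max_left _ _, ?_⟩
    rw [← hpow]
    exact .final (i := .lo) (j := .pow) (s := s) (x := M) (y := 2 ^ k * d) hlo hpow (by omega) hk
        (by simpa using hlt)
  | succ f ih =>
    intro k s hlo hpow hlt hk
    by_cases h : M < 2 ^ k * d
    · refine ⟨k, by omega, h, le_max_left _ _, ?_⟩
      rw [← hpow]
      exact (Iter.final (i := .lo) (j := .pow) (s := s) (n := 0) (x := M) (y := 2 ^ k * d)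
          hlo hpow (by omega) hk (by simpa using h)).mono
        (by omega)
    · have hd : 2 ^ (k + 1) * d = 2 ^ k * d + 2 ^ k * d := by ring
      obtain ⟨k', hk', hlt', hle, hit⟩ := ih (k + 1)
        { s with pow := doublings d (k + 1 + 1) ++ ps } hlo rfl
        (by rwa [show k + 1 + f = k + (f + 1) by ring]) (by omega)
      refine ⟨k', by omega, hlt', by omega, ?_⟩
      have h1 := run_copy (V := V) .pow .tmpA (by decide) (s := s) hpow hk
      have h2 := run_copy (V := V) .pow .tmpB (by decide)
        (s := { s with tmpA := 2 ^ k * d :: s.tmpA }) hpow hk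
      have h3 := run_binop (V := V) plus .tmpA .tmpB .pow (by decide)
        (s := { s with tmpA := 2 ^ k * d :: s.tmpA, tmpB := 2 ^ k * d :: s.tmpB })
        (x := 2 ^ k * d) (y := 2 ^ k * d) (l := s.tmpA) (m := s.tmpB) rfl rfl hk hk
      rw [eval_plus, ← hd] at h3
      have h4 : St.get { s with tmpA := s.tmpA, tmpB := s.tmpB } .pow = _ := hpow
      have h5 := h1.seq (h2.seq h3)
      refine (Iter.step (i := .lo) (j := .pow) (s := s) (x := M) (y := 2 ^ k * d) hlo hpow
          (by omega) hk (by simpa using h)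
        (h5.congr le_rfl ?_) hit).mono (by omega)
      simp only [St.set, St.get, hpow]
      rfl

/-- Find the largest multiple of `d` that is at most the top of `lo`, where `pow` holds doublings
of `d`, and add it to the top of `mul`. -/
def greedy : Prog Tape :=
  .loop (nonempty .pow) (.seq (copy .mul .num) (.seq (move .pow .tmpA) (.seq
    (binop plus .num .tmpA .num)
    (ifLess .lo .num (drop .num) (.seq (drop .mul) (move .num .mul))))))

/-- Long division in binary. The invariant is `x ≤ M < x + 2 ^ k * d` with `d ∣ x`; adding the next
doubling whenever the sum does not exceed `M` lowers `k` by one. At `k = 0` the number `x` is the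
largest multiple of `d` up to `M`. -/
theorem run_greedy {M d : ℕ} {ls ms : List ℕ} (hV1 : 1 ≤ V) (hMV : M ≤ V) (k : ℕ) :
    ∀ (x : ℕ) (s : St), s.lo = M :: ls → s.pow = doublings d k → s.mul = x :: ms → x ≤ M →
      d ∣ x → M < x + 2 ^ k * d → (∀ j < k, M + 2 ^ j * d ≤ V) →
      ∃ x', x' ≤ M ∧ d ∣ x' ∧ M < x' + d ∧
        Run V Free greedy s (12 * k + 1) { s with pow := [], mul := x' :: ms } := by
  induction k with
  | zero =>
    intro x s hlo hpow hmul hx hd hlt hV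
    refine ⟨x, hx, hd, by simpa using hlt, ?_⟩
    have : { s with pow := [], mul := x :: ms } = s := by rw [← hmul, show [] = s.pow from hpow.symm]
    rw [this]
    exact Run.loop_false trivial (nonempty_nil (i := .pow) (s := s) hpow)
  | succ k ih =>
    intro x s hlo hpow hmul hx hd hlt hV
    have hpk : 2 ^ (k + 1) * d = 2 ^ k * d + 2 ^ k * d := by ring
    have hVk := hV k (by omega)
    set w := 2 ^ k * d with hw
    have h1 := run_copy (V := V) .mul .num (by decide) (s := s) hmul (by omega)
    have h2 := run_move (V := V) .pow .tmpA (by decide) (s := s.set .num (x :: s.num)) (x := w)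
      (l := doublings d k) hpow (by omega)
    have h3 := run_binop (V := V) plus .num .tmpA .num (by decide)
      (s := { s with num := x :: s.num, pow := doublings d k, tmpA := w :: s.tmpA })
      (x := x) (y := w) (l := s.num) (m := s.tmpA) rfl rfl (by omega) (by omega)
    rw [eval_plus] at h3
    obtain ⟨x2, hx2, hdx, hlt2, hrun⟩ : ∃ x2, x2 ≤ M ∧ d ∣ x2 ∧ M < x2 + w ∧
        Run V Free (ifLess .lo .num (drop .num) (.seq (drop .mul) (move .num .mul)))
          { s with num := (x + w) :: s.num, pow := doublings d k } 7
          { s with pow := doublings d k, mul := x2 :: ms } := by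
      by_cases h : M < x + w
      · refine ⟨x, hx, hd, h, run_ifLess (n := 2) (x := M) (y := x + w) (l := ls) (m := s.num)
          .lo .num _ _ (by decide) (by decide) (by decide) hlo rfl
          (by omega) (by omega) hV1 (fun _ => ?_) (fun h' => absurd h' (by omega))⟩
        rw [← hmul]
        exact (run_drop (V := V) .num
          (s := { s with num := (x + w) :: s.num, pow := doublings d k }) rfl (by omega)).mono
          (by omega)
      · refine ⟨x + w, by omega, (Nat.dvd_add_right hd).2 (Dvd.intro_left _ rfl), by omega,
          run_ifLess (n := 2) (x := M) (y := x + w) (l := ls) (m := s.num) .lo .num _ _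
          (by decide) (by decide) (by decide) hlo rfl
          (by omega) (by omega) hV1 (fun h' => absurd h' h) (fun _ => ?_)⟩
        have h4 := run_drop (V := V) .mul
          (s := { s with num := (x + w) :: s.num, pow := doublings d k }) hmul (by omega)
        exact h4.seq (run_move (V := V) .num .mul (by decide) (s := { s with
          num := (x + w) :: s.num, pow := doublings d k, mul := ms }) (x := x + w)
          (l := s.num) rfl (by omega))
    obtain ⟨x', hx', hdx', hlt', hrun'⟩ := ih x2 { s with pow := doublings d k, mul := x2 :: ms }
      hlo rfl rfl hx2 hdx hlt2 (fun j hj => hV j (by omega))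
    refine ⟨x', hx', hdx', hlt', ?_⟩
    refine (Run.loop_true (nonempty_cons (i := .pow) (s := s) hpow) (h1.seq (h2.seq
        (h3.seq hrun))) hrun').mono
      (by omega)

end Composite

/-! ### Listing the multiples of a divisor in an interval -/

section Marks

variable {V : ℕ}

/-- Put the top of `mul` on the key stacks, and increase it by the top of `div`. -/
def markStep : Prog Tape := .seq (copy .mul .key) (.seq (copy .mul .rem) (addTo .mul .div))

/-- Each multiple is stored twice: on `key` as the number to be sorted, and on `rem` as the copy
whose binary digits the radix sort consumes. The fuel `f` suffices because `d ≥ 1`. -/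
theorem iter_markStep {N d : ℕ} {hs ms ds : List ℕ} (hd : 1 ≤ d) (hV : N + d ≤ V) (f : ℕ) :
    ∀ (x : ℕ) (s : St), s.hi = N :: hs → s.mul = x :: ms → s.div = d :: ds → N < x + f → x ≤ V →
      ∃ (L : List ℕ) (x' : ℕ), x' ≤ V ∧ (∀ y, y ∈ L ↔ ∃ i, y = x + i * d ∧ y ≤ N) ∧
        L.length * d ≤ N + d - x ∧
        Iter V false .hi .mul markStep s (9 * L.length)
          { s with key := L ++ s.key, rem := L ++ s.rem, mul := x' :: ms } := by
  have hfinal : ∀ (x : ℕ) (s : St), s.hi = N :: hs → s.mul = x :: ms → N < x → x ≤ V →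
      ∃ (L : List ℕ) (x' : ℕ), x' ≤ V ∧ (∀ y, y ∈ L ↔ ∃ i, y = x + i * d ∧ y ≤ N) ∧
        L.length * d ≤ N + d - x ∧
        Iter V false .hi .mul markStep s (9 * L.length)
          { s with key := L ++ s.key, rem := L ++ s.rem, mul := x' :: ms } := by
    intro x s hhi hmul hlt hx
    refine ⟨[], x, hx, ?_, by simp, ?_⟩
    · intro y
      simp only [List.not_mem_nil, false_iff, not_exists, not_and, not_le]
      rintro i rfl
      exact lt_of_lt_of_le hlt (Nat.le_add_right _ _)
    · rw [← hmul]
      exact .final (i := .hi) (j := .mul) (s := s) hhi hmul (by omega) hx (by simpa using hlt)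
  induction f with
  | zero => intro x s hhi hmul hdiv hlt hx; exact hfinal x s hhi hmul (by omega) hx
  | succ f ih =>
    intro x s hhi hmul hdiv hlt hx
    by_cases h : N < x
    · exact hfinal x s hhi hmul h hx
    · obtain ⟨L, x', hx', hL, hlen, hit⟩ := ih (x + d)
        { s with key := x :: s.key, rem := x :: s.rem, mul := (x + d) :: ms } hhi rfl hdiv
            (by omega)
        (by omega)
      have h1 := run_copy (V := V) .mul .key (by decide) (s := s) hmul hx
      have h2 := run_copy (V := V) .mul .rem (by decide) (s := { s with key := x :: s.key }) hmul hx
      have h3 := run_addTo (V := V) .mul .div (by decide) (by decide)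
        (s := { s with key := x :: s.key, rem := x :: s.rem }) hmul hdiv hx (by omega)
      refine ⟨L ++ [x], x', hx', ?_, ?_, ?_⟩
      · intro y
        rw [List.mem_append, hL, List.mem_singleton]
        constructor
        · rintro (⟨i, rfl, hy⟩ | rfl)
          · exact ⟨i + 1, by ring, hy⟩
          · exact ⟨0, by ring, by omega⟩
        · rintro ⟨i, rfl, hy⟩
          cases i with
          | zero => right; ring
          | succ i => left; exact ⟨i, by ring, hy⟩
      · rw [List.length_append, List.length_singleton, add_mul]; omega
      · have h5 := Iter.step (V := V) (b := false) (p := markStep) (i := .hi) (j := .mul) (s := s)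
          hhi hmul (by omega) hx (by simpa using h) (h1.seq (h2.seq h3)) hit
        simp only [List.append_assoc, List.singleton_append]
        exact h5.mono (by simp; omega)

/-- Put the multiples of the top `d` of `div` that are at least `2 * d`, greater than the top of
`lo` and at most the top of `hi` on the key stacks, and remove `d`. -/
def marks : Prog Tape :=
  .seq (copy .div .pow) (.seq growDoublings (.seq (pushZero .mul) (.seq greedy (.seq
    (addTo .mul .div) (.seq (ifLess .div .mul skip (addTo .mul .div)) (.seq
    (whileLess false .hi .mul markStep) (.seq (drop .mul) (drop .div))))))))

/-- If `x` is the largest multiple of `d` up to `M`, then `x + d` is the least one above `M`. It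
equals `d` exactly when `x = 0`, and then one more `d` is added, so that `d` itself is not marked.
Finding `x` takes `O(V.size)` operations, and each mark a bounded number. -/
theorem run_marks {M N d : ℕ} {ls hs ds : List ℕ} (hd : 1 ≤ d) (hM : 4 * M + 4 ≤ V)
    (hdV : 4 * d + 4 ≤ V) (hN : N + d ≤ V) {s : St} (hlo : s.lo = M :: ls) (hhi : s.hi = N :: hs)
        (hdiv : s.div = d :: ds)
    (hpow : s.pow = []) :
    ∃ L : List ℕ, (∀ y, y ∈ L ↔ d ∣ y ∧ M < y ∧ y ≤ N ∧ 2 * d ≤ y) ∧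
      L.length ≤ (N - M) / d + 1 ∧
      Run V Free marks s (20 * V.size + 9 * L.length + 50)
        { s with div := ds, key := L ++ s.key, rem := L ++ s.rem } := by
  have hMV : M.size ≤ V.size := Nat.size_le_size (by omega)
  have h1 : Run V Free _ s 1 { s with pow := doublings d 1 } :=
    (run_copy (V := V) .div .pow (by decide) (s := s) hdiv (by omega)).congr le_rfl
      (by simp [St.set, St.get, hpow, doublings])
  -- The fuel is `M.size`, since `M < 2 ^ M.size ≤ 2 ^ M.size * d`.
  obtain ⟨k, hk, hlt, hle, hit⟩ := iter_growDoublings (V := V) (M := M) (d := d) (ls := ls)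
    (ps := []) (by omega) M.size 0 { s with pow := doublings d 1 ++ [] } hlo rfl
    ((Nat.lt_size_self M).trans_le (by rw [zero_add]; exact Nat.le_mul_of_pos_right _ hd))
    (by omega)
  rw [pow_zero, one_mul] at hle
  have h2 : Run V Free growDoublings { s with pow := doublings d 1 } (8 * M.size + 5)
      { s with pow := doublings d (k + 1) } := by
    simpa only [List.append_nil, growDoublings] using hit.run (by decide) (by decide) (by decide)
        (by omega)
  have h3 := run_pushZero (V := V) .mul { s with pow := doublings d (k + 1) }
  have hk2 : 2 ^ (k + 1) * d = 2 ^ k * d + 2 ^ k * d := by ring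
  have hgreedy : ∃ x', x' ≤ M ∧ d ∣ x' ∧ M < x' + d ∧ Run V Free greedy
      { s with pow := doublings d (k + 1), mul := 0 :: s.mul } (12 * (k + 1) + 1)
      { s with pow := [], mul := x' :: s.mul } := by
    refine run_greedy (V := V) (M := M) (d := d) (ls := ls) (ms := s.mul) (by omega) (by omega)
      (k + 1) 0 { s with pow := doublings d (k + 1), mul := 0 :: s.mul } hlo rfl rfl
      (by omega) (by simp) (by omega) fun j hj => ?_
    have : 2 ^ j * d ≤ 2 ^ k * d :=
      Nat.mul_le_mul_right _ (Nat.pow_le_pow_right (by omega) (by omega))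
    omega
  obtain ⟨x, hx, hdx, hltx, h4⟩ := hgreedy
  have h5 := run_addTo (V := V) .mul .div (by decide) (by decide)
    (s := { s with pow := [], mul := x :: s.mul }) rfl hdiv (by omega) (by omega)
  obtain ⟨x2, hx2, hxdef, h6⟩ : ∃ x2, x2 ≤ M + 2 * d ∧ x2 =
      (if d < x + d then x + d else x + d + d) ∧
      Run V Free (ifLess .div .mul skip (addTo .mul .div))
        { s with pow := [], mul := (x + d) :: s.mul } 7
            { s with pow := [], mul := x2 :: s.mul } := by
    refine ⟨_, ?_, rfl, run_ifLess (n := 2) (x := d) (y := x + d) (l := ds) (m := s.mul) .div .mul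
      _ _ (by decide) (by decide) (by decide) hdiv rfl (by omega) (by omega) (by omega)
      (fun h => ?_) (fun h => ?_)⟩
    · split_ifs <;> omega
    · rw [if_pos h]; exact (run_skip _).mono (by omega)
    · rw [if_neg (by omega)]
      exact run_addTo (V := V) .mul .div (by decide) (by decide)
        (s := { s with pow := [], mul := (x + d) :: s.mul }) rfl hdiv (by omega) (by omega)
  have hx2M : M < x2 ∧ 2 * d ≤ x2 ∧ d ∣ x2 ∧ (x2 ≤ M + d ∨ x2 = 2 * d) := by
    rw [hxdef]
    rcases Nat.eq_zero_or_pos x with rfl | hpos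
    · rw [if_neg (by omega)]
      exact ⟨by omega, by omega, ⟨2, by ring⟩, by omega⟩
    · have := Nat.le_of_dvd hpos hdx
      rw [if_pos (by omega)]
      exact ⟨by omega, by omega, hdx.add (dvd_refl d), by omega⟩
  obtain ⟨L, x', hx', hL, hlen, hit2⟩ := iter_markStep (V := V) (N := N) (d := d) (hs := hs)
    (ms := s.mul) (ds := ds) hd hN (N + 1) x2 { s with pow := [], mul := x2 :: s.mul } hhi rfl hdiv
    (by omega) (by omega)
  have h7 := hit2.run (by decide) (by decide) (by decide) (by omega)
  have h8 := run_drop (V := V) .mul (s :=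
    { s with pow := [], key := L ++ s.key, rem := L ++ s.rem, mul := x' :: s.mul }) rfl hx'
  have h9 := run_drop (V := V) .div (s :=
      { s with pow := [], key := L ++ s.key, rem := L ++ s.rem })
    hdiv (by omega)
  refine ⟨L, ?_, ?_, ?_⟩
  · intro y
    rw [hL]
    constructor
    · rintro ⟨i, rfl, hy⟩
      exact ⟨hx2M.2.2.1.add (Dvd.intro_left _ rfl), by omega, hy, by omega⟩
    · rintro ⟨hdy, h1, h2, h3⟩
      -- A multiple of `d` above `M` and below `x2 ≤ M + d` would differ from `x2` by a positive
      -- multiple of `d` that is less than `d`.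
      have hle : x2 ≤ y := by
        rcases hx2M.2.2.2 with h | h
        · by_contra hlt
          have := Nat.le_of_dvd (by omega) ((Nat.dvd_sub hx2M.2.2.1 hdy))
          omega
        · omega
      obtain ⟨i, hi⟩ := Nat.dvd_sub hdy hx2M.2.2.1
      exact ⟨i, by rw [mul_comm] at hi; omega, h2⟩
  · rw [← Nat.add_div_right (N - M) (by omega), Nat.le_div_iff_mul_le (by omega)]
    omega
  · refine (h1.seq (h2.seq (h3.seq (h4.seq (h5.seq (h6.seq (h7.seq (h8.seq h9)))))))).congr
      (by omega) ?_
    simp only [St.set, ← hpow]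

end Marks

/-! ### Sieving -/

/-- The number of steps after which a stack with these numbers is still bounded. -/
def St.Fits (s : St) (V Z : ℕ) : Prop :=
  (∀ r, (s.get r).length ≤ Z ∧ ∀ x ∈ s.get r, x ≤ V) ∧ s.out.length ≤ Z ∧ ∀ x ∈ s.out, x ≤ V

theorem length_listWord_le {V Z : ℕ} {l : List ℕ} (hl : l.length ≤ Z) (hx : ∀ x ∈ l, x ≤ V) :
    (listWord l).length ≤ Z * (V.size + 1) := by
  refine le_trans ?_ (Nat.mul_le_mul_right _ hl)
  clear hl
  induction l with
  | nil => simp [listWord]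
  | cons x l ih =>
    have h1 := ih (fun y hy => hx y (by simp [hy]))
    have h2 := length_bits_le (hx x (by simp))
    rw [listWord_cons, List.length_append, List.length_map, List.length_cons, List.length_cons,
      add_mul]
    omega

theorem St.Fits.length_enc_le {s : St} {V Z : ℕ} (h : s.Fits V Z) (i : Tape) :
    (enc s i).length ≤ Z * (V.size + 1) := by
  cases i with
  | reg r => exact length_listWord_le (h.1 r).1 (h.1 r).2
  | aux => simp [enc]
  | carry => simp [enc]
  | out => simpa [enc] using length_listWord_le h.2.1 h.2.2

theorem St.Fits.set {s : St} {V Z : ℕ} (h : s.Fits V Z) (r : Reg) {l : List ℕ} (hl : l.length ≤ Z)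
    (hx : ∀ x ∈ l, x ≤ V) : (s.set r l).Fits V Z := by
  refine ⟨fun r' => ?_, by simpa only [St.out_set] using h.2⟩
  rw [St.get_set]
  split_ifs
  · exact ⟨hl, hx⟩
  · exact h.1 r'

section Sieve

variable {V Z S : ℕ}

/-- This is how space is bounded. A chunk of `O(Z)` operations starts from at most `Z` numbers per
stack and can raise a stack by no more than its own running time, which is again `O(Z * V.size)`. A
whole sieve has `O(Z * V.size)` operations, too many for this argument, so it is cut into chunks
between which `Fits` is established anew. -/
theorem Run.bounded_of_fits {p : Prog Tape} {s s' : St} {n : ℕ} (h : Run V Free p s n s')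
    (hs : s.Fits V Z) (hS : Z * (V.size + 1) + n * opCost V ≤ S) : Run V (Bounded S) p s n s' :=
  h.bounded fun i => (Nat.add_le_add_right (hs.length_enc_le i) _).trans hS

theorem St.Fits.bounded {s : St} (hs : s.Fits V Z) (hS : Z * (V.size + 1) ≤ S) :
    Bounded S (enc s) := fun i => (hs.length_enc_le i).trans hS

/-- Put the marked numbers on the key stacks. -/
def gather : Prog Tape := .loop (nonempty .div) marks

theorem run_gather {M N : ℕ} {ls hs : List ℕ} (hM : 4 * M + 4 ≤ V) (hN : 4 * N + 4 ≤ V)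
    (ds : List ℕ)
    (hS : Z * (V.size + 1) + (20 * V.size + 9 * Z + 50) * opCost V ≤ S) :
    ∀ s : St, s.lo = M :: ls → s.hi = N :: hs → s.div = ds → s.pow = [] →
      (∀ d ∈ ds, 1 ≤ d ∧ 4 * d + 4 ≤ V) → s.Fits V Z →
      s.key.length + (ds.map fun d => (N - M) / d + 1).sum ≤ Z →
      s.rem.length + (ds.map fun d => (N - M) / d + 1).sum ≤ Z →
      ∃ L : List ℕ, (∀ y, y ∈ L ↔ ∃ d ∈ ds, d ∣ y ∧ M < y ∧ y ≤ N ∧ 2 * d ≤ y) ∧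
        L.length ≤ (ds.map fun d => (N - M) / d + 1).sum ∧
        Run V (Bounded S) gather s ((20 * V.size + 51) * ds.length + 9 * L.length + 1)
          { s with div := [], key := L ++ s.key, rem := L ++ s.rem } := by
  induction ds with
  | nil =>
    intro s hlo hhi hdiv hpow hds hfit hk hr
    refine ⟨[], by simp, by simp, ?_⟩
    refine (Run.loop_false (hfit.bounded (le_trans (Nat.le_add_right _ _) hS))
      (nonempty_nil (i := .div) (s := s) hdiv)).congr (by simp) ?_
    cases s
    simp_all
  | cons d ds ih =>
    intro s hlo hhi hdiv hpow hds hfit hk hr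
    have hd := hds d (by simp)
    rw [List.map_cons, List.sum_cons] at hk hr
    obtain ⟨L1, hL1, hlen1, h1⟩ := run_marks (V := V) (M := M) (N := N) (ls := ls) (hs := hs)
      (ds := ds) hd.1 hM hd.2 (by omega) hlo hhi hdiv hpow
    have hb := h1.bounded_of_fits (S := S) hfit (le_trans (Nat.add_le_add_left
      (Nat.mul_le_mul_right _ (by omega)) _) hS)
    have hL1V : ∀ y ∈ L1, y ≤ V := fun y hy => by have := (hL1 y).1 hy; omega
    have hfit2 : St.Fits { s with div := ds, key := L1 ++ s.key, rem := L1 ++ s.rem } V Z := by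
      have hdl := hfit.1 .div
      rw [show s.get .div = d :: ds from hdiv] at hdl
      refine ((hfit.set .div (l := ds) ?_ fun x hx => hdl.2 x (by simp [hx])).set .key
        (l := L1 ++ s.key) ?_ ?_).set .rem (l := L1 ++ s.rem) ?_ ?_
      · have := hdl.1; simp at this; omega
      · simp; omega
      · intro x hx
        rcases List.mem_append.1 hx with h | h
        · exact hL1V x h
        · exact (hfit.1 .key).2 x h
      · simp; omega
      · intro x hx
        rcases List.mem_append.1 hx with h | h
        · exact hL1V x h
        · exact (hfit.1 .rem).2 x h
    obtain ⟨L, hL, hlen, hrun⟩ := ih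
      { s with div := ds, key := L1 ++ s.key, rem := L1 ++ s.rem } hlo hhi rfl hpow
      (fun d hd => hds d (by simp [hd])) hfit2
      (by simp only [List.length_append]; omega) (by simp only [List.length_append]; omega)
    refine ⟨L ++ L1, ?_, by
      rw [List.length_append, List.map_cons, List.sum_cons]; omega, ?_⟩
    · intro y
      rw [List.mem_append, hL, hL1, List.exists_mem_cons_iff, or_comm]
    · simp only [List.append_assoc]
      refine (Run.loop_true (nonempty_cons (i := .div) (s := s) hdiv) hb hrun).mono ?_
      simp only [List.length_append, List.length_cons]
      linarith

/-- Distribute the keys according to the parity of their remainders. -/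
def distribute : Prog Tape :=
  .loop (nonempty .key) (.ite (isOdd .rem)
    (.seq (half .rem) (.seq (move .key .key1) (move .rem .rem1)))
    (.seq (half .rem) (.seq (move .key .key0) (move .rem .rem0))))

/-- The value `f x` on `rem` is the key without the binary digits already treated, so its parity is
the digit of the current pass. Both classes come out reversed; pouring them back in `radixPass`
restores their order, which makes the sort stable. -/
theorem run_distribute (f : ℕ → ℕ) (l : List ℕ) (hf : ∀ x, f x ≤ x) :
    ∀ s : St, s.key = l → s.rem = l.map f → (∀ x ∈ l, x ≤ V) →
      Run V Free distribute s (5 * l.length + 1)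
        { s with
          key := []
          rem := []
          key0 := (l.filter fun x => f x % 2 = 0).reverse ++ s.key0
          rem0 := ((l.filter fun x => f x % 2 = 0).map fun x => f x / 2).reverse ++ s.rem0
          key1 := (l.filter fun x => f x % 2 = 1).reverse ++ s.key1
          rem1 := ((l.filter fun x => f x % 2 = 1).map fun x => f x / 2).reverse ++ s.rem1 } := by
  induction l with
  | nil =>
    intro s hkey hrem _
    refine (Run.loop_false (ok := Free) trivial
      (nonempty_nil (i := .key) (s := s) hkey)).congr (by simp) ?_
    cases s
    simp_all
  | cons x l ih =>
    intro s hkey hrem hl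
    have hx := hl x (by simp)
    have hfx := hf x
    have h1 := run_half (V := V) .rem (s := s) hrem
    rcases Nat.mod_two_eq_zero_or_one (f x) with h0 | h0
    · have h2 := run_move (V := V) .key .key0 (by decide)
        (s := { s with rem := f x / 2 :: l.map f }) hkey hx
      have h3 := run_move (V := V) .rem .rem0 (by decide)
        (s := { s with rem := f x / 2 :: l.map f, key := l, key0 := x :: s.key0 }) rfl (by omega)
      have h4 := ih
        { s with rem := l.map f, key := l, key0 := x :: s.key0, rem0 := f x / 2 :: s.rem0 }
        rfl rfl (fun y hy => hl y (by simp [hy]))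
      refine (Run.loop_true (nonempty_cons (i := .key) (s := s) hkey) (Run.ite_false ?_
        (h1.seq (h2.seq h3))) h4).congr (by simp; omega) ?_
      · rw [isOdd_eq (i := .rem) (s := s) hrem]; simp [h0]
      · simp [h0]
    · have h2 := run_move (V := V) .key .key1 (by decide)
        (s := { s with rem := f x / 2 :: l.map f }) hkey hx
      have h3 := run_move (V := V) .rem .rem1 (by decide)
        (s := { s with rem := f x / 2 :: l.map f, key := l, key1 := x :: s.key1 }) rfl (by omega)
      have h4 := ih
        { s with rem := l.map f, key := l, key1 := x :: s.key1, rem1 := f x / 2 :: s.rem1 }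
        rfl rfl (fun y hy => hl y (by simp [hy]))
      refine (Run.loop_true (nonempty_cons (i := .key) (s := s) hkey) (Run.ite_true ?_
        (h1.seq (h2.seq h3))) h4).congr (by simp; omega) ?_
      · rw [isOdd_eq (i := .rem) (s := s) hrem]; simp [h0]
      · simp [h0]

end Sieve

/-! ### Radix sort -/

section RadixSort

variable {V Z S : ℕ}

/-- Stable partition into the elements with even and odd values of `f`. -/
def parityParts (f : ℕ → ℕ) (l : List ℕ) : List ℕ :=
  l.filter (fun x => f x % 2 = 0) ++ l.filter fun x => f x % 2 = 1

theorem parityParts_perm (f : ℕ → ℕ) (l : List ℕ) : (parityParts f l).Perm l := by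
  unfold parityParts
  have h : (l.filter fun x => decide (f x % 2 = 1)) = l.filter fun x => ! decide (f x % 2 = 0) :=
    List.filter_congr fun x _ => by
      rcases Nat.mod_two_eq_zero_or_one (f x) with h | h <;> simp [h]
  rw [h]
  exact List.filter_append_perm _ l

/-- The inductive step of radix sort: `a % 2 ^ (j + 1)` is determined by digit `j` first and by `a %
2 ^ j` second. The partition orders by the former and, being stable, keeps the order by the latter.
-/
theorem pairwise_parityParts (j : ℕ) {l : List ℕ}
    (h : l.Pairwise fun a b => a % 2 ^ j ≤ b % 2 ^ j) :
    (parityParts (· / 2 ^ j) l).Pairwise fun a b => a % 2 ^ (j + 1) ≤ b % 2 ^ (j + 1) := by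
  unfold parityParts
  rw [List.pairwise_append]
  refine ⟨?_, ?_, ?_⟩
  · refine (h.filter _).imp_of_mem fun {a b} ha hb hab => ?_
    simp only [List.mem_filter, decide_eq_true_eq] at ha hb
    rw [Nat.mod_pow_succ, Nat.mod_pow_succ, ha.2, hb.2]
    omega
  · refine (h.filter _).imp_of_mem fun {a b} ha hb hab => ?_
    simp only [List.mem_filter, decide_eq_true_eq] at ha hb
    rw [Nat.mod_pow_succ, Nat.mod_pow_succ, ha.2, hb.2]
    omega
  · intro a ha b hb
    simp only [List.mem_filter, decide_eq_true_eq] at ha hb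
    rw [Nat.mod_pow_succ, Nat.mod_pow_succ, ha.2, hb.2]
    have := Nat.mod_lt a (Nat.two_pow_pos j)
    omega

/-- One pass of the radix sort. -/
def radixPass : Prog Tape :=
  .seq distribute (.seq (pour .key1 .key) (.seq (pour .rem1 .rem) (.seq (pour .key0 .key)
    (pour .rem0 .rem))))

theorem run_radixPass (f : ℕ → ℕ) (hf : ∀ x, f x ≤ x) (l : List ℕ) {s : St} (hkey : s.key = l)
    (hrem : s.rem = l.map f) (hl : ∀ x ∈ l, x ≤ V) (h0 : s.key0 = []) (h0' : s.rem0 = [])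
    (h1 : s.key1 = []) (h1' : s.rem1 = []) :
    Run V Free radixPass s (9 * l.length + 5)
      { s with key := parityParts f l, rem := (parityParts f l).map fun x => f x / 2 } := by
  set a0 := l.filter fun x => f x % 2 = 0 with ha0
  set a1 := l.filter fun x => f x % 2 = 1 with ha1
  have hlen : a0.length + a1.length = l.length := by
    rw [← (parityParts_perm f l).length_eq, parityParts, List.length_append]
  have hm0 : ∀ x ∈ a0, x ≤ V := fun x hx => hl x (List.mem_filter.1 hx).1
  have hm1 : ∀ x ∈ a1, x ≤ V := fun x hx => hl x (List.mem_filter.1 hx).1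
  have hm0' : ∀ x ∈ a0.map fun x => f x / 2, x ≤ V := by
    simp only [List.mem_map]
    rintro _ ⟨x, hx, rfl⟩
    exact (Nat.div_le_self _ _).trans ((hf x).trans (hm0 x hx))
  have hm1' : ∀ x ∈ a1.map fun x => f x / 2, x ≤ V := by
    simp only [List.mem_map]
    rintro _ ⟨x, hx, rfl⟩
    exact (Nat.div_le_self _ _).trans ((hf x).trans (hm1 x hx))
  have r1 : Run V Free distribute s (5 * l.length + 1)
      { s with
        key := []
        rem := []
        key0 := a0.reverse
        rem0 := (a0.map fun x => f x / 2).reverse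
        key1 := a1.reverse
        rem1 := (a1.map fun x => f x / 2).reverse } := by
    refine (run_distribute (V := V) f l hf s hkey hrem hl).congr le_rfl ?_
    rw [h0, h0', h1, h1']
    simp only [List.append_nil, ha0, ha1]
  have r2 : Run V Free (pour .key1 .key) _ _
      { s with
        key := a1
        rem := []
        key0 := a0.reverse
        rem0 := (a0.map fun x => f x / 2).reverse
        rem1 := (a1.map fun x => f x / 2).reverse } :=
    (run_pour (V := V) .key1 .key (by decide) a1.reverse (s := { s with
        key := []
        rem := []
        key0 := a0.reverse
        rem0 := (a0.map fun x => f x / 2).reverse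
        key1 := a1.reverse
        rem1 := (a1.map fun x => f x / 2).reverse }) rfl (by simpa using hm1)).congr le_rfl
      (by simp [St.set, St.get, h1])
  have r3 : Run V Free (pour .rem1 .rem) _ _
      { s with
        key := a1
        rem := a1.map fun x => f x / 2
        key0 := a0.reverse
        rem0 := (a0.map fun x => f x / 2).reverse } :=
    (run_pour (V := V) .rem1 .rem (by decide) (a1.map fun x => f x / 2).reverse (s := { s with
        key := a1
        rem := []
        key0 := a0.reverse
        rem0 := (a0.map fun x => f x / 2).reverse
        rem1 := (a1.map fun x => f x / 2).reverse }) rfl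
      (fun x hx => hm1' x (List.mem_reverse.1 hx))).congr le_rfl
      (by simp [St.set, St.get, h1'])
  have r4 : Run V Free (pour .key0 .key) _ _
      { s with
        key := a0 ++ a1
        rem := a1.map fun x => f x / 2
        rem0 := (a0.map fun x => f x / 2).reverse } :=
    (run_pour (V := V) .key0 .key (by decide) a0.reverse (s := { s with
        key := a1
        rem := a1.map fun x => f x / 2
        key0 := a0.reverse
        rem0 := (a0.map fun x => f x / 2).reverse }) rfl (by simpa using hm0)).congr le_rfl
      (by simp [St.set, St.get, h0])
  have r5 : Run V Free (pour .rem0 .rem) _ _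
      { s with
        key := a0 ++ a1
        rem := (a0 ++ a1).map fun x => f x / 2 } :=
    (run_pour (V := V) .rem0 .rem (by decide) (a0.map fun x => f x / 2).reverse (s := { s with
        key := a0 ++ a1
        rem := a1.map fun x => f x / 2
        rem0 := (a0.map fun x => f x / 2).reverse }) rfl
      (fun x hx => hm0' x (List.mem_reverse.1 hx))).congr le_rfl
      (by simp [St.set, St.get, h0'])
  refine (r1.seq (r2.seq (r3.seq (r4.seq r5)))).congr ?_ rfl
  simp only [List.length_reverse, List.length_map]
  omega

/-- As many passes as the top of `cnt` has binary digits. -/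
def radixLoop : Prog Tape := .loop (fun v => !isZero .cnt v) (.seq (half .cnt) radixPass)

/-- Each pass consumes one binary digit of the counter and one of every key, hence the induction
along the digits of `c`. A pass permutes the keys and only shortens the remainders, so `Fits`
persists and each pass is a chunk of its own. -/
theorem run_radixLoop (hS : Z * (V.size + 1) + (9 * Z + 6) * opCost V ≤ S) (cs : List ℕ) (c : ℕ) :
    ∀ (j : ℕ) (l : List ℕ) (s : St), s.cnt = c :: cs → s.key = l → s.rem = l.map (· / 2 ^ j) →
      s.key0 = [] → s.rem0 = [] → s.key1 = [] → s.rem1 = [] →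
      (l.Pairwise fun a b => a % 2 ^ j ≤ b % 2 ^ j) → s.Fits V Z →
      ∃ l' : List ℕ, l'.Perm l ∧
        (l'.Pairwise fun a b => a % 2 ^ (j + c.size) ≤ b % 2 ^ (j + c.size)) ∧
        Run V (Bounded S) radixLoop s ((9 * l.length + 7) * c.size + 1)
          { s with cnt := 0 :: cs, key := l', rem := l'.map (· / 2 ^ (j + c.size)) } := by
  induction c using Nat.binaryRec' with
  | zero =>
    intro j l s hcnt hkey hrem h0 h0' h1 h1' hsort hfit
    refine ⟨l, .refl _, by simpa using hsort, ?_⟩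
    refine (Run.loop_false (hfit.bounded (le_trans (Nat.le_add_right _ _) hS)) ?_).congr
      (by simp) ?_
    · rw [isZero_eq (i := .cnt) (s := s) hcnt]; rfl
    · cases s
      simp_all
  | bit b c hb ih =>
    intro j l s hcnt hkey hrem h0 h0' h1 h1' hsort hfit
    have hne : Nat.bit b c ≠ 0 := by
      cases b
      · intro h'; exact absurd (hb (by simpa [Nat.bit] using h')) (by simp)
      · simp [Nat.bit]
    have hhalf : Nat.bit b c / 2 = c := by cases b <;> simp [Nat.bit]; omega
    have hkl := hfit.1 .key
    rw [show s.get .key = l from hkey] at hkl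
    have hcl := hfit.1 .cnt
    rw [show s.get .cnt = Nat.bit b c :: cs from hcnt] at hcl
    have r1 := run_half (V := V) .cnt (s := s) hcnt
    rw [hhalf] at r1
    have r2 := run_radixPass (V := V) (· / 2 ^ j) (fun x => Nat.div_le_self _ _) l
      (s := { s with cnt := c :: cs }) hkey hrem hkl.2 h0 h0' h1 h1'
    have hperm := parityParts_perm (· / 2 ^ j) l
    have hl' : ∀ x ∈ parityParts (· / 2 ^ j) l, x ≤ V := fun x hx =>
      hkl.2 x (hperm.mem_iff.1 hx)
    have hdiv : ((parityParts (· / 2 ^ j) l).map fun x => x / 2 ^ j / 2) =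
        (parityParts (· / 2 ^ j) l).map (· / 2 ^ (j + 1)) := by
      refine List.map_congr_left fun x _ => ?_
      rw [Nat.div_div_eq_div_mul, pow_succ]
    obtain ⟨l', hp, hs', hrun⟩ := ih (j + 1) (parityParts (· / 2 ^ j) l)
      { s with
        cnt := c :: cs
        key := parityParts (· / 2 ^ j) l
        rem := (parityParts (· / 2 ^ j) l).map fun x => x / 2 ^ j / 2 } rfl rfl hdiv h0 h0' h1 h1'
      (pairwise_parityParts j hsort) (by
        refine ((hfit.set .cnt (l := c :: cs) hcl.1 ?_).set .key (l := parityParts (· / 2 ^ j) l)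
          (by rw [hperm.length_eq]; exact hkl.1) hl').set .rem ?_ ?_
        · intro x hx
          rcases List.mem_cons.1 hx with rfl | hx
          · rw [← hhalf]; exact (Nat.div_le_self _ _).trans (hcl.2 _ (by simp))
          · exact hcl.2 x (by simp [hx])
        · rw [List.length_map, hperm.length_eq]; exact hkl.1
        · simp only [List.mem_map]
          rintro _ ⟨x, hx, rfl⟩
          exact (Nat.div_le_self _ _).trans ((Nat.div_le_self _ _).trans (hl' x hx)))
    have hsz : j + (Nat.bit b c).size = j + 1 + c.size := by rw [Nat.size_bit hne]; omega
    refine ⟨l', hp.trans hperm, by rw [hsz]; exact hs', ?_⟩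
    rw [hsz]
    refine (Run.loop_true ?_ ((r1.seq r2).bounded_of_fits (S := S) hfit
      (le_trans (Nat.add_le_add_left (Nat.mul_le_mul_right _ ?_) _) hS)) hrun).mono ?_
    · rw [isZero_eq (i := .cnt) (s := s) hcnt, decide_eq_false hne]; rfl
    · have := hkl.1; omega
    · rw [Nat.size_bit hne, hperm.length_eq, Nat.succ_eq_add_one]
      linarith

/-! ### The unmarked numbers -/

/-- The numbers from `n` on that are missing in an increasing list, up to its last element. -/
def gaps : ℕ → List ℕ → List ℕ
  | _, [] => []
  | n, m :: l => List.range' n (m - n) ++ gaps (m + 1) l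

/-- A number is marked once for each of its divisors, so entries may repeat. After `m` the scan
continues from `m + 1`, and the next entry may be `m` again; hence the condition `n ≤ x + 1`, and
the truncated `m - n` makes such a gap empty. -/
theorem mem_gaps {n : ℕ} {l : List ℕ} (hl : l.Pairwise (· ≤ ·)) (hn : ∀ x ∈ l, n ≤ x + 1) (y : ℕ) :
    y ∈ gaps n l ↔ n ≤ y ∧ y ∉ l ∧ ∃ m ∈ l, y < m := by
  induction l generalizing n with
  | nil => simp [gaps]
  | cons m l ih =>
    rw [List.pairwise_cons] at hl
    have hm := hn m (by simp)
    rw [gaps, List.mem_append, ih hl.2 (fun x hx => by have := hl.1 x hx; omega),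
      List.mem_range'_1, List.exists_mem_cons_iff, List.mem_cons, not_or]
    constructor
    · rintro (⟨h1, h2⟩ | ⟨h1, h2, h3⟩)
      · exact ⟨h1, ⟨by omega, fun h => by have := hl.1 y h; omega⟩, Or.inl (by omega)⟩
      · exact ⟨by omega, ⟨by omega, h2⟩, Or.inr h3⟩
    · rintro ⟨h1, ⟨h2, h3⟩, h4⟩
      rcases Nat.lt_or_ge y m with h | h
      · exact Or.inl ⟨h1, by omega⟩
      · exact Or.inr ⟨by omega, h3, h4.resolve_left (by omega)⟩

theorem pairwise_gaps {n : ℕ} {l : List ℕ} (hl : l.Pairwise (· ≤ ·)) (hn : ∀ x ∈ l, n ≤ x + 1) :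
    (gaps n l).Pairwise (· < ·) := by
  induction l generalizing n with
  | nil => simp [gaps]
  | cons m l ih =>
    rw [List.pairwise_cons] at hl
    have hm := hn m (by simp)
    have hn' : ∀ x ∈ l, m + 1 ≤ x + 1 := fun x hx => by have := hl.1 x hx; omega
    rw [gaps, List.pairwise_append]
    refine ⟨List.pairwise_lt_range', ih hl.2 hn', ?_⟩
    intro a ha b hb
    rw [List.mem_range'_1] at ha
    rw [mem_gaps hl.2 hn'] at hb
    omega

/-- Put the top of `num` on `div`, and increase it by one. -/
def emitStep : Prog Tape := .seq (copy .num .div) (inc .num)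

theorem iter_emitStep {m : ℕ} {ks ns : List ℕ} (hV : m + 1 ≤ V) (f : ℕ) :
    ∀ (n : ℕ) (s : St), s.key = m :: ks → s.num = n :: ns → m - n = f → n ≤ V →
      Iter V true .num .key emitStep s (8 * f)
        { s with num := (n + f) :: ns, div := (List.range' n f).reverse ++ s.div } := by
  induction f with
  | zero =>
    intro n s hkey hnum hf hn
    rw [Nat.add_zero, ← hnum]
    exact .final (i := .num) (j := .key) (s := s) hnum hkey hn (by omega) (by simp; omega)
  | succ f ih =>
    intro n s hkey hnum hf hn
    have h1 := run_copy (V := V) .num .div (by decide) (s := s) hnum hn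
    have h2 := run_inc (V := V) .num (by decide) (s := { s with div := n :: s.div }) hnum hn
      (by omega)
    have h3 := ih (n + 1) { s with div := n :: s.div, num := (n + 1) :: ns } hkey rfl (by omega)
      (by omega)
    have h4 := Iter.step (i := .num) (j := .key) (s := s) (b := true) (p := emitStep) hnum hkey hn
      (by omega) (by simp; omega) (h1.seq h2) h3
    rw [List.range'_succ, List.reverse_cons, List.append_assoc, List.singleton_append,
      show n + (f + 1) = n + 1 + f by ring]
    exact h4.mono (by omega)

/-- Put the numbers that are missing on `key` on `div`. -/
def scan : Prog Tape :=
  .loop (nonempty .key) (.seq (whileLess true .num .key emitStep) (.seq (drop .num)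
    (.seq (move .key .num) (inc .num))))

theorem run_scan {ns : List ℕ} (l : List ℕ) :
    ∀ (n : ℕ) (s : St), s.key = l → s.num = n :: ns → n ≤ V → (∀ x ∈ l, x + 1 ≤ V) →
      ∃ n' ≤ V, Run V Free scan s (8 * (gaps n l).length + 10 * l.length + 1)
        { s with key := [], num := n' :: ns, div := (gaps n l).reverse ++ s.div } := by
  induction l with
  | nil =>
    intro n s hkey hnum hn _
    refine ⟨n, hn, (Run.loop_false (ok := Free) trivial
      (nonempty_nil (i := .key) (s := s) hkey)).congr (by simp) ?_⟩
    cases s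
    simp_all [gaps]
  | cons m l ih =>
    intro n s hkey hnum hn hl
    have hm := hl m (by simp)
    have h1 := (iter_emitStep (V := V) hm (m - n) n s hkey hnum rfl hn).run (by decide) (by decide)
      (by decide) (by omega)
    have h2 := run_drop (V := V) .num
      (s := { s with num := (n + (m - n)) :: ns, div := (List.range' n (m - n)).reverse ++ s.div })
      rfl (by omega)
    have h3 := run_move (V := V) .key .num (by decide)
      (s := { s with num := ns, div := (List.range' n (m - n)).reverse ++ s.div }) hkey (by omega)
    have h4 := run_inc (V := V) .num (by decide)
      (s := { s with num := m :: ns, key := l, div := (List.range' n (m - n)).reverse ++ s.div })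
      rfl (by omega) (by omega)
    obtain ⟨n', hn', h5⟩ := ih (m + 1)
      { s with num := (m + 1) :: ns, key := l, div := (List.range' n (m - n)).reverse ++ s.div }
      rfl rfl hm (fun x hx => hl x (by simp [hx]))
    refine ⟨n', hn', ?_⟩
    rw [gaps, List.reverse_append, List.append_assoc]
    refine (Run.loop_true (nonempty_cons (i := .key) (s := s) hkey)
      (h1.seq (h2.seq (h3.seq h4))) h5).mono ?_
    simp only [List.length_append, List.length_range', List.length_cons]
    omega

end RadixSort

/-- The numbers `M < n ≤ N` that are not proper multiples of elements of `ds`. -/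
def sieved (M N : ℕ) (ds : List ℕ) : List ℕ :=
  (List.range (N + 1)).filter fun n => M < n ∧ ∀ d ∈ ds, ¬(d ∣ n ∧ 2 * d ≤ n)

theorem eq_of_pairwise_lt {l l' : List ℕ} (h : l.Pairwise (· < ·)) (h' : l'.Pairwise (· < ·))
    (hmem : ∀ x, x ∈ l ↔ x ∈ l') : l = l' :=
  ((List.perm_ext_iff_of_nodup (h.imp fun h => h.ne) (h'.imp fun h => h.ne)).2
    hmem).eq_of_pairwise (fun _ _ _ _ h1 h2 => absurd h1 h2.not_gt) h h'

theorem mem_sieved {M N : ℕ} {ds : List ℕ} {n : ℕ} :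
    n ∈ sieved M N ds ↔ M < n ∧ n ≤ N ∧ ∀ d ∈ ds, ¬(d ∣ n ∧ 2 * d ≤ n) := by
  simp only [sieved, List.mem_filter, List.mem_range, decide_eq_true_eq]
  constructor
  · rintro ⟨h1, h2, h3⟩; exact ⟨h2, by omega, h3⟩
  · rintro ⟨h1, h2, h3⟩; exact ⟨by omega, h1, h3⟩

/-- The sentinel `N + 1` is sorted to the end and makes the gaps extend up to `N`. The hypothesis is
`M ≤ N + 1` because the last sieve starts from `max M 1`, which exceeds `N` if `N = 0`. -/
theorem gaps_eq_sieved {M N : ℕ} (hMN : M ≤ N + 1) {ds L l : List ℕ}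
    (hL : ∀ y, y ∈ L ↔ ∃ d ∈ ds, d ∣ y ∧ M < y ∧ y ≤ N ∧ 2 * d ≤ y) (hp : l.Perm (L ++ [N + 1]))
    (hl : l.Pairwise (· ≤ ·)) : gaps (M + 1) l = sieved M N ds := by
  have hmem : ∀ x, x ∈ l ↔ x ∈ L ∨ x = N + 1 := fun x => by rw [hp.mem_iff]; simp
  have hn : ∀ x ∈ l, M + 1 ≤ x + 1 := by
    intro x hx
    rcases (hmem x).1 hx with h | rfl
    · obtain ⟨d, _, _, h, _⟩ := (hL x).1 h; omega
    · omega
  refine eq_of_pairwise_lt (pairwise_gaps hl hn)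
    (List.Pairwise.filter _ List.pairwise_lt_range) fun x => ?_
  rw [mem_gaps hl hn, mem_sieved, hmem, hL, not_or]
  constructor
  · rintro ⟨h1, ⟨h2, h3⟩, m, hm, h4⟩
    have hxN : x ≤ N := by
      rcases (hmem m).1 hm with h | rfl
      · obtain ⟨d, _, _, _, h, _⟩ := (hL m).1 h; omega
      · omega
    exact ⟨h1, hxN, fun d hd h => h2 ⟨d, hd, h.1, h1, hxN, h.2⟩⟩
  · rintro ⟨h1, h2, h3⟩
    exact ⟨h1, ⟨fun ⟨d, hd, h⟩ => h3 d hd ⟨h.1, h.2.2.2⟩, by omega⟩, N + 1,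
      (hmem _).2 (Or.inr rfl), by omega⟩

theorem length_sieved_le (M N : ℕ) (ds : List ℕ) : (sieved M N ds).length ≤ N - M := by
  have hsub : sieved M N ds ⊆ List.range' (M + 1) (N - M) := by
    intro x hx
    rw [mem_sieved] at hx
    rw [List.mem_range'_1]
    omega
  have hnd : (sieved M N ds).Nodup := List.Nodup.filter _ List.nodup_range
  simpa using (hnd.subperm hsub).length_le

/-- The number of multiples that are marked. -/
def markCount (M N : ℕ) (ds : List ℕ) : ℕ := (ds.map fun d => (N - M) / d + 1).sum

theorem length_le_markCount (M N : ℕ) (ds : List ℕ) : ds.length ≤ markCount M N ds := by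
  induction ds with
  | nil => simp
  | cons d ds ih =>
    have := Nat.zero_le ((N - M) / d)
    simp only [markCount, List.map_cons, List.sum_cons, List.length_cons] at *
    omega

/-- Replace the divisors on `div` by the numbers between the tops of `lo` and `hi` that are not
proper multiples of them. -/
def sieve : Prog Tape :=
  .seq (.seq (copy .hi .key) (.seq (inc .key) (copy .key .rem))) (.seq gather (.seq
    (.seq (copy .hi .cnt) (inc .cnt)) (.seq radixLoop
    (.seq (drop .cnt) (.seq (clear .rem) (.seq (copy .lo .num) (.seq (inc .num) (.seq scan
      (drop .num)))))))))

/-! ### Correctness and cost of one sieve -/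

section Sieve

variable {V Z S : ℕ}

/-- The stacks that a sieve uses are empty. -/
structure St.Clean (s : St) : Prop where
  pow : s.pow = []
  num : s.num = []
  key : s.key = []
  rem : s.rem = []
  key0 : s.key0 = []
  rem0 : s.rem0 = []
  key1 : s.key1 = []
  rem1 : s.rem1 = []
  cnt : s.cnt = []

/-- With at most `Z` marks, gathering and sorting take `O(Z * V.size)` operations and everything
else `O(Z)`. The bound `S` leaves room for chunks of `100 * Z` operations. -/
theorem run_sieve {M N : ℕ} {ls hs : List ℕ} (hM : 4 * M + 4 ≤ V) (hN : 4 * N + 4 ≤ V)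
    (hMN : M ≤ N + 1) (hZ : V.size + 2 ≤ Z) (hNM : N - M ≤ Z)
    (hS : Z * (V.size + 1) + 100 * Z * opCost V ≤ S) {s : St} (hc : s.Clean) (hlo : s.lo = M :: ls)
    (hhi : s.hi = N :: hs) (hds : ∀ d ∈ s.div, 1 ≤ d ∧ 4 * d + 4 ≤ V)
    (hcount : markCount M N s.div + 1 ≤ Z) (hfit : s.Fits V Z) :
    Run V (Bounded S) sieve s (200 * Z * (V.size + 1))
      { s with div := (sieved M N s.div).reverse } := by
  have hNs : (N + 1).size ≤ V.size := Nat.size_le_size (by omega)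
  have hchunk : ∀ n, n ≤ 100 * Z → Z * (V.size + 1) + n * opCost V ≤ S := fun n hn =>
    le_trans (Nat.add_le_add_left (Nat.mul_le_mul_right _ hn) _) hS
  -- the sentinel
  have a1 := run_copy (V := V) .hi .key (by decide) (s := s) hhi (by omega)
  have a2 := run_inc (V := V) .key (by decide) (s := { s with key := N :: s.key }) rfl (by omega)
    (by omega)
  have a3 := run_copy (V := V) .key .rem (by decide) (s := { s with key := (N + 1) :: s.key }) rfl
    (by omega)
  have A : Run V (Bounded S) _ s 4 { s with key := [N + 1], rem := [N + 1] } :=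
    ((a1.seq (a2.seq a3)).bounded_of_fits hfit (hchunk _ (by omega))).congr (by omega)
      (by simp [St.set, St.get, hc.key, hc.rem])
  have hfitA : St.Fits { s with key := [N + 1], rem := [N + 1] } V Z :=
    (hfit.set .key (l := [N + 1]) (by simp; omega) (by simp; omega)).set .rem (l := [N + 1])
      (by simp; omega) (by simp; omega)
  -- the multiples
  obtain ⟨L, hL, hlen, G⟩ := run_gather (V := V) (Z := Z) (S := S) (M := M) (N := N) (ls := ls)
    (hs := hs) hM hN s.div (hchunk _ (by omega)) { s with key := [N + 1], rem := [N + 1] } hlo hhi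
    rfl hc.pow hds hfitA (by simp only [List.length_singleton]; unfold markCount at hcount; omega)
    (by simp only [List.length_singleton]; unfold markCount at hcount; omega)
  have hlenZ : L.length + 1 ≤ Z := by unfold markCount at hcount; omega
  obtain ⟨l, hl⟩ : ∃ l, l = L ++ [N + 1] := ⟨_, rfl⟩
  have hllen : l.length ≤ Z := by rw [hl]; simpa using hlenZ
  have hlN : ∀ x ∈ l, x ≤ N + 1 := by
    intro x hx
    rw [hl, List.mem_append, List.mem_singleton] at hx
    rcases hx with h | rfl
    · obtain ⟨d, _, _, _, h, _⟩ := (hL x).1 h; omega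
    · omega
  have hlV : ∀ x ∈ l, x ≤ V := fun x hx => (hlN x hx).trans (by omega)
  rw [← hl] at G
  have hfitG : St.Fits { s with div := [], key := l, rem := l } V Z :=
    ((hfit.set .div (l := []) (by simp) (by simp)).set .key hllen hlV).set .rem hllen hlV
  -- sorting
  have b1 := run_copy (V := V) .hi .cnt (by decide) (s := { s with div := [], key := l, rem := l })
    hhi (by omega)
  have b2 := run_inc (V := V) .cnt (by decide)
    (s := { s with div := [], key := l, rem := l, cnt := N :: s.cnt }) rfl (by omega) (by omega)
  have B : Run V (Bounded S) _ _ 3 { s with div := [], key := l, rem := l, cnt := [N + 1] } :=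
    ((b1.seq b2).bounded_of_fits hfitG (hchunk _ (by omega))).congr (by omega)
      (by simp [St.set, hc.cnt])
  have hfitB : St.Fits { s with div := [], key := l, rem := l, cnt := [N + 1] } V Z :=
    hfitG.set .cnt (l := [N + 1]) (by simp; omega) (by simp; omega)
  obtain ⟨l', hp, hsort, R⟩ := run_radixLoop (V := V) (Z := Z) (S := S) (hchunk _ (by omega)) []
    (N + 1) 0 l { s with div := [], key := l, rem := l, cnt := [N + 1] } rfl rfl (by simp)
    hc.key0 hc.rem0 hc.key1 hc.rem1 (List.pairwise_of_forall (by simp [Nat.mod_one])) hfitB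
  rw [zero_add] at hsort R
  -- There are as many passes as `N + 1` has digits, so no key has a digit left: order modulo the
  -- power of two is the true order, and all remainders have become `0`.
  have hlt : ∀ x ∈ l', x < 2 ^ (N + 1).size := fun x hx =>
    lt_of_le_of_lt (hlN x (hp.mem_iff.1 hx)) (Nat.lt_size_self _)
  have hsort' : l'.Pairwise (· ≤ ·) := hsort.imp_of_mem fun {a b} ha hb h => by
    rwa [Nat.mod_eq_of_lt (hlt a ha), Nat.mod_eq_of_lt (hlt b hb)] at h
  have hmap : l'.map (· / 2 ^ (N + 1).size) = l'.map fun _ => 0 :=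
    List.map_congr_left fun x hx => Nat.div_eq_of_lt (hlt x hx)
  rw [hmap] at R
  have hl'len : l'.length ≤ Z := hp.length_eq.trans_le hllen
  have hl'V : ∀ x ∈ l', x ≤ V := fun x hx => hlV x (hp.mem_iff.1 hx)
  have hfitR : St.Fits { s with div := [], key := l', rem := l'.map fun _ => 0, cnt := [0] } V Z :=
    (((hfit.set .div (l := []) (by simp) (by simp)).set .key hl'len hl'V).set .rem
      (l := l'.map fun _ => 0) (by simpa using hl'len) (by simp)).set .cnt (l := [0])
      (by simp; omega) (by simp)
  -- the unmarked numbers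
  have c1 := run_drop (V := V) .cnt (s := { s with
    div := [], key := l', rem := l'.map fun _ => 0, cnt := [0] }) rfl (by omega)
  have c2 := run_clear (V := V) .rem (l'.map fun _ => 0) (s := { s with
    div := [], key := l', rem := l'.map fun _ => 0, cnt := [] }) rfl (by simp)
  have c3 := run_copy (V := V) .lo .num (by decide) (s := { s with
    div := [], key := l', rem := [], cnt := [] }) hlo (by omega)
  have c4 := run_inc (V := V) .num (by decide) (s := { s with
    div := [], key := l', rem := [], cnt := [], num := M :: s.num }) rfl (by omega) (by omega)
  obtain ⟨n', hn', c5⟩ := run_scan (V := V) (ns := s.num) l' (M + 1) { s with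
    div := [], key := l', rem := [], cnt := [], num := (M + 1) :: s.num } rfl rfl (by omega)
    (fun x hx => by have := hlN x (hp.mem_iff.1 hx); omega)
  have hgaps : gaps (M + 1) l' = sieved M N s.div := gaps_eq_sieved hMN hL (hl ▸ hp) hsort'
  rw [hgaps] at c5
  have hslen := length_sieved_le M N s.div
  have c6 := run_drop (V := V) .num (s := { s with
    div := (sieved M N s.div).reverse ++ [], key := [], rem := [], cnt := [], num := n' :: s.num })
    rfl hn'
  have C := (c1.seq (c2.seq (c3.seq (c4.seq (c5.seq c6))))).bounded_of_fits (S := S) hfitR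
    (hchunk _ (by rw [List.length_map]; omega))
  have hdl := length_le_markCount M N s.div
  refine (A.seq (G.seq (B.seq (R.seq C)))).congr ?_ ?_
  · rw [List.length_map]
    have h1 : (20 * V.size + 51) * s.div.length ≤ (20 * V.size + 51) * Z :=
      Nat.mul_le_mul_left _ (by omega)
    have h2 : (9 * l.length + 7) * (N + 1).size ≤ (9 * Z + 7) * V.size :=
      Nat.mul_le_mul (by omega) hNs
    have h3 : 200 * Z * (V.size + 1) = 200 * (V.size * Z) + 200 * Z := by ring
    have h4 : (20 * V.size + 51) * Z = 20 * (V.size * Z) + 51 * Z := by ring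
    have h5 : (9 * Z + 7) * V.size = 9 * (V.size * Z) + 7 * V.size := by ring
    omega
  · simp [St.set, hc.key, hc.rem, hc.cnt]

end Sieve

/-! ### The whole program -/

/-- A power of two whose square is greater than `n` and at most `4 * n`. -/
def rootBound (n : ℕ) : ℕ := if n = 0 then 1 else 2 * rootBound (n / 4)
decreasing_by omega

theorem rootBound_zero : rootBound 0 = 1 := by rw [rootBound, if_pos rfl]

theorem rootBound_of_ne {n : ℕ} (h : n ≠ 0) : rootBound n = 2 * rootBound (n / 4) := by
  rw [rootBound, if_neg h]

theorem rootBound_pos (n : ℕ) : 0 < rootBound n := by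
  induction n using Nat.strong_induction_on with
  | _ n ih =>
    rcases eq_or_ne n 0 with rfl | h
    · simp [rootBound_zero]
    · rw [rootBound_of_ne h]
      have := ih (n / 4) (by omega)
      omega

theorem lt_rootBound_sq (n : ℕ) : n < rootBound n * rootBound n := by
  induction n using Nat.strong_induction_on with
  | _ n ih =>
    rcases eq_or_ne n 0 with rfl | h
    · simp [rootBound_zero]
    · rw [rootBound_of_ne h]
      have := ih (n / 4) (by omega)
      rw [show 2 * rootBound (n / 4) * (2 * rootBound (n / 4)) =
        4 * (rootBound (n / 4) * rootBound (n / 4)) by ring]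
      omega

theorem rootBound_sq_le {n : ℕ} (hn : n ≠ 0) : rootBound n * rootBound n ≤ 4 * n := by
  induction n using Nat.strong_induction_on with
  | _ n ih =>
    rw [rootBound_of_ne hn, show 2 * rootBound (n / 4) * (2 * rootBound (n / 4)) =
        4 * (rootBound (n / 4) * rootBound (n / 4)) by ring]
    rcases eq_or_ne (n / 4) 0 with h | h
    · rw [h, rootBound_zero]; omega
    · have := ih (n / 4) (by omega) h
      omega

theorem rootBound_le (n : ℕ) : rootBound n ≤ 2 * n + 1 := by
  rcases eq_or_ne n 0 with rfl | h
  · simp [rootBound_zero]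
  · have := rootBound_sq_le h
    nlinarith

/-- Multiply the top of `hi` by the root bound of the top of `cnt`. -/
def rootLoop : Prog Tape :=
  .loop (fun v => !isZero .cnt v) (.seq (half .cnt) (.seq (half .cnt) (addTo .hi .hi)))

/-- Put the root bound of the top of `hi` on `hi`. -/
def root : Prog Tape :=
  .seq (copy .hi .cnt) (.seq (pushOne .hi) (.seq rootLoop (drop .cnt)))

/-- Write all numbers of `num` on the output tape. -/
def writeAll : Prog Tape := .loop (nonempty .num) (emit .num)

/-- List the primes between the two numbers on `inp` on the output tape. -/
def listPrimes : Prog Tape :=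
  .seq (.seq (move .inp .lo) (.seq (move .inp .hi) (.seq (.ite (isZero .lo) (inc .lo) skip)
    (.seq root (.seq root (pushOne .lo)))))) (.seq sieve (.seq sieve (.seq (drop .hi) (.seq sieve
    (.seq (.seq (drop .hi) (drop .lo)) (.seq sieve (.seq (pour .div .num) writeAll)))))))

section Main

variable {V Z S : ℕ}

/-- Two halvings of the counter for one doubling of the product follow the recursion of `rootBound`.
-/
theorem run_rootLoop (cs hs : List ℕ) (c : ℕ) :
    ∀ (r : ℕ) (s : St), s.cnt = c :: cs → s.hi = r :: hs → r * rootBound c ≤ V →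
      Run V Free rootLoop s (5 * c.size + 1)
        { s with cnt := 0 :: cs, hi := (r * rootBound c) :: hs } := by
  induction c using Nat.strong_induction_on with
  | _ c ih =>
    intro r s hcnt hhi hr
    rcases eq_or_ne c 0 with rfl | hc
    · refine (Run.loop_false (ok := Free) trivial ?_).congr (by simp) ?_
      · rw [isZero_eq (i := .cnt) (s := s) hcnt]; rfl
      · rw [rootBound_zero, mul_one, ← hcnt, ← hhi]
    · rw [rootBound_of_ne hc] at hr ⊢
      have hpos := rootBound_pos (c / 4)
      have hrV : r * 1 ≤ r * rootBound (c / 4) := Nat.mul_le_mul_left _ hpos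
      have hr2 : r * (2 * rootBound (c / 4)) = (r + r) * rootBound (c / 4) := by ring
      have hr3 : (r + r) * rootBound (c / 4) =
        r * rootBound (c / 4) + r * rootBound (c / 4) := by ring
      have h1 := run_half (V := V) .cnt (s := s) hcnt
      have h2 := run_half (V := V) .cnt (s := { s with cnt := c / 2 :: cs }) rfl
      rw [Nat.div_div_eq_div_mul] at h2
      have h3 := run_addTo (V := V) .hi .hi (by decide) (by decide)
        (s := { s with cnt := c / (2 * 2) :: cs }) hhi hhi (by omega) (by omega)
      have h4 := ih (c / 4) (by omega) (r + r) { s with cnt := c / 4 :: cs, hi := (r + r) :: hs }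
        rfl rfl (by omega)
      have hsz : (c / 4).size + 1 ≤ c.size := by
        have hcs : 0 < c.size := Nat.size_pos.2 (by omega)
        have h := Nat.lt_size_self c
        rw [show c.size = c.size - 1 + 1 by omega, pow_succ] at h
        have : (c / 4).size ≤ c.size - 1 := Nat.size_le.2 (by omega)
        omega
      rw [hr2]
      refine (Run.loop_true ?_ (h1.seq (h2.seq h3)) h4).mono (by omega)
      rw [isZero_eq (i := .cnt) (s := s) hcnt, decide_eq_false hc]
      rfl

theorem run_root {n : ℕ} {hs : List ℕ} {s : St} (hhi : s.hi = n :: hs) (hn : n ≤ V)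
    (hr : rootBound n ≤ V) :
    Run V Free root s (5 * V.size + 4) { s with hi := rootBound n :: s.hi } := by
  have hsz := Nat.size_le_size hn
  have h1 := run_copy (V := V) .hi .cnt (by decide) (s := s) hhi hn
  have h2 := run_pushOne (V := V) .hi { s with cnt := n :: s.cnt }
  have h3 := run_rootLoop (V := V) s.cnt s.hi n 1 { s with cnt := n :: s.cnt, hi := 1 :: s.hi }
    rfl rfl (by omega)
  rw [one_mul] at h3
  have h4 := run_drop (V := V) .cnt (s := { s with cnt := 0 :: s.cnt, hi := rootBound n :: s.hi })
    rfl (by omega)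
  exact (h1.seq (h2.seq (h3.seq h4))).mono (by omega)

theorem run_writeAll (l : List ℕ) :
    ∀ s : St, s.num = l → (∀ x ∈ l, x ≤ V) →
      Run V Free writeAll s (2 * l.length + 1) { s with num := [], out := s.out ++ l } := by
  induction l with
  | nil =>
    intro s hnum _
    refine (Run.loop_false (ok := Free) trivial
      (nonempty_nil (i := .num) (s := s) hnum)).congr (by simp) ?_
    cases s
    simp_all
  | cons x l ih =>
    intro s hnum hl
    have h1 := run_emit (V := V) .num (s := s) hnum (hl x (by simp))
    have h2 := ih { s with num := l, out := s.out ++ [x] } rfl (fun y hy => hl y (by simp [hy]))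
    rw [List.append_assoc, List.singleton_append] at h2
    exact (Run.loop_true (nonempty_cons (i := .num) (s := s) hnum) h1 h2).mono (by simp; omega)

/-- The stacks with given contents of `inp`, `lo`, `hi` and `div`. -/
def St.of (inp lo hi div : List ℕ) : St :=
  ⟨inp, lo, hi, div, [], [], [], [], [], [], [], [], [], [], [], [], [], []⟩

theorem St.clean_of (inp lo hi div : List ℕ) : (St.of inp lo hi div).Clean :=
  ⟨rfl, rfl, rfl, rfl, rfl, rfl, rfl, rfl, rfl⟩

theorem St.fits_of {inp lo hi div : List ℕ} (h1 : inp.length ≤ Z ∧ ∀ x ∈ inp, x ≤ V)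
    (h2 : lo.length ≤ Z ∧ ∀ x ∈ lo, x ≤ V) (h3 : hi.length ≤ Z ∧ ∀ x ∈ hi, x ≤ V)
    (h4 : div.length ≤ Z ∧ ∀ x ∈ div, x ≤ V) : (St.of inp lo hi div).Fits V Z :=
  ⟨fun r => by cases r <;> first | assumption | exact ⟨Nat.zero_le _, by simp [St.of, St.get]⟩,
    Nat.zero_le _, by simp [St.of]⟩

theorem enc_of (l : List ℕ) :
    enc (St.of l [] [] []) = startStacks (.reg .inp) (listWord l) := by
  funext t
  cases t with
  | reg r => cases r <;> rfl
  | _ => rfl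

theorem run_sieve_of {M N : ℕ} {ls hs ds : List ℕ} (hM : 4 * M + 4 ≤ V) (hN : 4 * N + 4 ≤ V)
    (hMN : M ≤ N + 1) (hZ : V.size + 2 ≤ Z) (hNM : N - M ≤ Z)
    (hS : Z * (V.size + 1) + 100 * Z * opCost V ≤ S)
    (hls : (M :: ls).length ≤ Z ∧ ∀ x ∈ M :: ls, x ≤ V)
    (hhs : (N :: hs).length ≤ Z ∧ ∀ x ∈ N :: hs, x ≤ V)
    (hds : ∀ d ∈ ds, 1 ≤ d ∧ 4 * d + 4 ≤ V) (hcount : markCount M N ds + 1 ≤ Z) :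
    Run V (Bounded S) sieve (St.of [] (M :: ls) (N :: hs) ds) (200 * Z * (V.size + 1))
      (St.of [] (M :: ls) (N :: hs) (sieved M N ds).reverse) :=
  run_sieve hM hN hMN hZ hNM hS (St.clean_of _ _ _ _) rfl rfl hds hcount
    (St.fits_of (by simp) hls hhs ⟨by have := length_le_markCount M N ds; omega,
      fun d hd => by have := hds d hd; omega⟩)

/-- The choice of `V` comes from `R ≤ 2 * N + 1` and `R' ≤ 2 * R + 1 ≤ 4 * N + 3`, since a sieve
requires `4 * R' + 4 ≤ V`. The interval ends wait on the stacks `lo` and `hi` in the order in which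
the rounds need them. -/
theorem run_listPrimes {M N R R' : ℕ} (hMN : M ≤ N) (hR : R = rootBound N) (hR' : R' = rootBound R)
    (hV : V = 16 * N + 32) (hZ : V.size + 8 ≤ Z) (hNM : N - M ≤ Z) (hRZ : R ≤ Z) (hRZ' : R' ≤ Z)
    (hS : Z * (V.size + 1) + 100 * Z * opCost V ≤ S) {D1 D2 D3 : List ℕ}
    (hD1 : D1 = (sieved 1 R' []).reverse) (hD2 : D2 = (sieved 1 R' D1).reverse)
    (hD3 : D3 = (sieved 1 R D2).reverse) (hc1 : markCount 1 R' D1 + 1 ≤ Z)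
    (hc2 : markCount 1 R D2 + 1 ≤ Z) (hc3 : markCount (max M 1) N D3 + 1 ≤ Z) :
    ∃ s', Run V (Bounded S) listPrimes (St.of [M, N] [] [] []) (1000 * Z * (V.size + 1)) s' ∧
      s'.out = sieved (max M 1) N D3 := by
  have hRV : R ≤ 2 * N + 1 := hR ▸ rootBound_le N
  have hRV' : R' ≤ 2 * R + 1 := hR' ▸ rootBound_le R
  have hRpos : 1 ≤ R := hR ▸ rootBound_pos N
  have hRpos' : 1 ≤ R' := hR' ▸ rootBound_pos R
  have hmem : ∀ {M N : ℕ} {ds : List ℕ} {x : ℕ}, x ∈ (sieved M N ds).reverse → M < x ∧ x ≤ N :=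
    fun h => by
      rw [List.mem_reverse, mem_sieved] at h
      exact ⟨h.1, h.2.1⟩
  have hchunk : ∀ n, n ≤ 100 * Z → Z * (V.size + 1) + n * opCost V ≤ S := fun n hn =>
    le_trans (Nat.add_le_add_left (Nat.mul_le_mul_right _ hn) _) hS
  have a1 := run_move (V := V) .inp .lo (by decide) (s := St.of [M, N] [] [] []) rfl (by omega)
  have a2 := run_move (V := V) .inp .hi (by decide) (s := St.of [N] [M] [] []) rfl (by omega)
  -- The number `1` would survive every sieve by divisors `d ≥ 2`, so the lower end is raised to at
  -- least `1`.
  have a3 : Run V Free (.ite (isZero .lo) (inc .lo) skip) (St.of [] [M] [N] []) 3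
      (St.of [] [max M 1] [N] []) := by
    have hz := isZero_eq (i := .lo) (s := St.of [] [M] [N] []) (x := M) (l := []) rfl
    rcases Nat.eq_zero_or_pos M with rfl | h
    · exact Run.ite_true hz (run_inc (V := V) .lo (by decide) (s := St.of [] [0] [N] []) (x := 0)
        (l := []) rfl (by omega) (by omega))
    · rw [max_eq_left (by omega : 1 ≤ M)]
      exact (Run.ite_false (by rw [hz]; simpa using h.ne') (run_skip _)).mono (by omega)
  have a4 := run_root (V := V) (s := St.of [] [max M 1] [N] []) (n := N) (hs := []) rfl (by omega)
    (by omega)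
  rw [← hR] at a4
  have a5 := run_root (V := V) (s := St.of [] [max M 1] [R, N] []) (n := R) (hs := [N]) rfl
    (by omega) (by omega)
  rw [← hR'] at a5
  have a6 := run_pushOne (V := V) .lo (St.of [] [max M 1] [R', R, N] [])
  have A := (a1.seq (a2.seq (a3.seq (a4.seq (a5.seq a6))))).bounded_of_fits (S := S)
    (St.fits_of (V := V) (Z := Z) ⟨by simp; omega, by simp; omega⟩ (by simp) (by simp) (by simp))
    (hchunk _ (by omega))
  have hlo : [1, max M 1].length ≤ Z ∧ ∀ x ∈ [1, max M 1], x ≤ V :=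
    ⟨by simp; omega, by simp; omega⟩
  -- Without divisors nothing is marked, and the sieve lists all integers from `2` to `R'`.
  have b1 := run_sieve_of (V := V) (Z := Z) (S := S) (M := 1) (N := R') (ls := [max M 1])
    (hs := [R, N]) (ds := []) (by omega) (by omega) (by omega) (by omega) (by omega) hS hlo
    ⟨by simp; omega, by simp; omega⟩ (by simp) (by simp [markCount]; omega)
  rw [← hD1] at b1
  have b2 := run_sieve_of (V := V) (Z := Z) (S := S) (M := 1) (N := R') (ls := [max M 1])
    (hs := [R, N]) (ds := D1) (by omega) (by omega) (by omega) (by omega) (by omega) hS hlo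
    ⟨by simp; omega, by simp; omega⟩ (fun d hd => by rw [hD1] at hd; have := hmem hd; omega) hc1
  rw [← hD2] at b2
  have hfit : ∀ lo hi ds N', (lo.length ≤ Z ∧ ∀ x ∈ lo, x ≤ V) → (hi.length ≤ Z ∧ ∀ x ∈ hi, x ≤ V) →
      N' ≤ V → (∀ x ∈ ds, x ≤ N') → ds.length ≤ Z → (St.of [] lo hi ds).Fits V Z :=
    fun lo hi ds N' h1 h2 h3 h4 h5 =>
      St.fits_of (by simp) h1 h2 ⟨h5, fun x hx => (h4 x hx).trans h3⟩
  have hD2mem : ∀ x ∈ D2, 1 < x ∧ x ≤ R' := fun x hx => by rw [hD2] at hx; exact hmem hx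
  have hD3mem : ∀ x ∈ D3, 1 < x ∧ x ≤ R := fun x hx => by rw [hD3] at hx; exact hmem hx
  have c1 := (run_drop (V := V) .hi (s := St.of [] [1, max M 1] [R', R, N] D2) (x := R')
    (l := [R, N]) rfl (by omega)).bounded_of_fits (S := S)
    (hfit _ _ _ R' hlo ⟨by simp; omega, by simp; omega⟩ (by omega) (fun x hx => (hD2mem x hx).2)
      (by rw [hD2, List.length_reverse]; exact (length_sieved_le _ _ _).trans (by omega)))
    (hchunk _ (by omega))
  have b3 := run_sieve_of (V := V) (Z := Z) (S := S) (M := 1) (N := R) (ls := [max M 1])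
    (hs := [N]) (ds := D2) (by omega) (by omega) (by omega) (by omega) (by omega) hS hlo
    ⟨by simp; omega, by simp; omega⟩ (fun d hd => by have := hD2mem d hd; omega) hc2
  rw [← hD3] at b3
  have c2 := run_drop (V := V) .hi (s := St.of [] [1, max M 1] [R, N] D3) (x := R)
    (l := [N]) rfl (by omega)
  have c3 := run_drop (V := V) .lo (s := St.of [] [1, max M 1] [N] D3) (x := 1)
    (l := [max M 1]) rfl (by omega)
  have c4 := (c2.seq c3).bounded_of_fits (S := S)
    (hfit _ _ _ R hlo ⟨by simp; omega, by simp; omega⟩ (by omega) (fun x hx => (hD3mem x hx).2)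
      (by rw [hD3, List.length_reverse]; exact (length_sieved_le _ _ _).trans (by omega)))
    (hchunk _ (by omega))
  have b4 := run_sieve_of (V := V) (Z := Z) (S := S) (M := max M 1) (N := N) (ls := [])
    (hs := []) (ds := D3) (by omega) (by omega) (by omega) (by omega) (by omega) hS
    ⟨by simp; omega, by simp; omega⟩
    ⟨by simp; omega, by simp; omega⟩ (fun d hd => by have := hD3mem d hd; omega) hc3
  set D4 := sieved (max M 1) N D3 with hD4
  have hD4mem : ∀ x ∈ D4.reverse, x ≤ V := fun x hx => by have := hmem hx; omega
  have hD4len : D4.length ≤ Z := (length_sieved_le _ _ _).trans (by omega)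
  have d1 := run_pour (V := V) .div .num (by decide) D4.reverse
    (s := St.of [] [max M 1] [N] D4.reverse) rfl hD4mem
  have d2 := run_writeAll (V := V) D4
    { St.of [] [max M 1] [N] [] with num := D4.reverse.reverse ++ [] } (by simp)
    (fun x hx => hD4mem x (List.mem_reverse.2 hx))
  have d3 := (d1.seq d2).bounded_of_fits (S := S)
    (hfit _ _ _ N ⟨by simp; omega, by simp; omega⟩ ⟨by simp; omega, by simp; omega⟩ (by omega)
      (fun x hx => (hmem hx).2) (by simpa using hD4len))
    (hchunk _ (by rw [List.length_reverse]; omega))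
  refine ⟨_, (A.seq (b1.seq (b2.seq (c1.seq (b3.seq (c4.seq (b4.seq d3))))))).mono ?_, rfl⟩
  rw [List.length_reverse]
  have h1 : 1000 * Z * (V.size + 1) = 5 * (200 * Z * (V.size + 1)) := by ring
  have h2 : 200 * Z * (V.size + 1) = 200 * (Z * V.size) + 200 * Z := by ring
  omega

end Main

/-! ### The sieve produces the primes -/

theorem mem_primesBetween {M N n : ℕ} : n ∈ primesBetween M N ↔ M < n ∧ n ≤ N ∧ n.Prime := by
  simp only [primesBetween, List.mem_filter, List.mem_range, decide_eq_true_eq]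
  constructor
  · rintro ⟨h1, h2, h3⟩; exact ⟨h2, by omega, h3⟩
  · rintro ⟨h1, h2, h3⟩; exact ⟨by omega, h1, h3⟩

theorem primesBetween_max_one (M N : ℕ) : primesBetween (max M 1) N = primesBetween M N := by
  unfold primesBetween
  refine List.filter_congr fun n _ => ?_
  rw [decide_eq_decide]
  constructor
  · rintro ⟨h1, h2⟩; exact ⟨by omega, h2⟩
  · rintro ⟨h1, h2⟩; exact ⟨by have := h2.one_lt; omega, h2⟩

/-- Sieving by a set of divisors that contains the primes up to the square root leaves the
primes. -/
theorem sieved_eq_primesBetween {M N : ℕ} {ds : List ℕ} (hM : 1 ≤ M) (hds : ∀ d ∈ ds, 2 ≤ d)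
    (hp : ∀ p : ℕ, p.Prime → p * p ≤ N → p ∈ ds) : sieved M N ds = primesBetween M N := by
  unfold sieved primesBetween
  refine List.filter_congr fun n hn => ?_
  rw [List.mem_range] at hn
  rw [decide_eq_decide]
  refine and_congr_right fun hMn => ⟨fun h => ?_, fun h d hd hdn => ?_⟩
  · by_contra hnp
    have h2 : 2 ≤ n := by omega
    -- The least prime factor `p` of a composite `n` has `p * p ≤ n`, so it is among the divisors,
    -- and `2 * p ≤ p * p ≤ n` makes `n` a proper multiple.
    have hmp := Nat.minFac_prime (n := n) (by omega)
    have hsq := Nat.minFac_sq_le_self (by omega) hnp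
    rw [sq] at hsq
    refine h _ (hp _ hmp (by omega)) ⟨Nat.minFac_dvd n, le_trans ?_ hsq⟩
    exact Nat.mul_le_mul_right _ hmp.two_le
  -- A divisor `d ≥ 2` of a prime is the prime itself, against `2 * d ≤ n`. Composite divisors in
  -- `ds` do no harm.
  · have := hds d hd
    rcases h.eq_one_or_self_of_dvd d hdn.1 with h1 | h1 <;> omega

theorem mem_sieved_nil {M N n : ℕ} : n ∈ sieved M N [] ↔ M < n ∧ n ≤ N := by
  rw [mem_sieved]; simp

/-- Three rounds of sieving, by all numbers up to the fourth root, by the primes up to the fourth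
root and by the primes up to the square root. -/
theorem sieved_rounds {M N R R' : ℕ} (hR : N < R * R) (hR' : R < R' * R') :
    sieved 1 R' (sieved 1 R' []).reverse = primesBetween 1 R' ∧
    sieved 1 R (primesBetween 1 R').reverse = primesBetween 1 R ∧
    sieved (max M 1) N (primesBetween 1 R).reverse = primesBetween M N := by
  refine ⟨sieved_eq_primesBetween le_rfl (fun d hd => ?_) fun p hp hpp => ?_,
    sieved_eq_primesBetween le_rfl (fun d hd => ?_) fun p hp hpp => ?_, ?_⟩
  · rw [List.mem_reverse, mem_sieved_nil] at hd; omega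
  · rw [List.mem_reverse, mem_sieved_nil]
    exact ⟨hp.one_lt, (Nat.le_mul_self p).trans hpp⟩
  · rw [List.mem_reverse, mem_primesBetween] at hd; omega
  · rw [List.mem_reverse, mem_primesBetween]
    exact ⟨hp.one_lt, (Nat.mul_self_lt_mul_self_iff.1 (hpp.trans_lt hR')).le, hp⟩
  · rw [← primesBetween_max_one M]
    refine sieved_eq_primesBetween (by omega) (fun d hd => ?_) fun p hp hpp => ?_
    · rw [List.mem_reverse, mem_primesBetween] at hd; omega
    · rw [List.mem_reverse, mem_primesBetween]
      exact ⟨hp.one_lt, (Nat.mul_self_lt_mul_self_iff.1 (hpp.trans_lt hR)).le, hp⟩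

/-- The sum of the reciprocals of primes is estimated by dyadic intervals, hence only up to powers
of two. -/
theorem exists_rootBound_eq_two_pow (n : ℕ) : ∃ k, rootBound n = 2 ^ k := by
  induction n using Nat.strong_induction_on with
  | _ n ih =>
    rcases Nat.eq_zero_or_pos n with h | h
    · exact ⟨0, by rw [h, rootBound_zero, pow_zero]⟩
    · obtain ⟨k, hk⟩ := ih (n / 4) (by omega)
      exact ⟨k + 1, by rw [rootBound_of_ne (by omega), hk, pow_succ, mul_comm]⟩

/-! ### Reciprocals of primes -/

open Finset in
/-- The primes in a dyadic interval, by Chebyshev's upper bound. -/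
theorem card_dyadic_primes_le (k : ℕ) :
    k * #{p ∈ Ioc (2 ^ k) (2 ^ (k + 1)) | p.Prime} ≤ 4 * 2 ^ k := by
  set A := {p ∈ Ioc (2 ^ k) (2 ^ (k + 1)) | p.Prime} with hA
  -- The primes in the interval exceed `2 ^ k`, and their product is at most the primorial, hence at
  -- most `4 ^ 2 ^ (k + 1) = 2 ^ (4 * 2 ^ k)`. Exponents are then compared.
  have h1 : (2 ^ k) ^ #A ≤ primorial (2 ^ (k + 1)) := by
    calc (2 ^ k) ^ #A = ∏ _p ∈ A, 2 ^ k := by rw [prod_const]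
      _ ≤ ∏ p ∈ A, p := prod_le_prod' fun p hp => by
          rw [hA, mem_filter, mem_Ioc] at hp; exact hp.1.1.le
      _ ≤ primorial (2 ^ (k + 1)) := by
          unfold primorial
          refine prod_le_prod_of_subset_of_one_le' (fun p hp => ?_) fun p hp _ => ?_
          · rw [hA, mem_filter, mem_Ioc] at hp
            rw [mem_filter, mem_range]
            exact ⟨by omega, hp.2⟩
          · rw [mem_filter] at hp; exact hp.2.one_lt.le
  have h2 := h1.trans (primorial_le_four_pow _)
  rw [← pow_mul, show (4 : ℕ) = 2 ^ 2 by norm_num, ← pow_mul,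
    Nat.pow_le_pow_iff_right (by norm_num)] at h2
  rw [pow_succ] at h2
  omega

open Finset in
/-- A weak form of Mertens' second theorem. -/
theorem sum_inv_primes_two_pow_le (k : ℕ) :
    ∑ p ∈ Icc (1 : ℕ) (2 ^ (k + 1)) with p.Prime, 1 / (p : ℝ) ≤ 1 / 2 + 4 * harmonic k := by
  induction k with
  | zero =>
    have : {p ∈ Icc 1 (2 ^ (0 + 1)) | p.Prime} = {2} := by decide
    rw [this]; simp
  | succ k ih =>
    have hsplit : {p ∈ Icc 1 (2 ^ (k + 1 + 1)) | p.Prime} =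
        {p ∈ Icc 1 (2 ^ (k + 1)) | p.Prime} ∪
          {p ∈ Ioc (2 ^ (k + 1)) (2 ^ (k + 1 + 1)) | p.Prime} := by
      rw [← filter_union]
      congr 1
      ext p
      have : 2 ^ (k + 1) ≤ 2 ^ (k + 1 + 1) := Nat.pow_le_pow_right (by norm_num) (by omega)
      have : 1 ≤ 2 ^ (k + 1) := Nat.one_le_two_pow
      simp only [mem_union, mem_Icc, mem_Ioc]
      omega
    have hdisj : Disjoint {p ∈ Icc 1 (2 ^ (k + 1)) | p.Prime}
        {p ∈ Ioc (2 ^ (k + 1)) (2 ^ (k + 1 + 1)) | p.Prime} := by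
      rw [disjoint_left]
      intro p hp hq
      rw [mem_filter, mem_Icc] at hp
      rw [mem_filter, mem_Ioc] at hq
      omega
    -- At most `4 * 2 ^ (k + 1) / (k + 1)` primes contribute at most `1 / 2 ^ (k + 1)` each; the
    -- quotient `4 / (k + 1)` is the next term of `4 * harmonic`.
    have hd : ∑ p ∈ Ioc ((2 : ℕ) ^ (k + 1)) (2 ^ (k + 1 + 1)) with p.Prime, 1 / (p : ℝ)
        ≤ 4 / (k + 1) := by
      have hc : ((k : ℝ) + 1) * #{p ∈ Ioc (2 ^ (k + 1)) (2 ^ (k + 1 + 1)) | p.Prime}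
          ≤ 4 * 2 ^ (k + 1) := by exact_mod_cast card_dyadic_primes_le (k + 1)
      have h1 : ∑ p ∈ Ioc ((2 : ℕ) ^ (k + 1)) (2 ^ (k + 1 + 1)) with p.Prime, 1 / (p : ℝ)
          ≤ #{p ∈ Ioc (2 ^ (k + 1)) (2 ^ (k + 1 + 1)) | p.Prime} • (1 / 2 ^ (k + 1) : ℝ) := by
        refine sum_le_card_nsmul _ _ _ fun p hp => ?_
        rw [mem_filter, mem_Ioc] at hp
        exact one_div_le_one_div_of_le (by positivity) (by exact_mod_cast hp.1.1.le)
      refine h1.trans ?_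
      rw [nsmul_eq_mul, mul_one_div, div_le_div_iff₀ (by positivity) (by positivity)]
      linarith
    rw [hsplit, sum_union hdisj, harmonic_succ]
    push_cast
    have : (4 : ℝ) / (k + 1) = 4 * ((k : ℝ) + 1)⁻¹ := by rw [div_eq_mul_inv]
    linarith

-- The exponent is `O(log N)`, so the harmonic number is at most `1 + 2 + log log N`, and `1 / 2 + 4
-- * 3 ≤ 13`. The allowance `8 * N` covers both root bounds.
open Finset in
theorem sum_inv_primes_le {N k : ℕ} (hN : 3 ≤ N) (hk : 2 ^ k ≤ 8 * N) :
    ∑ p ∈ Icc (1 : ℕ) (2 ^ k) with p.Prime, 1 / (p : ℝ) ≤ 13 + 4 * Real.log (Real.log N) := by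
  have hNr : (3 : ℝ) ≤ N := by exact_mod_cast hN
  have hlog : 1 < Real.log N := by
    rw [Real.lt_log_iff_exp_lt (by linarith)]
    exact Real.exp_one_lt_three.trans_le hNr
  have hll : 0 < Real.log (Real.log N) := Real.log_pos hlog
  cases k with
  | zero =>
    have : {p ∈ Icc 1 (2 ^ 0) | p.Prime} = ∅ := by decide
    rw [this, sum_empty]; linarith
  | succ k =>
    refine (sum_inv_primes_two_pow_le k).trans ?_
    have hk' : (k : ℝ) ≤ 6 * Real.log N := by
      have h1 : (2 : ℝ) ^ k ≤ 4 * N := by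
        have : 2 ^ k ≤ 4 * N := by rw [pow_succ] at hk; omega
        exact_mod_cast this
      have h2 := Real.log_le_log (by positivity) h1
      rw [Real.log_pow, Real.log_mul (by norm_num) (by linarith),
        show (4 : ℝ) = 2 ^ 2 by norm_num, Real.log_pow] at h2
      have := Real.log_two_gt_d9
      have := Real.log_two_lt_d9
      push_cast at h2
      nlinarith
    have h3 : (harmonic k : ℝ) ≤ 1 + Real.log k := harmonic_le_one_add_log k
    have h4 : Real.log k ≤ 2 + Real.log (Real.log N) := by
      rcases Nat.eq_zero_or_pos k with h | h
      · rw [h, Nat.cast_zero, Real.log_zero]; linarith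
      · have h5 := Real.log_le_log (by exact_mod_cast h) hk'
        rw [Real.log_mul (by norm_num) (by linarith)] at h5
        have h6 : Real.log 6 ≤ 2 := by
          rw [Real.log_le_iff_le_exp (by norm_num), show (2 : ℝ) = 1 + 1 by norm_num, Real.exp_add]
          nlinarith [Real.exp_one_gt_d9]
        linarith
    linarith

/-! ### The number of marks -/

/-- A crude bound, enough for the round in which all integers up to the fourth root serve as
divisors. -/
theorem markCount_le_mul {M N K : ℕ} {ds : List ℕ} (hK : N - M + 1 ≤ K) :
    markCount M N ds ≤ ds.length * K := by
  unfold markCount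
  refine (List.sum_le_card_nsmul _ K fun x hx => ?_).trans (by simp)
  obtain ⟨d, _, rfl⟩ := List.mem_map.1 hx
  exact (Nat.add_le_add_right (Nat.div_le_self _ _) 1).trans hK

open Finset in
theorem markCount_primesBetween_le (M N B : ℕ) :
    (markCount M N (primesBetween 1 B).reverse : ℝ) ≤
      ((N - M : ℕ) : ℝ) * ∑ p ∈ Icc (1 : ℕ) B with p.Prime, 1 / (p : ℝ) + B := by
  have hnd : (primesBetween 1 B).Nodup := List.Nodup.filter _ List.nodup_range
  have hset : (primesBetween 1 B).toFinset = {p ∈ Icc 1 B | p.Prime} := by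
    ext p
    rw [List.mem_toFinset, mem_primesBetween, mem_filter, mem_Icc]
    exact ⟨fun h => ⟨⟨h.1.le, h.2.1⟩, h.2.2⟩, fun h => ⟨h.2.one_lt, h.1.2, h.2⟩⟩
  unfold markCount
  rw [List.map_reverse, List.sum_reverse, ← List.sum_toFinset _ hnd, hset]
  push_cast
  rw [sum_add_distrib, mul_sum]
  refine add_le_add (sum_le_sum fun p _ => ?_) ?_
  · rw [mul_one_div]; exact Nat.cast_div_le
  · rw [sum_const, nsmul_eq_mul, mul_one]
    exact_mod_cast (card_filter_le _ _).trans (by simp)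

/-! ### The resources -/

theorem one_lt_log {N : ℕ} (hN : 3 ≤ N) : 1 < Real.log N := by
  have hNr : (3 : ℝ) ≤ N := by exact_mod_cast hN
  rw [Real.lt_log_iff_exp_lt (by linarith)]
  exact Real.exp_one_lt_three.trans_le hNr

/-- For `N ≥ 3` one has `16 * N + 32 ≤ 27 * N ≤ N ^ 4`, and `4 / log 2 + 2 < 8`. -/
theorem size_le_log {N : ℕ} (hN : 3 ≤ N) : ((16 * N + 32).size : ℝ) + 1 ≤ 8 * Real.log N := by
  have hNr : (3 : ℝ) ≤ N := by exact_mod_cast hN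
  have hlog := one_lt_log hN
  obtain ⟨m, hm⟩ : ∃ m, (16 * N + 32).size = m + 1 :=
    Nat.exists_eq_succ_of_ne_zero (by rw [Ne, Nat.size_eq_zero]; omega)
  have h1 : 2 ^ m ≤ 16 * N + 32 := by rw [← Nat.lt_size]; omega
  have h2 : (2 : ℝ) ^ m ≤ 27 * N := by
    have : 2 ^ m ≤ 27 * N := by omega
    exact_mod_cast this
  have h3 := Real.log_le_log (by positivity) h2
  have h4 : Real.log 3 ≤ Real.log N := Real.log_le_log (by norm_num) hNr
  rw [Real.log_pow, Real.log_mul (by norm_num) (by linarith),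
    show (27 : ℝ) = 3 ^ 3 by norm_num, Real.log_pow] at h3
  have := Real.log_two_gt_d9
  rw [hm]
  push_cast at h3 ⊢
  nlinarith

theorem log_le_two_mul_sqrt {x : ℝ} (hx : 0 < x) : Real.log x ≤ 2 * √x := by
  have h := Real.log_le_sub_one_of_pos (Real.sqrt_pos.2 hx)
  rw [Real.log_sqrt hx.le] at h
  linarith

/-- The parameter `Z` bounds all the sizes that occur while the primes in `(M, N]` are listed. -/
structure Budget (M N Z : ℕ) : Prop where
  le : M ≤ N
  size : (16 * N + 32).size + 8 ≤ Z
  sub : N - M ≤ Z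
  root : rootBound N ≤ Z
  root_root : rootBound (rootBound N) ≤ Z
  marks₁ : markCount 1 (rootBound (rootBound N))
    (sieved 1 (rootBound (rootBound N)) []).reverse + 1 ≤ Z
  marks₂ : markCount 1 (rootBound N) (primesBetween 1 (rootBound (rootBound N))).reverse + 1 ≤ Z
  marks₃ : markCount (max M 1) N (primesBetween 1 (rootBound N)).reverse + 1 ≤ Z

/-- `Z` is the sum of all quantities it has to bound. `R * R ≤ 4 * N` gives `R ≤ 2 * √N`; the first
round makes at most `R' * R' ≤ 4 * R` marks, and the other two are bounded by reciprocals of primes.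
Summands without `log log N` are absorbed by `K`, because `log log N ≥ log log 3 > 0`. -/
theorem exists_budget : ∃ C : ℝ, 0 ≤ C ∧ ∀ M N : ℕ, M ≤ N → ∃ Z : ℕ, Budget M N Z ∧
    (3 ≤ N → (Z : ℝ) ≤ C * (((N : ℝ) - M + √N) * Real.log (Real.log N))) := by
  set K : ℝ := (Real.log (Real.log 3))⁻¹ with hK
  have hlog3 : 1 < Real.log 3 := by exact_mod_cast one_lt_log le_rfl
  have hK0 : 0 < K := inv_pos.2 (Real.log_pos hlog3)
  refine ⟨80 * K + 8, by positivity, fun M N hMN => ?_⟩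
  set R := rootBound N with hR
  set R' := rootBound R with hR'
  set m1 := markCount 1 R' (sieved 1 R' []).reverse with hm1
  set m2 := markCount 1 R (primesBetween 1 R').reverse with hm2
  set m3 := markCount (max M 1) N (primesBetween 1 R).reverse with hm3
  refine ⟨(16 * N + 32).size + 8 + (N - M) + R + R' + (m1 + 1) + (m2 + 1) + (m3 + 1),
    ⟨hMN, by omega, by omega, show R ≤ _ by omega, show R' ≤ _ by omega, show m1 + 1 ≤ _ by omega,
      show m2 + 1 ≤ _ by omega, show m3 + 1 ≤ _ by omega⟩, fun hN => ?_⟩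
  have hNr : (3 : ℝ) ≤ N := by exact_mod_cast hN
  have hlog := one_lt_log hN
  set ℓ := Real.log (Real.log N) with hℓ
  have hℓ0 : 0 < ℓ := Real.log_pos hlog
  have hKℓ : 1 ≤ K * ℓ := by
    rw [hK, inv_mul_eq_div, one_le_div (Real.log_pos hlog3)]
    exact Real.log_le_log (by linarith) (Real.log_le_log (by norm_num) hNr)
  set Q := √(N : ℝ) with hQ
  have hQ1 : 1 ≤ Q := Real.one_le_sqrt.2 (by linarith)
  have hRpos : 0 < R := rootBound_pos N
  have hRQ : (R : ℝ) ≤ 2 * Q := by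
    have h1 : (R : ℝ) * R ≤ 4 * N := by exact_mod_cast rootBound_sq_le (n := N) (by omega)
    have h2 : Q * Q = N := Real.mul_self_sqrt (by linarith)
    nlinarith
  have hR'R' : R' * R' ≤ 4 * R := rootBound_sq_le (by omega)
  have hR'le : R' ≤ 2 * R + 1 := rootBound_le R
  have hRle : R ≤ 2 * N + 1 := rootBound_le N
  obtain ⟨k, hk⟩ := exists_rootBound_eq_two_pow N
  obtain ⟨k', hk'⟩ := exists_rootBound_eq_two_pow R
  rw [← hR] at hk
  rw [← hR'] at hk'
  have hs : ((16 * N + 32).size : ℝ) ≤ 16 * Q := by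
    have := size_le_log hN
    have := log_le_two_mul_sqrt (x := N) (by linarith)
    linarith
  have b1 : (m1 : ℝ) ≤ 8 * Q := by
    have h1 : m1 ≤ R' * R' := by
      have hlen := length_sieved_le 1 R' []
      have hpos : 0 < R' := rootBound_pos R
      refine (markCount_le_mul (K := R') (by omega)).trans (Nat.mul_le_mul_right _ ?_)
      rw [List.length_reverse]; omega
    have h2 : (m1 : ℝ) ≤ 4 * R := by exact_mod_cast h1.trans hR'R'
    linarith
  have hR'r : (R' : ℝ) ≤ 5 * Q := by
    have : (R' : ℝ) ≤ 2 * R + 1 := by exact_mod_cast hR'le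
    linarith
  have b2 : (m2 : ℝ) ≤ 2 * Q * (13 + 4 * ℓ) + 5 * Q := by
    refine (markCount_primesBetween_le 1 R R').trans (add_le_add ?_ hR'r)
    refine mul_le_mul (le_trans ?_ hRQ) ?_ (Finset.sum_nonneg fun _ _ => by positivity)
      (by linarith)
    · exact_mod_cast Nat.sub_le _ _
    · rw [hk']; exact sum_inv_primes_le hN (by omega)
  have hL : ((N - M : ℕ) : ℝ) = N - M := Nat.cast_sub hMN
  have hL0 : (0 : ℝ) ≤ N - M := by rw [← hL]; positivity
  have b3 : (m3 : ℝ) ≤ (N - M) * (13 + 4 * ℓ) + 2 * Q := by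
    refine (markCount_primesBetween_le (max M 1) N R).trans (add_le_add ?_ hRQ)
    refine mul_le_mul ?_ ?_ (Finset.sum_nonneg fun _ _ => by positivity) hL0
    · rw [← hL]; exact_mod_cast Nat.sub_le_sub_left (le_max_left _ _) _
    · rw [hk]; exact sum_inv_primes_le hN (by omega)
  have key : (((16 * N + 32).size + 8 + (N - M) + R + R' + (m1 + 1) + (m2 + 1) + (m3 + 1) : ℕ) : ℝ)
      ≤ ((N : ℝ) - M + Q) * (80 + 8 * ℓ) := by
    push_cast [hL]
    nlinarith [mul_nonneg hL0 hℓ0.le, mul_nonneg (by linarith : (0 : ℝ) ≤ Q) hℓ0.le]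
  refine key.trans ?_
  have : (80 + 8 * ℓ) ≤ (80 * K + 8) * ℓ := by nlinarith
  calc ((N : ℝ) - M + Q) * (80 + 8 * ℓ) ≤ ((N : ℝ) - M + Q) * ((80 * K + 8) * ℓ) :=
        mul_le_mul_of_nonneg_left this (by linarith)
    _ = _ := by ring

theorem Budget.run_listPrimes {M N Z V S : ℕ} (h : Budget M N Z) (hV : V = 16 * N + 32)
    (hS : Z * (V.size + 1) + 100 * Z * opCost V ≤ S) :
    ∃ s', Run V (Bounded S) listPrimes (St.of [M, N] [] [] []) (1000 * Z * (V.size + 1)) s' ∧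
      s'.out = primesBetween M N := by
  obtain ⟨e1, e2, e3⟩ := sieved_rounds (M := M) (lt_rootBound_sq N) (lt_rootBound_sq (rootBound N))
  obtain ⟨s', hrun, hout⟩ := TapeProgram.run_listPrimes h.le rfl rfl hV (by rw [hV]; exact h.size)
    h.sub h.root h.root_root hS rfl (by rw [e1]) (by rw [e2]) h.marks₁ h.marks₂ h.marks₃
  exact ⟨s', hrun, hout.trans e3⟩

/-- The program that lists the primes up to `N`. -/
def listPrimesUpTo : Prog Tape := .seq (pushZero .inp) listPrimes

theorem Budget.run_listPrimesUpTo {N Z V S : ℕ} (h : Budget 0 N Z) (hV : V = 16 * N + 32)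
    (hS : Z * (V.size + 1) + 100 * Z * opCost V ≤ S) :
    ∃ s', Run V (Bounded S) listPrimesUpTo (St.of [N] [] [] []) (1001 * Z * (V.size + 1)) s' ∧
      s'.out = primesBetween 0 N := by
  obtain ⟨s', hrun, hout⟩ := h.run_listPrimes hV hS
  have hZ := h.size
  refine ⟨s', (((run_pushZero (V := V) .inp (St.of [N] [] [] [])).bounded_of_fits (Z := Z)
    (St.fits_of ⟨by simp; omega, by simp; omega⟩ (by simp) (by simp) (by simp)) ?_).seq hrun).mono
    ?_, hout⟩
  · refine (Nat.add_le_add_left (Nat.mul_le_mul_right _ ?_) _).trans hS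
    omega
  · have : 1 ≤ Z * (V.size + 1) := Nat.mul_pos (by omega) (by omega)
    rw [mul_assoc, mul_assoc]
    omega

/-- A program that lists primes within a budget gives a Turing machine with the resource bounds. -/
theorem exists_resource_bound (p : Prog Tape) (inp : ℕ → ℕ → List ℕ) (dom : ℕ → ℕ → Prop)
    (hdom : ∀ M N, dom M N → M ≤ N)
    (hrun : ∀ M N Z V S, dom M N → Budget M N Z → V = 16 * N + 32 →
      Z * (V.size + 1) + 100 * Z * opCost V ≤ S →
      ∃ s', Run V (Bounded S) p (St.of (inp M N) [] [] []) (1001 * Z * (V.size + 1)) s' ∧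
        s'.out = primesBetween M N) :
    ∃ C : ℝ, 0 ≤ C ∧ ∀ M N : ℕ, dom M N → ∃ t : ℕ,
      (p.machine (.reg .inp) .out).OutputsWithin (listWord (inp M N))
        (listWord (primesBetween M N)) t ∧
      (3 ≤ N →
        (t : ℝ) ≤ C * (((N : ℝ) - M + √N) * Real.log N ^ 2 * Real.log (Real.log N)) ∧
        ((p.machine (.reg .inp) .out).space (listWord (inp M N)) t : ℝ) ≤
          C * (((N : ℝ) - M + √N) * Real.log N * Real.log (Real.log N))) := by
  obtain ⟨C, hC, hbud⟩ := exists_budget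
  obtain ⟨c, hc⟩ : ∃ c : ℝ, c = ((Fintype.card Tape : ℕ) : ℝ) := ⟨_, rfl⟩
  have hc0 : 0 ≤ c := hc ▸ Nat.cast_nonneg _
  refine ⟨(50000 * 64 + c * 3000 * 8) * C, by positivity, fun M N hMN => ?_⟩
  obtain ⟨Z, hZ, hZle⟩ := hbud M N (hdom M N hMN)
  set V := 16 * N + 32 with hV
  have hZ1 : 1 ≤ Z := by have := hZ.size; omega
  have hZB : 1 ≤ Z * (V.size + 1) := Nat.mul_pos hZ1 (by omega)
  -- Here `2001 = 1 + 100 * 20`, the `20` being the factor in `opCost`.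
  obtain ⟨s', ⟨t, ht, hexec⟩, hout⟩ := hrun M N Z V (2001 * (Z * (V.size + 1))) hMN hZ hV
    (by unfold opCost; apply le_of_eq; ring)
  rw [enc_of] at hexec
  obtain ⟨h1, h2⟩ := p.machine_spec (.reg .inp) .out (by simp) (listWord (inp M N))
    (listWord (primesBetween M N)) (2001 * (Z * (V.size + 1))) t (enc s') (by omega) hexec
    (by rw [← hout]; rfl)
  refine ⟨2 * t + 1, h1, fun hN => ?_⟩
  have hsize := size_le_log hN
  rw [← hV] at hsize
  have hlog := one_lt_log hN
  set L := Real.log N with hL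
  have hX := hZle hN
  set X : ℝ := ((N : ℝ) - M + √N) * Real.log L with hXdef
  have hZ0 : (0 : ℝ) ≤ Z := Nat.cast_nonneg _
  have hX0 : 0 ≤ X := by
    refine mul_nonneg ?_ (Real.log_pos hlog).le
    have : (M : ℝ) ≤ N := by exact_mod_cast hdom M N hMN
    have := Real.sqrt_nonneg (N : ℝ)
    linarith
  have hCX : 0 ≤ C * X := mul_nonneg hC hX0
  have hB0 : (0 : ℝ) ≤ (V.size : ℝ) + 1 := by positivity
  have hZB8 : (Z : ℝ) * (V.size + 1) ≤ C * X * (8 * L) := mul_le_mul hX hsize hB0 hCX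
  constructor
  · have ht' : 2 * t + 1 ≤ 50000 * (Z * (V.size + 1) * (V.size + 1)) := by
      have h3 : 1 ≤ Z * (V.size + 1) * (V.size + 1) := Nat.mul_pos hZB (by omega)
      have h4 : 1001 * Z * (V.size + 1) * opCost V = 20020 * (Z * (V.size + 1) * (V.size + 1)) := by
        unfold opCost; ring
      omega
    have ht2 : ((2 * t + 1 : ℕ) : ℝ) ≤ 50000 * (Z * (V.size + 1) * (V.size + 1)) := by
      exact_mod_cast ht'
    have h5 : (Z : ℝ) * (V.size + 1) * (V.size + 1) ≤ C * X * (8 * L) * (8 * L) :=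
      mul_le_mul hZB8 hsize hB0 (by positivity)
    calc ((2 * t + 1 : ℕ) : ℝ) ≤ 50000 * (C * X * (8 * L) * (8 * L)) := by linarith
      _ = (50000 * 64) * C * (X * L ^ 2) := by ring
      _ ≤ (50000 * 64 + c * 3000 * 8) * C * (X * L ^ 2) := by
          refine mul_le_mul_of_nonneg_right (mul_le_mul_of_nonneg_right ?_ hC) (by positivity)
          linarith [mul_nonneg (mul_nonneg hc0 (by norm_num : (0 : ℝ) ≤ 3000))
            (by norm_num : (0 : ℝ) ≤ 8)]
      _ = _ := by rw [hXdef]; ring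
  · have h3 := h2.trans (Nat.mul_le_mul_left (Fintype.card Tape)
      (by omega : 2001 * (Z * (V.size + 1)) + 1 ≤ 3000 * (Z * (V.size + 1))))
    have h4 : (((p.machine (.reg .inp) .out).space (listWord (inp M N)) (2 * t + 1) : ℕ) : ℝ) ≤
        c * (3000 * (Z * (V.size + 1))) := by rw [hc]; exact_mod_cast h3
    calc _ ≤ c * (3000 * (Z * (V.size + 1) : ℝ)) := h4
      _ ≤ c * (3000 * (C * X * (8 * L))) := by gcongr
      _ = (c * 3000 * 8) * C * (X * L) := by ring
      _ ≤ (50000 * 64 + c * 3000 * 8) * C * (X * L) := by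
          refine mul_le_mul_of_nonneg_right (mul_le_mul_of_nonneg_right ?_ hC) (by positivity)
          linarith
      _ = _ := by rw [hXdef]; ring

end TapeProgram

theorem mainTheorem7 :
    (∃ (T : MultitapeTM) (C : ℝ), ∀ N : ℕ, ∃ t : ℕ,
      T.OutputsWithin (listWord [N]) (listWord (primesBetween 0 N)) t ∧
      (3 ≤ N →
        (t : ℝ) ≤ C * (N * Real.log N ^ 2 * Real.log (Real.log N)) ∧
        (T.space (listWord [N]) t : ℝ) ≤ C * (N * Real.log N * Real.log (Real.log N)))) ∧
    (∃ (T : MultitapeTM) (C : ℝ), ∀ M N : ℕ, M ≤ N → ∃ t : ℕ,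
      T.OutputsWithin (listWord [M, N]) (listWord (primesBetween M N)) t ∧
      (3 ≤ N →
        (t : ℝ) ≤ C * (((N : ℝ) - M + Real.sqrt N) * Real.log N ^ 2 * Real.log (Real.log N)) ∧
        (T.space (listWord [M, N]) t : ℝ) ≤
          C * (((N : ℝ) - M + Real.sqrt N) * Real.log N * Real.log (Real.log N)))) := by
  constructor
  · obtain ⟨C, hC, h⟩ := TapeProgram.exists_resource_bound TapeProgram.listPrimesUpTo
      (fun _ N => [N]) (fun M _ => M = 0) (fun M N h => by omega)
      (fun M N Z V S hM hZ hV hS => by subst hM; exact hZ.run_listPrimesUpTo hV hS)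
    -- The factor `2` pays for `√N ≤ N`.
    refine ⟨TapeProgram.listPrimesUpTo.machine (.reg .inp) .out, 2 * C, fun N => ?_⟩
    obtain ⟨t, h1, h2⟩ := h 0 N rfl
    refine ⟨t, h1, fun hN => ?_⟩
    obtain ⟨ht, hs⟩ := h2 hN
    have hlog := TapeProgram.one_lt_log hN
    have hll := Real.log_pos hlog
    have hNr : (1 : ℝ) ≤ N := by exact_mod_cast (by omega : 1 ≤ N)
    have hX : (N : ℝ) - (0 : ℕ) + √N ≤ 2 * N := by
      have : √(N : ℝ) ≤ N := Real.sqrt_le_iff.2 ⟨by linarith, by nlinarith⟩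
      push_cast
      linarith
    constructor
    · calc (t : ℝ) ≤ _ := ht
        _ ≤ C * (2 * N * Real.log N ^ 2 * Real.log (Real.log N)) := by gcongr
        _ = _ := by ring
    · calc _ ≤ _ := hs
        _ ≤ C * (2 * N * Real.log N * Real.log (Real.log N)) := by gcongr
        _ = _ := by ring
  · obtain ⟨C, _, h⟩ := TapeProgram.exists_resource_bound TapeProgram.listPrimes
      (fun M N => [M, N]) (fun M N => M ≤ N) (fun M N h => h)
      (fun M N Z V S hMN hZ hV hS => by
        obtain ⟨s', hr, ho⟩ := hZ.run_listPrimes hV hS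
        exact ⟨s', hr.mono (Nat.mul_le_mul_right _ (Nat.mul_le_mul_right _ (by norm_num))), ho⟩)
    exact ⟨_, C, h⟩
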